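/- **Conventions.** Let $\delta$ be an ordinal. A *$\delta$-ITTM$_0$* (a parameter-free infinite time Turing machine with tapes of length $\delta$) has three tapes whose cells are indexed by the ordinals below $\delta$, each cell containing $0$ or $1$, and one read/write head, which reads and writes the three cells at its position simultaneously. It is run by an ordinary finite Turing program with finitely many states $0,\dots,m$: depending on the state and the three symbols read, the program either halts, or writes three symbols, moves the head by at most one cell and changes the state; a move to the left from cell $0$ or from a limit cell leads to cell $0$. At time $0$ the state is $0$, the head is on cell $0$ and all cells contain $0$ (there is no input and there are no ordinal parameters). At a limit time, the state, the head position and the content of each cell are the inferior limits of their previous values, except that the head returns to cell $0$ if the inferior limit of its positions is $\delta$. A program *reaches* the cell $\alpha<\delta$ if its run halts at some ordinal time with the head exactly on cell $\alpha$. For $\delta\ge\omega$, a binary relation $E$ on $\omega$ *appears* on a tape at time $\tau$ if, for all $m,n<\omega$, $m\mathrel{E}n$ holds if and only if the cell with number $\langle m,n\rangle$ of this tape contains $1$ at time $\tau$, where $\langle\cdot,\cdot\rangle$ is a fixed recursive pairing bijection $\omega\times\omega\to\omega$. The *primitive recursive set functions* are those obtained from the constant $\emptyset$, the projections, $(x,y)\mapsto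 x\cup\{y\}$ and the function with value $x$ if $u\in v$ and $y$ otherwise, by composition and by the recursion $F(z,\vec x)=G\bigl(\bigcup\{F(u,\vec x):u\in z\},z,\vec x\bigr)$. The ordinal $\delta$ is *primitive recursively closed* if every ordinal that is the value of a primitive recursive set function at ordinals below $\delta$ is itself below $\delta$. **Theorem 3.1.** Let $\delta$ be a primitive recursively closed ordinal. Then the following are equivalent: 1. for every $\alpha<\delta$, the cell $\alpha$ is reached by some program on a $\delta$-ITTM$_0$; 2. there is a program such that, at some stage of its run on a $\delta$-ITTM$_0$, a (strict) wellorder of $\omega$ of order type $\delta$ appears on one of the three tapes. -/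

import Mathlib

universe u

/-! ### Primitive recursive set functions and primitive recursively closed ordinals -/

open Classical in
/-- The primitive recursive set functions of finitely many variables (Jensen and Karp): the least
class containing the constant `∅`, the projections, `x ∪ {y}` and the case distinction on `u ∈ v`,
and closed under composition and under the recursion
`F(z, x⃗) = G(⋃ {F(u, x⃗) : u ∈ z}, z, x⃗)`. -/
inductive PrimRecSetFun :
    ∀ {n : ℕ}, ((Fin n → ZFSet.{u}) → ZFSet.{u}) → Prop
  | empty {n : ℕ} : PrimRecSetFun (fun _ : Fin n → ZFSet.{u} => ∅)
  | proj {n : ℕ} (i : Fin n) : PrimRecSetFun (fun x : Fin n → ZFSet.{u} => x i)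
  | adjoin : PrimRecSetFun (fun x : Fin 2 → ZFSet.{u} => x 0 ∪ {x 1})
  | cond : PrimRecSetFun (fun x : Fin 4 → ZFSet.{u} => if x 2 ∈ x 3 then x 0 else x 1)
  | comp {m n : ℕ} {G : (Fin m → ZFSet.{u}) → ZFSet.{u}}
      {H : Fin m → (Fin n → ZFSet.{u}) → ZFSet.{u}} :
      PrimRecSetFun G → (∀ i, PrimRecSetFun (H i)) → PrimRecSetFun (fun x => G (fun i => H i x))
  | recursion {n : ℕ} {G : (Fin (n + 2) → ZFSet.{u}) → ZFSet.{u}}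
      {F : (Fin (n + 1) → ZFSet.{u}) → ZFSet.{u}} :
      PrimRecSetFun G →
      (∀ (z : ZFSet.{u}) (x : Fin n → ZFSet.{u}),
        F (Fin.cons z x) =
          G (Fin.cons (ZFSet.iUnion (fun w : {w // w ∈ z} => F (Fin.cons w.1 x)))
            (Fin.cons z x))) →
      PrimRecSetFun F

/-- `δ` is primitive recursively closed: whenever a primitive recursive set function takes, at
(von Neumann) ordinals below `δ`, an ordinal as its value, this value is below `δ`. -/
def PrimRecClosed (δ : Ordinal.{u}) : Prop :=
  ∀ (n : ℕ) (F : (Fin n → ZFSet.{u}) → ZFSet.{u}), PrimRecSetFun F →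
    ∀ (a : Fin n → Ordinal.{u}) (b : Ordinal.{u}), (∀ i, a i < δ) →
      F (fun i => (a i).toZFSet) = b.toZFSet → b < δ

/-! ### Infinite time Turing machines with three tapes of length `δ` -/

namespace ITTM

/-- The possible moves of the head. -/
inductive Move
  | left
  | stay
  | right

/-- A program: an ordinary finite Turing program with states `0, …, last` for one head which reads
the three cells at its position simultaneously. Given the state and the three symbols read, it
either halts (`none`) or gives the new state, the three symbols to write, and a move. -/
structure Program where
  last : ℕ
  next : Fin (last + 1) → (Fin 3 → Bool) → Option (Fin (last + 1) × (Fin 3 → Bool) × Move)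

/-- A snapshot of a machine: state, head position, and the contents of the three tapes. On a
machine with tapes of length `δ` the cells are those at positions below `δ`: the head never leaves
them, so that the values of `tape` at positions `≥ δ` are never read or changed. -/
structure Config (p : Program) where
  state : Fin (p.last + 1)
  head : Ordinal.{u}
  tape : Fin 3 → Ordinal.{u} → Bool

variable {p : Program}

/-- The initial snapshot: state `0`, head on cell `0`, and all cells `0` (in particular there are
no parameters on the tapes). -/
def Config.init (p : Program) : Config.{u} p where
  state := 0
  head := 0
  tape := fun _ _ => false

/-- The three symbols which are read. -/
def Config.read (c : Config.{u} p) : Fin 3 → Bool := fun k => c.tape k c.head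

/-- The machine has halted in this snapshot. -/
def Config.Halted (c : Config.{u} p) : Prop := p.next c.state c.read = none

open Classical in
/-- The new head position. Moving left from a limit cell (or from cell `0`) leads to cell `0`; so
does moving right from a last cell, which exists only if `δ` is a successor. -/
noncomputable def Move.apply (δ : Ordinal.{u}) : Move → Ordinal.{u} → Ordinal.{u}
  | .left, ξ => if Order.IsSuccPrelimit ξ then 0 else ξ.pred
  | .stay, ξ => ξ
  | .right, ξ => if ξ + 1 < δ then ξ + 1 else 0

open Classical in
/-- One step of the machine with tapes of length `δ`; a halted machine does not change. -/
noncomputable def Config.step (δ : Ordinal.{u}) (c : Config.{u} p) : Config.{u} p :=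
  match p.next c.state c.read with
  | none => c
  | some (q, w, m) =>
    { state := q
      head := m.apply δ c.head
      tape := fun k ξ => if ξ = c.head then w k else c.tape k ξ }

open Classical in
/-- The snapshot at a limit time `μ`: the state, the head position and the content of every cell
are the inferior limits of their previous values, except that the head returns to cell `0` if the
inferior limit of its positions is not the position of a cell. -/
noncomputable def Config.limit (δ : Ordinal.{u}) {μ : Ordinal.{u}}
    (c : Set.Iio μ → Config.{u} p) : Config.{u} p where
  state := Filter.liminf (fun β => (c β).state) Filter.atTop
  head :=
    if Filter.liminf (fun β => (c β).head) Filter.atTop < δ then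
      Filter.liminf (fun β => (c β).head) Filter.atTop
    else 0
  tape := fun k ξ => Filter.liminf (fun β => (c β).tape k ξ) Filter.atTop

/-- The snapshot at time `τ` of the run of the program `p` on a machine with three tapes of length
`δ`, without input or parameters. After halting the final snapshot is kept. -/
noncomputable def run (δ : Ordinal.{u}) (p : Program) (τ : Ordinal.{u}) : Config.{u} p :=
  Ordinal.limitRecOn τ (Config.init p) (fun _ c => c.step δ)
    (fun μ _ c => Config.limit δ (fun β : Set.Iio μ => c β.1 β.2))

/-- The program `p` reaches the cell `α`: its run halts with the head exactly on that cell. -/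
def Reaches (δ : Ordinal.{u}) (p : Program) (α : Ordinal.{u}) : Prop :=
  ∃ τ, (run δ p τ).Halted ∧ (run δ p τ).head = α

/-- The binary relation on `ω` coded by the first `ω` cells of a tape: `m` precedes `n` iff the
cell with number `⟨m, n⟩` contains `1`. -/
def codedRel (t : Ordinal.{u} → Bool) (m n : ℕ) : Prop :=
  t (Nat.pair m n : Ordinal.{u}) = true

/-- The relation on `ω` coded by the tape content `t` is a (strict) wellorder of `ω` of order type
`δ`. -/
def CodesWellOrder (t : Ordinal.{u} → Bool) (δ : Ordinal.{u}) : Prop :=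
  ∃ _ : IsWellOrder ℕ (codedRel t), Ordinal.lift.{u} (Ordinal.type (codedRel t)) = δ

end ITTM

/-!
Both directions use one universal machine, which simulates all programs at the same time, step by
step, on tapes of the same length `δ`. This is possible because a primitive recursively closed
`δ > ω` satisfies `ω * δ = δ` (`PrimRecClosed.omega0_mul_eq`): the cell `ω * x + y` represents the
cell `x` of the `y`-th program, and the finite tables of all programs can be enumerated by counting
(`ITTM.table`, `ITTM.succDigits_table`): the digits of the number of the current row are carried
along, and the number is increased by one from row to row. In each round every row makes one step.
After `μ` rounds, `μ` a limit, the inferior limits of the universal machine are those of the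
simulated programs, so that the simulation is faithful through all ordinal times
(`ITTM.allTape_limit`, `ITTM.describes_run`).

*From cells to a code* (`ITTM.exists_code_of_reaches`). In the step phase the machine compares the
head positions of all pairs of programs and writes the result on the beginning of its third tape. If
each cell is reached by some program, take a round `κ` in which all these programs have halted. The
relation which is written then compares the places `ω * h y + y`, where `h y` is the head position
of program `y`. The places are distinct and below `ω * δ = δ`, and every `α < δ` occurs as some
`h y`, so that the relation is a wellorder of type `δ`.

*From a code to cells* (`ITTM.exists_reaches_of_code`). Before each step of a row the machine
computes, stage by stage, the wellfounded part of the relation which is coded on the tape of this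
row: the numbers of rank less than `β` are accepted by stage `β`. It halts if new numbers are still
accepted at all stages `β < δ`. If a program writes a code for `δ`, this happens at some time. At
the first time at which it happens, in row `c` say, the relation has elements of each rank `u < δ`,
though it need not be wellfounded. This time does not depend on which number `n₀` is singled out. If
`n₀` has rank `u`, then a register contains `u` in the end, and the machine halts at the beginning
of the block for the cell `ω * u + c`, that is, at a finite distance from `ω * u`; finitely many
moves, built into the program, then lead to `ω * u + v`. Every `α < δ` has this form.

The universal machine is constructed in layers. A *pass machine* sweeps over a tape with several
tracks from left to right, again and again; it is compiled to a program which stores each of its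
cells in a finite block (`ITTM.PassMachine.program`). A cycle of passes is given by a tree of
commands (`ITTM.Cmd`). The central difficulty lies in the limits of cycles: the inferior limit of
the whole run is determined by the tapes at the ends of the cycles only if no bit which is `1`
before and after a segment of the run is `0` at some time in between. This condition is part of the
relations `ITTM.Seg` and `ITTM.Reach`, which therefore can be composed transfinitely
(`ITTM.Reach.chain`), and it has to be checked for each composition (`ITTM.enc_dip`).

The case `δ = ω`, in which `ω * δ = δ` fails, is settled by tapes of length `ω * 1`, on which both
sides of the equivalence hold (`ITTM.exists_code_omega0`, `ITTM.exists_reaches_omega0`).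
-/

open Order

/-! ### Cofinal behaviour below a limit ordinal -/

/-- `P` holds at all ordinals below `μ` from some point on. -/
def EvBelow (μ : Ordinal.{u}) (P : Ordinal.{u} → Prop) : Prop :=
  ∃ t₀ < μ, ∀ t, t₀ ≤ t → t < μ → P t

/-- `P` holds cofinally often below `μ`. -/
def CofBelow (μ : Ordinal.{u}) (P : Ordinal.{u} → Prop) : Prop :=
  ∀ t₀ < μ, ∃ t, t₀ ≤ t ∧ t < μ ∧ P t

theorem EvBelow.mono {μ : Ordinal.{u}} {P Q : Ordinal.{u} → Prop} (h : EvBelow μ P)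
    (hpq : ∀ t < μ, P t → Q t) : EvBelow μ Q := by
  obtain ⟨t, ht, h⟩ := h
  exact ⟨t, ht, fun s hs hs' => hpq s hs' (h s hs hs')⟩

theorem CofBelow.mono {μ : Ordinal.{u}} {P Q : Ordinal.{u} → Prop} (h : CofBelow μ P)
    (hpq : ∀ t < μ, P t → Q t) : CofBelow μ Q := by
  intro t ht
  obtain ⟨s, hs, hs', hp⟩ := h t ht
  exact ⟨s, hs, hs', hpq s hs' hp⟩

theorem EvBelow.cof {μ : Ordinal.{u}} {P : Ordinal.{u} → Prop}
    (h : EvBelow μ P) : CofBelow μ P := by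
  obtain ⟨t, ht, h⟩ := h
  exact fun s hs => ⟨max t s, le_max_right _ _, max_lt ht hs, h _ (le_max_left _ _) (max_lt ht hs)⟩

theorem evBelow_of_forall {μ : Ordinal.{u}} {P : Ordinal.{u} → Prop} (hμ : 0 < μ)
    (h : ∀ t < μ, P t) : EvBelow μ P := ⟨0, hμ, fun t _ ht => h t ht⟩

theorem not_evBelow {μ : Ordinal.{u}} {P : Ordinal.{u} → Prop} :
    ¬ EvBelow μ P ↔ CofBelow μ (fun t => ¬ P t) := by
  unfold EvBelow CofBelow
  push Not
  rfl

theorem eventually_Iio_iff {μ : Ordinal.{u}} (hμ : 0 < μ) {P : Ordinal.{u} → Prop} :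
    (∀ᶠ n : Set.Iio μ in Filter.atTop, P n.1) ↔ EvBelow μ P := by
  have : Nonempty (Set.Iio μ) := ⟨⟨0, hμ⟩⟩
  rw [Filter.eventually_atTop]
  constructor
  · rintro ⟨a, h⟩
    exact ⟨a.1, a.2, fun t h1 h2 => h ⟨t, h2⟩ h1⟩
  · rintro ⟨a, ha, h⟩
    exact ⟨⟨a, ha⟩, fun b hb => h b.1 hb b.2⟩

theorem liminf_Iio_eq {α : Type*} [ConditionallyCompleteLattice α] {μ : Ordinal.{u}} (hμ : 0 < μ)
    (f : Ordinal.{u} → α) :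
    Filter.liminf (fun n : Set.Iio μ => f n.1) Filter.atTop =
      sSup {a | EvBelow μ (fun t => a ≤ f t)} := by
  rw [Filter.liminf_eq]
  congr 1
  ext a
  exact eventually_Iio_iff hμ (P := fun t => a ≤ f t)

theorem liminf_Iio_eq_of_isGreatest {α : Type*} [ConditionallyCompleteLinearOrder α]
    {μ : Ordinal.{u}} (hμ : 0 < μ) {f : Ordinal.{u} → α} {v : α}
    (h1 : EvBelow μ (fun t => v ≤ f t)) (h2 : CofBelow μ (fun t => f t ≤ v)) :
    Filter.liminf (fun n : Set.Iio μ => f n.1) Filter.atTop = v := by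
  rw [liminf_Iio_eq hμ]
  refine IsGreatest.csSup_eq ⟨h1, ?_⟩
  rintro a ⟨t, ht, h⟩
  obtain ⟨s, hs, hs', h'⟩ := h2 t ht
  exact (h s hs hs').trans h'

theorem liminf_Iio_ordinal {μ : Ordinal.{u}} (hμ : 0 < μ) {f : Ordinal.{u} → Ordinal.{u}}
    {v : Ordinal.{u}} (h1 : ∀ x < v, EvBelow μ (fun t => x < f t))
    (h2 : CofBelow μ (fun t => f t ≤ v)) :
    Filter.liminf (fun n : Set.Iio μ => f n.1) Filter.atTop = v := by
  rw [liminf_Iio_eq hμ]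
  have hub : v ∈ upperBounds {a | EvBelow μ (fun t => a ≤ f t)} := by
    rintro a ⟨t, ht, h⟩
    obtain ⟨s, hs, hs', h'⟩ := h2 t ht
    exact (h s hs hs').trans h'
  refine le_antisymm (csSup_le ⟨0, evBelow_of_forall hμ fun _ _ => zero_le⟩ hub) ?_
  by_contra hlt
  push Not at hlt
  have := le_csSup ⟨v, hub⟩ (show sSup {a | EvBelow μ (fun t => a ≤ f t)} + 1 ∈ _ from
    (h1 _ hlt).mono fun t _ h => Order.add_one_le_of_lt h)
  exact absurd this (not_le.2 (lt_add_one _))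

theorem lt_liminf_Iio_iff {μ : Ordinal.{u}} (hμ : 0 < μ) {f : Ordinal.{u} → Ordinal.{u}}
    {b : Ordinal.{u}} (hb : ∀ t < μ, f t ≤ b) (x : Ordinal.{u}) :
    x < Filter.liminf (fun n : Set.Iio μ => f n.1) Filter.atTop ↔ EvBelow μ (fun t => x < f t) := by
  rw [liminf_Iio_eq hμ]
  have hub : b ∈ upperBounds {a | EvBelow μ (fun t => a ≤ f t)} := by
    rintro a ⟨t, ht, h⟩
    exact (h t le_rfl ht).trans (hb t ht)
  constructor
  · intro h
    obtain ⟨a, ha, hxa⟩ := exists_lt_of_lt_csSup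
      ⟨0, evBelow_of_forall hμ fun _ _ => zero_le⟩ h
    exact EvBelow.mono ha fun t _ h => hxa.trans_le h
  · intro h
    have := le_csSup ⟨b, hub⟩ (show x + 1 ∈ {a | EvBelow μ (fun t => a ≤ f t)} from
      h.mono fun t _ h => Order.add_one_le_of_lt h)
    exact (lt_add_one x).trans_le this

theorem evBelow_add {s μ : Ordinal.{u}} {P : Ordinal.{u} → Prop} (hμ : 0 < μ) :
    EvBelow (s + μ) P ↔ EvBelow μ (fun t => P (s + t)) := by
  constructor
  · rintro ⟨t, ht, h⟩
    rcases le_total s t with hst | hst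
    · obtain ⟨r, rfl⟩ := exists_add_of_le hst
      exact ⟨r, by simpa using ht, fun q hq hq' => h _ (by simpa using hq) (by simpa using hq')⟩
    · exact ⟨0, hμ, fun q _ hq' => h _ (hst.trans (by simp)) (by simpa using hq')⟩
  · rintro ⟨t, ht, h⟩
    refine ⟨s + t, by simpa using ht, fun q hq hq' => ?_⟩
    obtain ⟨r, rfl⟩ := exists_add_of_le ((le_add_of_nonneg_right zero_le).trans hq)
    exact h r (by simpa using hq) (by simpa using hq')

theorem liminf_Iio_add {α : Type*} [ConditionallyCompleteLattice α] {s μ : Ordinal.{u}} (hμ : 0 < μ)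
    {f g : Ordinal.{u} → α} (hfg : ∀ t < μ, f (s + t) = g t) :
    Filter.liminf (fun n : Set.Iio (s + μ) => f n.1) Filter.atTop =
      Filter.liminf (fun n : Set.Iio μ => g n.1) Filter.atTop := by
  rw [liminf_Iio_eq (hμ.trans_le (le_add_of_nonneg_left zero_le)), liminf_Iio_eq hμ]
  congr 1
  ext a
  rw [Set.mem_ofPred_eq, Set.mem_ofPred_eq, evBelow_add hμ]
  exact ⟨fun h => h.mono fun t ht h => by rwa [← hfg t ht],
    fun h => h.mono fun t ht h => by rwa [hfg t ht]⟩

/-! ### Runs from arbitrary snapshots, and segments of runs -/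

namespace ITTM

variable {p : Program}

/-- The snapshot at time `τ` of the run which starts with the snapshot `c`. -/
noncomputable def runFrom (δ : Ordinal.{u}) (c : Config.{u} p) (τ : Ordinal.{u}) : Config.{u} p :=
  Ordinal.limitRecOn τ c (fun _ c => c.step δ)
    (fun μ _ c => Config.limit δ (fun β : Set.Iio μ => c β.1 β.2))

theorem run_eq_runFrom (δ : Ordinal.{u}) (τ : Ordinal.{u}) :
    run δ p τ = runFrom δ (Config.init p) τ := rfl

@[simp] theorem runFrom_zero (δ : Ordinal.{u}) (c : Config.{u} p) : runFrom δ c 0 = c :=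
  Ordinal.limitRecOn_zero ..

@[simp] theorem runFrom_add_one (δ : Ordinal.{u}) (c : Config.{u} p) (τ : Ordinal.{u}) :
    runFrom δ c (τ + 1) = (runFrom δ c τ).step δ :=
  Ordinal.limitRecOn_add_one ..

theorem runFrom_limit (δ : Ordinal.{u}) (c : Config.{u} p) {μ : Ordinal.{u}} (hμ : IsSuccLimit μ) :
    runFrom δ c μ = Config.limit δ (fun β : Set.Iio μ => runFrom δ c β.1) :=
  Ordinal.limitRecOn_limit _ _ _ _ hμ

theorem Config.ext' {c d : Config.{u} p} (h1 : c.state = d.state) (h2 : c.head = d.head)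
    (h3 : c.tape = d.tape) : c = d := by
  cases c; cases d; simp_all

theorem runFrom_add (δ : Ordinal.{u}) (c : Config.{u} p) (s t : Ordinal.{u}) :
    runFrom δ c (s + t) = runFrom δ (runFrom δ c s) t := by
  induction t using Ordinal.limitRecOn with
  | zero => simp
  | add_one t ih => rw [← add_assoc, runFrom_add_one, ih, runFrom_add_one]
  | limit μ hμ ih =>
    have h0 : 0 < μ := hμ.bot_lt
    have h0' : 0 < s + μ := h0.trans_le (le_add_of_nonneg_left zero_le)
    have hsμ : IsSuccLimit (s + μ) := (Ordinal.isNormal_add_right s).map_isSuccLimit hμ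
    rw [runFrom_limit δ _ hsμ, runFrom_limit δ _ hμ]
    refine Config.ext' ?_ ?_ ?_
    · exact liminf_Iio_add h0 (f := fun t => (runFrom δ c t).state)
        (g := fun t => (runFrom δ (runFrom δ c s) t).state) fun t ht => congrArg Config.state
            (ih t ht)
    · simp only [Config.limit]
      rw [liminf_Iio_add h0 (f := fun t => (runFrom δ c t).head)
        fun t ht => congrArg Config.head (ih t ht)]
    · funext k ξ
      exact liminf_Iio_add h0 (f := fun t => (runFrom δ c t).tape k ξ)
        (g := fun t => (runFrom δ (runFrom δ c s) t).tape k ξ)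
        fun t ht => congrArg (fun c => Config.tape c k ξ) (ih t ht)

/-- Sufficient conditions for `v` to be the inferior limit of the snapshots before time `μ`; `ℓ` is
the inferior limit of the head positions. -/
theorem runFrom_eq_of_limit {δ : Ordinal.{u}} {c v : Config.{u} p} {μ : Ordinal.{u}}
    (hμ : IsSuccLimit μ) {ℓ : Ordinal.{u}}
    (hs1 : EvBelow μ fun t => v.state ≤ (runFrom δ c t).state)
    (hs2 : CofBelow μ fun t => (runFrom δ c t).state ≤ v.state)
    (hv : v.head = if ℓ < δ then ℓ else 0)
    (hh1 : ∀ x < ℓ, EvBelow μ fun t => x < (runFrom δ c t).head)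
    (hh2 : CofBelow μ fun t => (runFrom δ c t).head ≤ ℓ)
    (ht1 : ∀ k ξ, v.tape k ξ = true → EvBelow μ fun t => (runFrom δ c t).tape k ξ = true)
    (ht2 : ∀ k ξ, v.tape k ξ = false → CofBelow μ fun t => (runFrom δ c t).tape k ξ = false) :
    runFrom δ c μ = v := by
  have h0 : 0 < μ := hμ.bot_lt
  rw [runFrom_limit δ _ hμ]
  refine Config.ext' ?_ ?_ ?_
  · exact liminf_Iio_eq_of_isGreatest h0 (f := fun t => (runFrom δ c t).state) hs1 hs2
  · simp only [Config.limit]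
    rw [liminf_Iio_ordinal h0 (f := fun t => (runFrom δ c t).head) hh1 hh2, hv]
  · funext k ξ
    refine liminf_Iio_eq_of_isGreatest h0 (f := fun t => (runFrom δ c t).tape k ξ) ?_ ?_
    · cases hv : v.tape k ξ
      · exact evBelow_of_forall h0 fun t _ => by simp
      · exact (ht1 k ξ hv).mono fun t _ h => by simp [h]
    · cases hv : v.tape k ξ
      · exact (ht2 k ξ hv).mono fun t _ h => by simp [h]
      · intro t ht; exact ⟨t, le_rfl, ht, by simp⟩

/-- `Seg δ c c' s h L Z`: the run from `c` leads in a positive time to `c'`, and before that time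
the states are at least `s`, the head positions are at least `h`, the cells in `L` constantly
contain `1`, and each of the cells in `Z` contains `0` at some time. -/
def Seg (δ : Ordinal.{u}) (c c' : Config.{u} p) (s : Fin (p.last + 1)) (h : Ordinal.{u})
    (L Z : Fin 3 → Ordinal.{u} → Prop) : Prop :=
  ∃ l, 0 < l ∧ runFrom δ c l = c' ∧
    (∀ t < l, s ≤ (runFrom δ c t).state ∧ h ≤ (runFrom δ c t).head ∧
      ∀ k ξ, L k ξ → (runFrom δ c t).tape k ξ = true) ∧
    (∀ k ξ, Z k ξ → ∃ t < l, (runFrom δ c t).tape k ξ = false)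

theorem Seg.weaken {δ : Ordinal.{u}} {c c' : Config.{u} p} {s s' : Fin (p.last + 1)}
    {h h' : Ordinal.{u}} {L L' Z Z' : Fin 3 → Ordinal.{u} → Prop} (H : Seg δ c c' s h L Z)
    (hs : s' ≤ s) (hh : h' ≤ h) (hL : ∀ k ξ, L' k ξ → L k ξ) (hZ : ∀ k ξ, Z' k ξ → Z k ξ) :
    Seg δ c c' s' h' L' Z' := by
  obtain ⟨l, h0, h1, h2, h3⟩ := H
  exact ⟨l, h0, h1, fun t ht => ⟨hs.trans (h2 t ht).1, hh.trans (h2 t ht).2.1,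
    fun k ξ h => (h2 t ht).2.2 k ξ (hL k ξ h)⟩, fun k ξ h => h3 k ξ (hZ k ξ h)⟩

theorem Seg.single {δ : Ordinal.{u}} {c c' : Config.{u} p} (h : c.step δ = c') :
    Seg δ c c' c.state c.head (fun k ξ => c.tape k ξ = true) (fun k ξ => c.tape k ξ = false) := by
  refine ⟨1, zero_lt_one, ?_, fun t ht => ?_, fun k ξ h => ⟨0, zero_lt_one, by simpa using h⟩⟩
  · rw [← zero_add (1 : Ordinal), runFrom_add_one, runFrom_zero, h]
  · obtain rfl := Order.lt_one_iff.1 ht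
    simp

theorem Seg.trans {δ : Ordinal.{u}} {a b c : Config.{u} p} {s : Fin (p.last + 1)}
    {h : Ordinal.{u}} {L Z Z' : Fin 3 → Ordinal.{u} → Prop}
    (H : Seg δ a b s h L Z) (H' : Seg δ b c s h L Z') :
    Seg δ a c s h L (fun k ξ => Z k ξ ∨ Z' k ξ) := by
  obtain ⟨l, h0, h1, h2, h3⟩ := H
  obtain ⟨l', h0', h1', h2', h3'⟩ := H'
  refine ⟨l + l', h0.trans_le (le_add_of_nonneg_right zero_le), ?_, ?_, ?_⟩
  · rw [runFrom_add, h1, h1']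
  · intro t ht
    rcases lt_or_ge t l with h | h
    · exact h2 t h
    · obtain ⟨r, rfl⟩ := exists_add_of_le h
      rw [runFrom_add, h1]
      exact h2' r (by simpa using ht)
  · rintro k ξ (hz | hz)
    · obtain ⟨t, ht, h⟩ := h3 k ξ hz
      exact ⟨t, ht.trans_le (le_add_of_nonneg_right zero_le), h⟩
    · obtain ⟨t, ht, h⟩ := h3' k ξ hz
      exact ⟨l + t, by simpa using ht, by rw [runFrom_add, h1]; exact h⟩

/-- Transfinitely many segments can be composed if, at each limit index, the snapshot `V μ` is
forced by the information which the earlier segments carry. -/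
theorem Seg.chain {δ κ : Ordinal.{u}} (hκ : 0 < κ) {V : Ordinal.{u} → Config.{u} p}
    {s : Ordinal.{u} → Fin (p.last + 1)} {h : Ordinal.{u} → Ordinal.{u}}
    {L Z : Ordinal.{u} → Fin 3 → Ordinal.{u} → Prop}
    (hseg : ∀ k < κ, Seg δ (V k) (V (k + 1)) (s k) (h k) (L k) (Z k))
    (hlim : ∀ μ ≤ κ, IsSuccLimit μ →
      (EvBelow μ fun k => (V μ).state ≤ s k) ∧ (CofBelow μ fun k => (V k).state ≤ (V μ).state) ∧
      (∃ ℓ, (V μ).head = (if ℓ < δ then ℓ else 0) ∧ (∀ x < ℓ, EvBelow μ fun k => x < h k) ∧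
        CofBelow μ fun k => (V k).head ≤ ℓ) ∧
      (∀ i ξ, (V μ).tape i ξ = true → EvBelow μ fun k => L k i ξ) ∧
      (∀ i ξ, (V μ).tape i ξ = false → CofBelow μ fun k => Z k i ξ ∨ (V k).tape i ξ = false))
    {s' : Fin (p.last + 1)} {h' : Ordinal.{u}} {L' Z' : Fin 3 → Ordinal.{u} → Prop}
    (hs : ∀ k < κ, s' ≤ s k) (hh : ∀ k < κ, h' ≤ h k) (hL : ∀ k < κ, ∀ i ξ, L' i ξ → L k i ξ)
    (hZ : ∀ i ξ, Z' i ξ → ∃ k < κ, Z k i ξ ∨ (V k).tape i ξ = false) :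
    Seg δ (V 0) (V κ) s' h' L' Z' := by
  have : ∀ k : Ordinal.{u}, ∃ l : Ordinal.{u}, 0 < l ∧ (k < κ → runFrom δ (V k) l = V (k + 1) ∧
    (∀ t < l, s k ≤ (runFrom δ (V k) t).state ∧ h k ≤ (runFrom δ (V k) t).head ∧
      ∀ i ξ, L k i ξ → (runFrom δ (V k) t).tape i ξ = true) ∧
    (∀ i ξ, Z k i ξ → ∃ t < l, (runFrom δ (V k) t).tape i ξ = false)) := by
    intro k
    by_cases hk : k < κ
    · obtain ⟨l, h0, h1⟩ := hseg k hk
      exact ⟨l, h0, fun _ => h1⟩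
    · exact ⟨1, zero_lt_one, fun h => absurd h hk⟩
  choose l hl0 hl using this
  -- `T k` is the time at which the chain arrives at `V k`
  let T : Ordinal.{u} → Ordinal.{u} := fun k => Ordinal.limitRecOn k 0 (fun k t => t + l k)
    (fun μ _ f => ⨆ β : Set.Iio μ, f β.1 β.2)
  have T0 : T 0 = 0 := Ordinal.limitRecOn_zero ..
  have Ts : ∀ k, T (k + 1) = T k + l k := fun k => Ordinal.limitRecOn_add_one ..
  have Tl : ∀ μ, IsSuccLimit μ → T μ = ⨆ β : Set.Iio μ, T β.1 := fun μ hμ =>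
    Ordinal.limitRecOn_limit _ _ _ _ hμ
  have hN : IsNormal T := by
    refine IsNormal.of_succ_lt (fun k => ?_) (fun {μ} hμ => ?_)
    · rw [← Order.succ_eq_add_one] at *
      rw [Order.succ_eq_add_one, Ts]
      exact lt_add_of_pos_right _ (hl0 k)
    · rw [Tl μ hμ]
      have : T '' Set.Iio μ = Set.range (fun β : Set.Iio μ => T β.1) := by
        ext x; simp
      rw [this]
      have : Nonempty (Set.Iio μ) := ⟨⟨0, hμ.bot_lt⟩⟩
      exact isLUB_ciSup (Ordinal.bddAbove_of_small)
  -- every time before `T κ` lies in exactly one segment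
  have hfind : ∀ μ t, t < T μ → ∃ k < μ, ∃ r < l k, t = T k + r := by
    intro μ t ht
    induction μ using Ordinal.limitRecOn with
    | zero => rw [T0] at ht; exact absurd ht (not_lt.2 zero_le)
    | add_one μ ih =>
      rcases lt_or_ge t (T μ) with h | h
      · obtain ⟨k, hk, r⟩ := ih h
        exact ⟨k, hk.trans (lt_add_one _), r⟩
      · obtain ⟨r, rfl⟩ := exists_add_of_le h
        rw [Ts] at ht
        exact ⟨μ, lt_add_one _, r, by simpa using ht, rfl⟩
    | limit μ hμ ih =>
      obtain ⟨ν, hν, h⟩ := (hN.lt_iff_exists_lt hμ).1 ht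
      obtain ⟨k, hk, r⟩ := ih ν hν h
      exact ⟨k, hk.trans hν, r⟩
  have hrun : ∀ k ≤ κ, runFrom δ (V 0) (T k) = V k := by
    intro k
    induction k using Ordinal.limitRecOn with
    | zero => intro _; rw [T0, runFrom_zero]
    | add_one k ih =>
      intro hk
      have hk' : k < κ := (lt_add_one k).trans_le hk
      rw [Ts, runFrom_add, ih hk'.le, (hl k hk').1]
    | limit μ hμ ih =>
      intro hμκ
      obtain ⟨h1, h2, ⟨ℓ, h3, h4, h5⟩, h6, h7⟩ := hlim μ hμκ hμ
      have hT : IsSuccLimit (T μ) := hN.map_isSuccLimit hμ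
      have hloc : ∀ k < μ, ∀ r, runFrom δ (V 0) (T k + r) = runFrom δ (V k) r := by
        intro k hk r
        rw [runFrom_add, ih k hk (hk.le.trans hμκ)]
      -- transfer from indices to times
      have hev : ∀ (P : Config.{u} p → Prop) (Q : Ordinal.{u} → Prop), EvBelow μ Q →
          (∀ k < μ, Q k → ∀ r < l k, P (runFrom δ (V k) r)) →
          EvBelow (T μ) fun t => P (runFrom δ (V 0) t) := by
        rintro P Q ⟨k₀, hk₀, hQ⟩ hPQ
        refine ⟨T k₀, hN.strictMono hk₀, fun t ht ht' => ?_⟩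
        obtain ⟨k, hk, r, hr, rfl⟩ := hfind μ t ht'
        show P (runFrom δ (V 0) (T k + r))
        rw [hloc k hk]
        refine hPQ k hk (hQ k ?_ hk) r hr
        by_contra hlt
        push Not at hlt
        have h1 : T k + r < T (k + 1) := by rw [Ts]; simpa using hr
        have h2 : T (k + 1) ≤ T k₀ := hN.strictMono.monotone (Order.add_one_le_of_lt hlt)
        exact absurd ht (not_le.2 (h1.trans_le h2))
      have hcof : ∀ (P : Config.{u} p → Prop) (Q : Ordinal.{u} → Prop), CofBelow μ Q →
          (∀ k < μ, Q k → ∃ r < l k, P (runFrom δ (V k) r)) →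
          CofBelow (T μ) fun t => P (runFrom δ (V 0) t) := by
        intro P Q hQ hPQ t ht
        obtain ⟨k₀, hk₀, hlt⟩ := (hN.lt_iff_exists_lt hμ).1 ht
        obtain ⟨k, hk, hk', hq⟩ := hQ k₀ hk₀
        obtain ⟨r, hr, hp⟩ := hPQ k hk' hq
        refine ⟨T k + r, (hlt.le.trans (hN.strictMono.monotone hk)).trans
          (le_add_of_nonneg_right zero_le), ?_, by simpa only [hloc k hk'] using hp⟩
        have h1 : T k + r < T (k + 1) := by rw [Ts]; simpa using hr
        exact h1.trans_le (hN.strictMono.monotone (Order.add_one_le_of_lt hk'))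
      have hkκ : ∀ k < μ, k < κ := fun k hk => hk.trans_le hμκ
      refine runFrom_eq_of_limit hT (ℓ := ℓ) ?_ ?_ h3 ?_ ?_ ?_ ?_
      · exact hev (fun c => (V μ).state ≤ c.state) _ h1
          fun k hk hq r hr => hq.trans ((hl k (hkκ k hk)).2.1 r hr).1
      · exact hcof (fun c => c.state ≤ (V μ).state) _ h2
          fun k hk hq => ⟨0, hl0 k, by simpa using hq⟩
      · intro x hx
        exact hev (fun c => x < c.head) _ (h4 x hx)
          fun k hk hq r hr => hq.trans_le ((hl k (hkκ k hk)).2.1 r hr).2.1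
      · exact hcof (fun c => c.head ≤ ℓ) _ h5 fun k hk hq => ⟨0, hl0 k, by simpa using hq⟩
      · intro i ξ hv
        exact hev (fun c => c.tape i ξ = true) _ (h6 i ξ hv)
          fun k hk hq r hr => ((hl k (hkκ k hk)).2.1 r hr).2.2 i ξ hq
      · intro i ξ hv
        refine hcof (fun c => c.tape i ξ = false) _ (h7 i ξ hv) fun k hk hq => ?_
        rcases hq with hq | hq
        · exact (hl k (hkκ k hk)).2.2 i ξ hq
        · exact ⟨0, hl0 k, by simpa using hq⟩
  refine ⟨T κ, ?_, hrun κ le_rfl, ?_, ?_⟩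
  · rw [← T0]; exact hN.strictMono hκ
  · intro t ht
    obtain ⟨k, hk, r, hr, rfl⟩ := hfind κ t ht
    rw [runFrom_add, hrun k hk.le]
    have := (hl k hk).2.1 r hr
    exact ⟨(hs k hk).trans this.1, (hh k hk).trans this.2.1,
      fun i ξ h => this.2.2 i ξ (hL k hk i ξ h)⟩
  · intro i ξ hz
    obtain ⟨k, hk, hz⟩ := hZ i ξ hz
    obtain ⟨r, hr, h⟩ : ∃ t < l k, (runFrom δ (V k) t).tape i ξ = false :=
      hz.elim ((hl k hk).2.2 i ξ) fun h => ⟨0, hl0 k, by simpa using h⟩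
    refine ⟨T k + r, ?_, by rw [runFrom_add, hrun k hk.le]; exact h⟩
    have h1 : T k + r < T (k + 1) := by rw [Ts]; simpa using hr
    exact h1.trans_le (hN.strictMono.monotone (Order.add_one_le_of_lt hk))

end ITTM

namespace ITTM

/-! ### Pass machines -/

/-- A pass machine sweeps over its tape from left to right, again and again. Its cells hold one bit
for each track in `Tr`; a cell is stored in `K` consecutive cells of the three tapes, the track `t`
in the place `pos t` of this block. The place `(0, 0)` of a block stays free for the mark of the
first cell.
During a pass with control state `c`, the function `op c` maps the local state and the content of
the current cell to the next local state and the new content of the cell; the value `none` ends the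
run, with the moves `tail`. Local states are `none` or remembered contents of a cell. After the
pass, `nx c` chooses the next control state from the final local state; `none` ends a cycle,
and the next cycle begins with `start`. -/
structure PassMachine where
  K : ℕ
  Tr : Type
  Ctrl : Type
  finTr : Finite Tr
  finCtrl : Finite Ctrl
  pos : Tr → Fin 3 × Fin K
  pos_inj : Function.Injective pos
  pos_ne : ∀ t, (pos t).1 = 0 → ((pos t).2 : ℕ) ≠ 0
  K_pos : 0 < K
  start : Ctrl
  op : Ctrl → Option (Tr → Bool) → (Tr → Bool) → Option (Option (Tr → Bool) × (Tr → Bool))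
  nx : Ctrl → Option (Tr → Bool) → Option Ctrl
  tail : List Move

namespace PassMachine

variable (M : PassMachine)

/-- The content of a cell of a pass machine. -/
abbrev Cell : Type := M.Tr → Bool

/-- The content of the block of real cells which stores a cell. -/
abbrev Raw : Type := Fin 3 → Fin M.K → Bool

/-- The phases of the treatment of a block: arrival, reading to the right, going back, and writing
to the right. -/
inductive Phase
  | arrive
  | read (r : Fin M.K) (B : M.Raw)
  | back (r : Fin (M.K + 1)) (B : M.Raw)
  | write (r : Fin M.K) (B : M.Raw)

/-- The states of the program which simulates a pass machine. -/
inductive State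
  | boot
  | node (c : M.Ctrl) (s : Option M.Cell) (i : M.Phase)
  | tail (n : Fin (M.tail.length + 1))

instance : Finite M.Phase := by
  refine Finite.of_injective (fun i : M.Phase => (match i with
    | .arrive => none
    | .read r B => some (.inl (r, B))
    | .back r B => some (.inr (.inl (r, B)))
    | .write r B => some (.inr (.inr (r, B))) :
      Option ((Fin M.K × M.Raw) ⊕ (Fin (M.K + 1) × M.Raw) ⊕ (Fin M.K × M.Raw)))) ?_
  intro a b h
  cases a <;> cases b <;> simp_all

instance : Finite M.State := by
  have := M.finTr
  have := M.finCtrl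
  refine Finite.of_injective (fun i : M.State => (match i with
    | .boot => none
    | .node c s i => some (.inl (c, s, i))
    | .tail n => some (.inr n) :
      Option ((M.Ctrl × Option M.Cell × M.Phase) ⊕ Fin (M.tail.length + 1)))) ?_
  intro a b h
  cases a <;> cases b <;> simp_all

/-- An injective numbering of a finite type. -/
noncomputable def numbering (α : Type) [Finite α] (a : α) : ℕ := (Finite.equivFin α a : ℕ)

theorem numbering_injective (α : Type) [Finite α] : Function.Injective (numbering α) :=
  fun _ _ h => (Finite.equivFin α).injective (Fin.ext h)

open Classical in
/-- The position of a state in the order of the states. Since states are subject to inferior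
limits, `boot` comes first, and for each control state `c` the local state `none` and the phase
`arrive` come before the others. -/
noncomputable def key : M.State → ℕ ×ₗ ℕ ×ₗ ℕ ×ₗ ℕ :=
  have := M.finTr
  have := M.finCtrl
  fun
  | .boot => toLex (0, toLex (0, toLex (0, 0)))
  | .node c s i => toLex (1, toLex (numbering _ c, toLex
      (s.elim 0 (fun x => numbering _ x + 1), if i = .arrive then 0 else numbering _ i + 1)))
  | .tail n => toLex (2, toLex (0, toLex (0, (n : ℕ))))

theorem key_injective : Function.Injective M.key := by
  have := M.finTr
  have := M.finCtrl
  intro a b h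
  cases a with
  | boot => cases b <;> simp [key] at h; rfl
  | tail n =>
    cases b <;> simp [key] at h
    rw [Fin.ext h]
  | node c s i =>
    cases b with
    | boot => simp [key] at h
    | tail n => simp [key] at h
    | node c' s' i' =>
      simp only [key, EmbeddingLike.apply_eq_iff_eq, Prod.mk.injEq, true_and] at h
      obtain ⟨h1, h2, h3⟩ := h
      have h1 := numbering_injective _ h1
      have h2 : s = s' := by
        rcases s with _ | s <;> rcases s' with _ | s' <;> simp at h2 ⊢
        exact numbering_injective _ h2
      have h3 : i = i' := by
        by_cases hi : i = .arrive <;> by_cases hi' : i' = .arrive <;> simp [hi, hi'] at h3 ⊢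
        exact numbering_injective _ h3
      rw [h1, h2, h3]

noncomputable instance : LinearOrder M.State := LinearOrder.lift' M.key M.key_injective

theorem boot_le (q : M.State) : .boot ≤ q := by
  show M.key _ ≤ M.key _
  cases q <;> simp [key, Prod.Lex.le_iff]

theorem arrive_le (c : M.Ctrl) {s s' : Option M.Cell} (h : s = none ∨ s' = s) (i : M.Phase) :
    State.node c s .arrive ≤ .node c s' i := by
  show M.key _ ≤ M.key _
  rcases h with rfl | rfl
  · cases s' <;> simp [key, Prod.Lex.le_iff]
  · simp [key, Prod.Lex.le_iff]

/-- The content of a cell which is stored in a block. -/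
def decode (B : M.Raw) : M.Cell := fun t => B (M.pos t).1 (M.pos t).2

open Classical in
/-- A block with the new content `γ` of its cell. -/
noncomputable def encode (γ : M.Cell) (B : M.Raw) : M.Raw := fun k r =>
  if h : ∃ t, M.pos t = (k, r) then γ h.choose else B k r

/-- The transition function of the program which simulates a pass machine. -/
noncomputable def trans : M.State → (Fin 3 → Bool) → Option (M.State × (Fin 3 → Bool) × Move)
  | .boot, b => some (.node M.start none (.read ⟨0, M.K_pos⟩ fun _ _ => false),
      Function.update b 0 true, .stay)
  | .node c s .arrive, b =>
    if b 0 then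
      match M.nx c s with
      | some c' => some (.node c' none (.read ⟨0, M.K_pos⟩ fun _ _ => false), b, .stay)
      | none => some (.boot, b, .stay)
    else some (.node c s (.read ⟨0, M.K_pos⟩ fun _ _ => false), b, .stay)
  | .node c s (.read r B), b =>
    let B' : M.Raw := fun k r' => if r' = r then b k else B k r'
    if h : (r : ℕ) + 1 < M.K then some (.node c s (.read ⟨r + 1, h⟩ B'), b, .right)
    else some (.node c s (.back (Fin.last _) B'), b, .right)
  | .node c s (.back r B), b =>
    if h : (r : ℕ) = 0 then
      match M.op c s (M.decode B) with
      | none => some (.tail 0, b, .stay)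
      | some _ => some (.node c s (.write ⟨0, M.K_pos⟩ B), b, .stay)
    else some (.node c s (.back ⟨r - 1, by omega⟩ B), b, .left)
  | .node c s (.write r B), _ =>
    match M.op c s (M.decode B) with
    | none => none
    | some (s', γ) =>
      if h : (r : ℕ) + 1 < M.K then
        some (.node c s (.write ⟨r + 1, h⟩ B), fun k => M.encode γ B k r, .right)
      else some (.node c s' .arrive, fun k => M.encode γ B k r, .right)
  | .tail n, b =>
    if h : (n : ℕ) < M.tail.length then some (.tail ⟨n + 1, by omega⟩, b, M.tail[(n : ℕ)])
    else none

noncomputable instance : Fintype M.State := Fintype.ofFinite _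

theorem card_state : Fintype.card M.State = Fintype.card M.State - 1 + 1 := by
  have : 0 < Fintype.card M.State := Fintype.card_pos_iff.2 ⟨.boot⟩
  omega

/-- The states in their order. -/
noncomputable def stateIso : Fin (Fintype.card M.State - 1 + 1) ≃o M.State :=
  monoEquivOfFin M.State M.card_state

/-- The program which simulates a pass machine. -/
noncomputable def program : Program where
  last := Fintype.card M.State - 1
  next q b := (M.trans (M.stateIso q) b).map fun x => (M.stateIso.symm x.1, x.2)

/-- The snapshot of the simulating program with state `q`. -/
noncomputable def snap (q : M.State) (h : Ordinal.{u}) (tp : Fin 3 → Ordinal.{u} → Bool) :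
    Config.{u} M.program where
  state := M.stateIso.symm q
  head := h
  tape := tp

theorem init_eq : Config.init.{u} M.program = M.snap .boot 0 fun _ _ => false := by
  refine Config.ext' ?_ rfl rfl
  have h : (0 : Fin (Fintype.card M.State - 1 + 1)) = M.stateIso.symm .boot :=
    le_antisymm (Fin.zero_le _) (by
      rw [OrderIso.symm_apply_le]
      exact M.boot_le _)
  exact h

variable {M} {δ : Ordinal.{u}}

theorem snap_step {q q' : M.State} {h : Ordinal.{u}} {tp : Fin 3 → Ordinal.{u} → Bool}
    {w : Fin 3 → Bool} {m : Move} (hq : M.trans q (fun k => tp k h) = some (q', w, m)) :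
    (M.snap q h tp).step δ =
      M.snap q' (m.apply δ h) (fun k ξ => if ξ = h then w k else tp k ξ) := by
  have : M.program.next (M.snap q h tp).state (M.snap q h tp).read =
      some (M.stateIso.symm q', w, m) := by
    show (M.trans (M.stateIso (M.stateIso.symm q)) (fun k => tp k h)).map _ = _
    rw [OrderIso.apply_symm_apply, hq]; rfl
  unfold Config.step
  rw [this]
  exact Config.ext' rfl rfl (by funext k ξ; simp only [snap]; congr)

theorem snap_step_same {q q' : M.State} {h : Ordinal.{u}} {tp : Fin 3 → Ordinal.{u} → Bool}
    {m : Move} (hq : M.trans q (fun k => tp k h) = some (q', (fun k => tp k h), m)) :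
    (M.snap q h tp).step δ = M.snap q' (m.apply δ h) tp := by
  rw [snap_step hq]
  congr 1
  funext k ξ
  split_ifs with h1
  · rw [h1]
  · rfl

end PassMachine
end ITTM

namespace ITTM
namespace PassMachine

variable {M : PassMachine} {δ : Ordinal.{u}}

/-! ### Simulation of one pass -/

open Classical in
/-- The contents of the three tapes which store the tape `W` of a pass machine: the cell `ξ` is
stored in the block which begins at position `K * ξ`, and the first cell is marked. -/
noncomputable def flat (M : PassMachine) (δ : Ordinal.{u}) (W : Ordinal.{u} → M.Cell) (k : Fin 3)
    (ζ : Ordinal.{u}) : Bool :=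
  decide (ζ < δ ∧ ((∃ t, (M.pos t).1 = k ∧ (((M.pos t).2 : ℕ) : Ordinal.{u}) = ζ % M.K ∧
    W (ζ / M.K) t = true) ∨ (k = 0 ∧ ζ = 0)))

open Classical in
theorem flat_eq_true {W : Ordinal.{u} → M.Cell} {k : Fin 3} {ζ : Ordinal.{u}} :
    M.flat δ W k ζ = true ↔ ζ < δ ∧ ((∃ t, (M.pos t).1 = k ∧
      (((M.pos t).2 : ℕ) : Ordinal.{u}) = ζ % M.K ∧ W (ζ / M.K) t = true) ∨ (k = 0 ∧ ζ = 0)) :=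
  decide_eq_true_iff

theorem natCast_K_ne : (M.K : Ordinal.{u}) ≠ 0 := by
  exact_mod_cast M.K_pos.ne'

theorem block_div (ξ : Ordinal.{u}) {r : ℕ} (hr : r < M.K) :
    ((M.K : Ordinal.{u}) * ξ + r) / M.K = ξ := by
  rw [Ordinal.mul_add_div _ natCast_K_ne, Ordinal.div_eq_zero_of_lt
      (by exact_mod_cast hr), add_zero]

theorem block_mod (ξ : Ordinal.{u}) {r : ℕ} (hr : r < M.K) :
    ((M.K : Ordinal.{u}) * ξ + r) % M.K = r := by
  rw [Ordinal.mul_add_mod_self, Ordinal.mod_eq_of_lt (by exact_mod_cast hr)]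

theorem flat_congr {W W' : Ordinal.{u} → M.Cell} {ζ : Ordinal.{u}}
    (h : ζ < δ → W (ζ / M.K) = W' (ζ / M.K)) (k : Fin 3) : M.flat δ W k ζ = M.flat δ W' k ζ := by
  unfold flat
  by_cases hζ : ζ < δ
  · simp [h hζ]
  · simp [hζ]

theorem flat_pos {W : Ordinal.{u} → M.Cell} {ξ : Ordinal.{u}} (t : M.Tr)
    (hξ : (M.K : Ordinal.{u}) * ξ + ((M.pos t).2 : ℕ) < δ) :
    M.flat δ W (M.pos t).1 (M.K * ξ + ((M.pos t).2 : ℕ)) = W ξ t := by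
  rw [Bool.eq_iff_iff, flat_eq_true, block_div _ (M.pos t).2.2, block_mod _ (M.pos t).2.2]
  constructor
  · rintro ⟨_, ⟨t', h1, h2, h3⟩ | ⟨h1, h2⟩⟩
    · have : t' = t := M.pos_inj (Prod.ext h1 (Fin.ext (by exact_mod_cast h2)))
      rwa [← this]
    · have := M.pos_ne t h1
      simp at h2
      exact absurd (by exact_mod_cast h2.2) this
  · exact fun h => ⟨hξ, .inl ⟨t, rfl, rfl, h⟩⟩

theorem flat_mark (W : Ordinal.{u} → M.Cell) {ξ : Ordinal.{u}} (hδ : 0 < δ) :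
    M.flat δ W 0 (M.K * ξ) = true ↔ ξ = 0 := by
  have hK := natCast_K_ne.{u} (M := M)
  rw [flat_eq_true]
  constructor
  · rintro ⟨_, ⟨t, h1, h2, _⟩ | ⟨_, h2⟩⟩
    · have := M.pos_ne t h1
      rw [Ordinal.mul_mod] at h2
      exact absurd (by exact_mod_cast h2) this
    · simpa [hK] using h2
  · rintro rfl
    simpa using hδ

/-- The tape length is a limit, and multiplication by `K` does not lead out of it. -/
structure Closed (M : PassMachine) (δ : Ordinal.{u}) : Prop where
  isSuccLimit : IsSuccLimit δ
  mul_lt : ∀ ξ < δ, (M.K : Ordinal.{u}) * ξ < δ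

theorem Closed.add_lt (hδ : M.Closed δ) {ξ : Ordinal.{u}} (hξ : ξ < δ) (r : ℕ) :
    (M.K : Ordinal.{u}) * ξ + r < δ := by
  induction r with
  | zero => simpa using hδ.mul_lt ξ hξ
  | succ r ih =>
    have := hδ.isSuccLimit.add_one_lt ih
    rwa [add_assoc, ← Nat.cast_succ] at this

theorem right_apply (hδ : M.Closed δ) {ξ : Ordinal.{u}} (hξ : ξ < δ) (r : ℕ) :
    Move.right.apply δ ((M.K : Ordinal.{u}) * ξ + r) = M.K * ξ + (r + 1 : ℕ) := by
  have := hδ.add_lt hξ (r + 1)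
  simp only [Move.apply]
  rw [add_assoc, ← Nat.cast_succ, if_pos this]

theorem left_apply (a : Ordinal.{u}) (r : ℕ) :
    Move.left.apply δ (a + (r + 1 : ℕ)) = a + r := by
  simp only [Move.apply]
  rw [Nat.cast_succ, ← add_assoc, if_neg, Ordinal.pred_add_one]
  exact fun h => h (a + r) (Order.covBy_add_one _)

variable (M) in
/-- The real content of the block at `ξ`. -/
noncomputable def rawAt (δ : Ordinal.{u}) (W : Ordinal.{u} → M.Cell) (ξ : Ordinal.{u}) : M.Raw :=
  fun k r => M.flat δ W k (M.K * ξ + (r : ℕ))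

theorem decode_rawAt (hδ : M.Closed δ) (W : Ordinal.{u} → M.Cell) {ξ : Ordinal.{u}} (hξ : ξ < δ) :
    M.decode (M.rawAt δ W ξ) = W ξ := by
  funext t
  exact flat_pos t (hδ.add_lt hξ _)

theorem encode_rawAt (hδ : M.Closed δ) (W : Ordinal.{u} → M.Cell) {ξ : Ordinal.{u}} (hξ : ξ < δ)
    (γ : M.Cell) (k : Fin 3) (r : Fin M.K) :
    M.encode γ (M.rawAt δ W ξ) k r =
      M.flat δ (Function.update W ξ γ) k (M.K * ξ + (r : ℕ)) := by
  unfold encode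
  split_ifs with h
  · have := h.choose_spec
    set t := h.choose
    have h2 := flat_pos (δ := δ) (W := Function.update W ξ γ) t (hδ.add_lt hξ _)
    rw [this] at h2
    simpa using h2.symm
  · unfold rawAt
    rw [Bool.eq_iff_iff, flat_eq_true, flat_eq_true, block_div _ r.2, block_mod _ r.2]
    refine and_congr_right fun _ => or_congr_left ⟨?_, ?_⟩
    · rintro ⟨t, h1, h2, _⟩
      exact absurd ⟨t, Prod.ext h1 (Fin.ext (by exact_mod_cast h2))⟩ h
    · rintro ⟨t, h1, h2, _⟩
      exact absurd ⟨t, Prod.ext h1 (Fin.ext (by exact_mod_cast h2))⟩ h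

/-- Reading the block at `ξ`. -/
theorem seg_read (hδ : M.Closed δ) {W : Ordinal.{u} → M.Cell} {ξ : Ordinal.{u}} (hξ : ξ < δ)
    (c : M.Ctrl) (s : Option M.Cell) (n : ℕ) : ∀ (r : Fin M.K) (B : M.Raw),
    (r : ℕ) + (n + 1) = M.K → (∀ k (r' : Fin M.K), r' < r → B k r' = M.rawAt δ W ξ k r') →
    Seg δ (M.snap (.node c s (.read r B)) (M.K * ξ + (r : ℕ)) (M.flat δ W))
      (M.snap (.node c s (.back (Fin.last _) (M.rawAt δ W ξ))) (M.K * ξ + (M.K : ℕ)) (M.flat δ W))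
      (M.stateIso.symm (.node c s .arrive)) (M.K * ξ) (fun k ζ => M.flat δ W k ζ = true)
      (fun _ _ => False) := by
  induction n with
  | zero =>
    intro r B hr hB
    have hlast : ¬ ((r : ℕ) + 1 < M.K) := by omega
    have hstep := snap_step_same (δ := δ) (q := .node c s (.read r B))
      (q' := .node c s (.back (Fin.last _) (M.rawAt δ W ξ)))
      (h := M.K * ξ + (r : ℕ)) (tp := M.flat δ W) (m := .right) (by
        simp only [trans, hlast, dite_false]
        congr 4
        funext k r'
        by_cases h : r' = r
        · subst h; simp [rawAt]
        · rw [if_neg h]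
          exact hB k r' (lt_of_le_of_ne (by
            have := r'.2
            exact Fin.le_def.2 (by omega)) h))
    rw [right_apply hδ hξ, show (r : ℕ) + 1 = M.K by omega] at hstep
    exact (Seg.single hstep).weaken (M.stateIso.symm.monotone (M.arrive_le c (.inr rfl) _))
      (le_add_of_nonneg_right zero_le) (fun _ _ h => h) (fun _ _ h => h.elim)
  | succ n ih =>
    intro r B hr hB
    have hlt : (r : ℕ) + 1 < M.K := by omega
    have hstep := snap_step_same (δ := δ) (q := .node c s (.read r B))
      (q' := .node c s (.read ⟨r + 1, hlt⟩
        (fun k r' => if r' = r then M.flat δ W k (M.K * ξ + (r : ℕ)) else B k r')))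
      (h := M.K * ξ + (r : ℕ)) (tp := M.flat δ W) (m := .right) (by
        simp only [trans, hlt, dite_true])
    rw [right_apply hδ hξ] at hstep
    have h2 := ih ⟨r + 1, hlt⟩ (fun k r' => if r' = r then M.flat δ W k
        (M.K * ξ + (r : ℕ)) else B k r')
      (by simp only; omega) (by
        intro k r' hr'
        by_cases h : r' = r
        · subst h; simp [rawAt]
        · simp only [if_neg h]
          refine hB k r' (lt_of_le_of_ne ?_ h)
          have := Fin.lt_def.1 hr'
          simp only at this
          exact Fin.le_def.2 (by omega))
    exact (((Seg.single hstep).weaken (Z' := fun _ _ => False)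
      (M.stateIso.symm.monotone (M.arrive_le c (.inr rfl) _))
      (le_add_of_nonneg_right zero_le) (fun _ _ h => h) (fun _ _ h => h.elim)).trans h2).weaken
      le_rfl le_rfl (fun _ _ h => h) (fun _ _ h => h.elim)

/-- Going back to the beginning of the block at `ξ`. -/
theorem seg_back {W : Ordinal.{u} → M.Cell} {ξ : Ordinal.{u}}
    (c : M.Ctrl) (s : Option M.Cell) (B : M.Raw) {q : M.State}
    (hq : ∀ b, M.trans (.node c s (.back 0 B)) b = some (q, b, .stay)) (n : ℕ) :
    ∀ (r : Fin (M.K + 1)), (r : ℕ) = n →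
    Seg δ (M.snap (.node c s (.back r B)) (M.K * ξ + (r : ℕ)) (M.flat δ W))
      (M.snap q (M.K * ξ) (M.flat δ W))
      (M.stateIso.symm (.node c s .arrive)) (M.K * ξ) (fun k ζ => M.flat δ W k ζ = true)
      (fun _ _ => False) := by
  induction n with
  | zero =>
    intro r hr
    obtain rfl : r = 0 := Fin.ext hr
    have hstep := snap_step_same (δ := δ) (h := M.K * ξ + ((0 : Fin (M.K + 1)) : ℕ))
      (tp := M.flat δ W) (hq _)
    simp only [Move.apply] at hstep
    rw [show M.snap q (M.K * ξ + ((0 : Fin (M.K + 1)) : ℕ)) (M.flat δ W) =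
      M.snap q (M.K * ξ) (M.flat δ W) by simp] at hstep
    exact (Seg.single hstep).weaken (M.stateIso.symm.monotone (M.arrive_le c (.inr rfl) _))
      (le_add_of_nonneg_right zero_le) (fun _ _ h => h) (fun _ _ h => h.elim)
  | succ n ih =>
    intro r hr
    have hne : ¬ (r : ℕ) = 0 := by omega
    have hstep := snap_step_same (δ := δ) (q := .node c s (.back r B))
      (q' := .node c s (.back ⟨r - 1, by omega⟩ B))
      (h := M.K * ξ + (r : ℕ)) (tp := M.flat δ W) (m := .left) (by
        simp only [trans, hne, dite_false])
    have hl := left_apply (δ := δ) ((M.K : Ordinal.{u}) * ξ) n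
    rw [← hr] at hl
    rw [hl] at hstep
    have h2 := ih ⟨r - 1, by omega⟩ (by simp only; omega)
    simp only [show (r : ℕ) - 1 = n by omega] at h2 hstep
    exact (((Seg.single hstep).weaken (Z' := fun _ _ => False)
      (M.stateIso.symm.monotone (M.arrive_le c (.inr rfl) _))
      (le_add_of_nonneg_right zero_le) (fun _ _ h => h) (fun _ _ h => h.elim)).trans h2).weaken
      le_rfl le_rfl (fun _ _ h => h) (fun _ _ h => h.elim)

/-- Writing the block at `ξ`: before position `K * ξ + r` the tapes are already those of `W'`. -/
theorem seg_write (hδ : M.Closed δ) {W : Ordinal.{u} → M.Cell} {ξ : Ordinal.{u}} (hξ : ξ < δ)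
    (c : M.Ctrl) {s s' : Option M.Cell} {γ : M.Cell} (hop : M.op c s (W ξ) = some (s', γ)) (n : ℕ) :
    ∀ (r : Fin M.K), (r : ℕ) + (n + 1) = M.K →
    Seg δ (M.snap (.node c s (.write r (M.rawAt δ W ξ))) (M.K * ξ + (r : ℕ))
        (fun k ζ => if ζ < M.K * ξ + (r : ℕ) then M.flat δ (Function.update W ξ γ) k ζ
          else M.flat δ W k ζ))
      (M.snap (.node c s' .arrive) (M.K * ξ + (M.K : ℕ))
        (fun k ζ => if ζ < M.K * ξ + (M.K : ℕ) then M.flat δ (Function.update W ξ γ) k ζ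
          else M.flat δ W k ζ))
      (M.stateIso.symm (.node c s .arrive)) (M.K * ξ)
      (fun k ζ => M.flat δ W k ζ = true ∧ M.flat δ (Function.update W ξ γ) k ζ = true)
      (fun _ _ => False) := by
  have htape : ∀ r : Fin M.K, (fun k ζ => if ζ = M.K * ξ + (r : ℕ) then
      M.encode γ (M.rawAt δ W ξ) k r else
        if ζ < M.K * ξ + (r : ℕ) then M.flat δ (Function.update W ξ γ) k ζ
          else M.flat δ W k ζ) = (fun k ζ => if ζ < M.K * ξ + ((r : ℕ) + 1 : ℕ) then
          M.flat δ (Function.update W ξ γ) k ζ else M.flat δ W k ζ) := by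
    intro r
    funext k ζ
    rw [encode_rawAt hδ W hξ]
    have : ζ < M.K * ξ + ((r : ℕ) + 1 : ℕ) ↔ ζ = M.K * ξ + (r : ℕ) ∨ ζ < M.K * ξ + (r : ℕ) := by
      rw [Nat.cast_succ, ← add_assoc, Order.lt_add_one_iff, le_iff_eq_or_lt]
    by_cases h1 : ζ = M.K * ξ + (r : ℕ)
    · rw [if_pos h1, if_pos (this.2 (.inl h1)), h1]
    · simp only [this, h1, false_or, if_false]
  have hL : ∀ r : ℕ, ∀ (k : Fin 3) (ζ : Ordinal.{u}), (M.flat δ W k ζ = true ∧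
      M.flat δ (Function.update W ξ γ) k ζ = true) → (if ζ < M.K * ξ + (r : ℕ) then
        M.flat δ (Function.update W ξ γ) k ζ else M.flat δ W k ζ) = true := by
    rintro r k ζ ⟨h1, h2⟩
    split_ifs <;> assumption
  have hdec := decode_rawAt hδ W hξ
  induction n with
  | zero =>
    intro r hr
    have hlast : ¬ ((r : ℕ) + 1 < M.K) := by omega
    have hstep := snap_step (δ := δ) (q := .node c s (.write r (M.rawAt δ W ξ)))
      (q' := .node c s' .arrive) (h := M.K * ξ + (r : ℕ))
      (tp := fun k ζ => if ζ < M.K * ξ + (r : ℕ) then M.flat δ (Function.update W ξ γ) k ζ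
          else M.flat δ W k ζ) (w := fun k => M.encode γ (M.rawAt δ W ξ) k r) (m := .right) (by
        simp only [trans, hlast, dite_false, hdec, hop])
    rw [right_apply hδ hξ, htape, show (r : ℕ) + 1 = M.K by omega] at hstep
    exact (Seg.single hstep).weaken (M.stateIso.symm.monotone (M.arrive_le c (.inr rfl) _))
      (le_add_of_nonneg_right zero_le) (hL r) (fun _ _ h => h.elim)
  | succ n ih =>
    intro r hr
    have hlt : (r : ℕ) + 1 < M.K := by omega
    have hstep := snap_step (δ := δ) (q := .node c s (.write r (M.rawAt δ W ξ)))
      (q' := .node c s (.write ⟨r + 1, hlt⟩ (M.rawAt δ W ξ))) (h := M.K * ξ + (r : ℕ))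
      (tp := fun k ζ => if ζ < M.K * ξ + (r : ℕ) then M.flat δ (Function.update W ξ γ) k ζ
          else M.flat δ W k ζ) (w := fun k => M.encode γ (M.rawAt δ W ξ) k r) (m := .right) (by
        simp only [trans, hlt, dite_true, hdec, hop])
    rw [right_apply hδ hξ, htape] at hstep
    have h2 := ih ⟨r + 1, hlt⟩ (by simp only; omega)
    exact (((Seg.single hstep).weaken (Z' := fun _ _ => False)
      (M.stateIso.symm.monotone (M.arrive_le c (.inr rfl) _))
      (le_add_of_nonneg_right zero_le) (hL r) (fun _ _ h => h.elim)).trans h2).weaken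
      le_rfl le_rfl (fun _ _ h => h) (fun _ _ h => h.elim)

/-- The state in which the treatment of a block begins. -/
def readState (c : M.Ctrl) (s : Option M.Cell) : M.State :=
  .node c s (.read ⟨0, M.K_pos⟩ fun _ _ => false)

/-- The treatment of the block at `ξ`. -/
theorem seg_block (hδ : M.Closed δ) {W : Ordinal.{u} → M.Cell} {ξ : Ordinal.{u}} (hξ : ξ < δ)
    (c : M.Ctrl) {s s' : Option M.Cell} {γ : M.Cell} (hop : M.op c s (W ξ) = some (s', γ)) :
    Seg δ (M.snap (readState c s) (M.K * ξ) (M.flat δ W))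
      (M.snap (.node c s' .arrive) (M.K * (ξ + 1)) (M.flat δ (Function.update W ξ γ)))
      (M.stateIso.symm (.node c s .arrive)) (M.K * ξ)
      (fun k ζ => M.flat δ W k ζ = true ∧ M.flat δ (Function.update W ξ γ) k ζ = true)
      (fun _ _ => False) := by
  have h1 := seg_read hδ (W := W) hξ c s (M.K - 1) ⟨0, M.K_pos⟩ (fun _ _ => false)
    (by have := M.K_pos; simp only; omega) (fun k r' h => absurd h (by simp [Fin.lt_def]))
  have h2 := seg_back (δ := δ) (W := W) (ξ := ξ) c s (M.rawAt δ W ξ)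
    (q := .node c s (.write ⟨0, M.K_pos⟩ (M.rawAt δ W ξ)))
    (by intro b; simp [trans, decode_rawAt hδ W hξ, hop]) M.K (Fin.last _) rfl
  have h3 := seg_write hδ (W := W) hξ c hop (M.K - 1) ⟨0, M.K_pos⟩
    (by have := M.K_pos; simp only; omega)
  have hdiv : ∀ ζ : Ordinal.{u}, ζ < M.K * ξ → ζ / M.K ≠ ξ := by
    intro ζ hζ
    exact ((Ordinal.lt_mul_iff_div_lt natCast_K_ne).1 hζ).ne
  have hdiv' : ∀ ζ : Ordinal.{u}, ¬ ζ < M.K * (ξ + 1) → ζ / M.K ≠ ξ := by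
    intro ζ hζ h
    apply hζ
    rw [Ordinal.lt_mul_iff_div_lt natCast_K_ne, h]
    exact lt_add_one ξ
  have e1 : (fun k ζ => if ζ < (M.K : Ordinal.{u}) * ξ + ((⟨0, M.K_pos⟩ : Fin M.K) : ℕ) then
      M.flat δ (Function.update W ξ γ) k ζ else M.flat δ W k ζ) = M.flat δ W := by
    funext k ζ
    simp only [Nat.cast_zero, add_zero]
    split_ifs with h
    · exact flat_congr (fun _ => by rw [Function.update_of_ne (hdiv ζ h)]) k
    · rfl
  have e2 : (M.K : Ordinal.{u}) * ξ + (M.K : ℕ) = M.K * (ξ + 1) := by rw [mul_add, mul_one]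
  have e3 : (fun k ζ => if ζ < (M.K : Ordinal.{u}) * (ξ + 1) then
      M.flat δ (Function.update W ξ γ) k ζ else M.flat δ W k ζ) =
      M.flat δ (Function.update W ξ γ) := by
    funext k ζ
    split_ifs with h
    · rfl
    · exact flat_congr (fun _ => by rw [Function.update_of_ne (hdiv' ζ h)]) k
  rw [e1] at h3
  rw [e2] at h1 h3
  rw [e3] at h3
  simp only [Nat.cast_zero, add_zero, Fin.val_last] at h1 h2 h3
  rw [e2] at h2
  have hw : ∀ {a b : Config.{u} M.program} {s h}, Seg δ a b s h
      (fun k ζ => M.flat δ W k ζ = true) (fun _ _ => False) → Seg δ a b s h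
      (fun k ζ => M.flat δ W k ζ = true ∧ M.flat δ (Function.update W ξ γ) k ζ = true)
      (fun _ _ => False) := fun H => H.weaken le_rfl le_rfl (fun _ _ h => h.1) (fun _ _ h => h)
  exact (((hw h1).trans (hw h2)).trans h3).weaken le_rfl le_rfl (fun _ _ h => h)
    (fun _ _ h => h.elim)

end PassMachine
end ITTM

namespace ITTM
namespace PassMachine

variable {M : PassMachine} {δ : Ordinal.{u}}

/-- `st` lists the local states of the first `κ` steps of a pass with control state `c`, which
change the tape `W` into `W'`. -/
structure Trace (M : PassMachine) (c : M.Ctrl) (κ : Ordinal.{u}) (W W' : Ordinal.{u} → M.Cell)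
    (st : Ordinal.{u} → Option M.Cell) : Prop where
  zero : st 0 = none
  step : ∀ ξ < κ, M.op c (st ξ) (W ξ) = some (st (ξ + 1), W' ξ)
  limit : ∀ μ ≤ κ, IsSuccLimit μ → (EvBelow μ fun ξ => st μ = none ∨ st ξ = st μ) ∧
    CofBelow μ fun ξ => st ξ = st μ

open Classical in
/-- The tape during a pass, before the treatment of cell `κ`. -/
noncomputable def mix (κ : Ordinal.{u}) (W W' : Ordinal.{u} → M.Cell) (ξ : Ordinal.{u}) : M.Cell :=
  if ξ < κ then W' ξ else W ξ

theorem mix_zero (W W' : Ordinal.{u} → M.Cell) : mix 0 W W' = W := by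
  funext ξ; simp [mix]

theorem mix_update (κ : Ordinal.{u}) (W W' : Ordinal.{u} → M.Cell) :
    Function.update (mix κ W W') κ (W' κ) = mix (κ + 1) W W' := by
  funext ξ
  by_cases h : ξ = κ
  · subst h; simp [mix]
  · rw [Function.update_of_ne h]
    simp [mix, Order.lt_add_one_iff, le_iff_lt_or_eq, h]

theorem seg_arrive (hδ : M.Closed δ) {W : Ordinal.{u} → M.Cell} {ξ : Ordinal.{u}} (hξ : ξ ≠ 0)
    (c : M.Ctrl) (s : Option M.Cell) :
    Seg δ (M.snap (.node c s .arrive) (M.K * ξ) (M.flat δ W))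
      (M.snap (readState c s) (M.K * ξ) (M.flat δ W))
      (M.stateIso.symm (.node c s .arrive)) (M.K * ξ) (fun k ζ => M.flat δ W k ζ = true)
      (fun _ _ => False) := by
  have h0 : ¬ M.flat δ W 0 (M.K * ξ) = true := by
    rw [flat_mark W hδ.isSuccLimit.bot_lt]; exact hξ
  have hstep := snap_step_same (δ := δ) (q := .node c s .arrive) (q' := readState c s)
    (h := M.K * ξ) (tp := M.flat δ W) (m := .stay) (by simp [trans, h0, readState])
  exact (Seg.single hstep).weaken le_rfl le_rfl (fun _ _ h => h) (fun _ _ h => h.elim)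

/-- The run during the first `κ` steps of a pass. -/
theorem Trace.seg (hδ : M.Closed δ) {c : M.Ctrl} {κ : Ordinal.{u}} {W W' : Ordinal.{u} → M.Cell}
    {st : Ordinal.{u} → Option M.Cell} (T : M.Trace c κ W W' st) (hκ0 : 0 < κ) (hκ : κ ≤ δ) :
    Seg δ (M.snap (readState c none) 0 (M.flat δ W))
      (M.snap (.node c (st κ) .arrive) (if M.K * κ < δ then M.K * κ else 0)
        (M.flat δ (mix κ W W'))) 0 0
      (fun k ζ => M.flat δ W k ζ = true ∧ M.flat δ W' k ζ = true)
      (fun k ζ => M.flat δ W k ζ = false) := by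
  have hK := natCast_K_ne.{u} (M := M)
  have hN := Ordinal.isNormal_mul_right (pos_iff_ne_zero.2 hK)
  let V : Ordinal.{u} → Config.{u} M.program := fun ξ => if ξ = 0 then
    M.snap (readState c none) 0 (M.flat δ W) else
    M.snap (.node c (st ξ) .arrive) (if M.K * ξ < δ then M.K * ξ else 0) (M.flat δ (mix ξ W W'))
  have V0 : V 0 = M.snap (readState c none) 0 (M.flat δ W) := if_pos rfl
  have Vn : ∀ ξ ≠ 0, V ξ = M.snap (.node c (st ξ) .arrive) (if M.K * ξ < δ then M.K * ξ else 0)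
    (M.flat δ (mix ξ W W')) := fun ξ h => if_neg h
  have Vtape : ∀ ξ, (V ξ).tape = M.flat δ (mix ξ W W') := by
    intro ξ
    by_cases h : ξ = 0
    · rw [h, V0, mix_zero]; rfl
    · rw [Vn ξ h]; rfl
  have hnext : ∀ ξ < κ, (if M.K * (ξ + 1) < δ then M.K * (ξ + 1) else 0) = M.K * (ξ + 1) := by
    intro ξ hξ
    rw [if_pos]
    rw [mul_add, mul_one]
    exact hδ.add_lt (hξ.trans_le hκ) _
  have hcong : ∀ {A B : Ordinal.{u} → M.Cell} {k : Fin 3} {ζ : Ordinal.{u}},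
      A (ζ / M.K) = B (ζ / M.K) → M.flat δ A k ζ = M.flat δ B k ζ := fun h =>
    flat_congr (fun _ => h) _
  rw [← V0, ← Vn κ hκ0.ne']
  -- At a limit cell `μ` the least states and positions in the previous blocks determine the
  -- snapshot: the state is an arrival with the limit of the local states, and the position of
  -- the head is `K * μ`.
  refine Seg.chain hκ0 (s := fun ξ => M.stateIso.symm (.node c (st ξ) .arrive))
    (h := fun ξ => M.K * ξ)
    (L := fun ξ k ζ => M.flat δ (mix ξ W W') k ζ = true ∧ M.flat δ (mix (ξ + 1) W W') k ζ = true)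
    (Z := fun _ _ _ => False) ?_ ?_ (fun _ _ => Fin.zero_le _) (fun _ _ => zero_le) ?_ ?_
  · intro ξ hξ
    have hξδ := hξ.trans_le hκ
    have hop : M.op c (st ξ) (mix ξ W W' ξ) = some (st (ξ + 1), W' ξ) := by
      simpa [mix] using T.step ξ hξ
    have hb := seg_block hδ hξδ c hop
    rw [mix_update] at hb
    rw [Vn (ξ + 1) (by simp), hnext ξ hξ]
    by_cases h0 : ξ = 0
    · subst h0
      rw [V0]
      simpa [mix_zero, T.zero] using hb
    · rw [Vn ξ h0, if_pos (hδ.mul_lt ξ hξδ)]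
      exact (((seg_arrive hδ h0 c (st ξ)).weaken le_rfl le_rfl (fun _ _ h => h.1)
        (fun _ _ h => h)).trans hb).weaken le_rfl le_rfl (fun _ _ h => h) (fun _ _ h => h.elim)
  · intro μ hμκ hμ
    obtain ⟨t1, t2⟩ := T.limit μ hμκ hμ
    have hμ0 : μ ≠ 0 := hμ.bot_lt.ne'
    rw [Vtape, Vn μ hμ0]
    refine ⟨?_, ?_, ⟨M.K * μ, rfl, ?_, ?_⟩, ?_, ?_⟩
    · exact t1.mono fun ξ _ h => M.stateIso.symm.monotone
        (M.arrive_le c (h.imp id id) _)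
    · intro ξ hξ
      obtain ⟨ξ', h1, h2, h3⟩ := t2 (max ξ 1) (max_lt hξ (by simpa using hμ.add_one_lt hμ.bot_lt))
      have h1' : ξ' ≠ 0 := (zero_lt_one.trans_le ((le_max_right _ _).trans h1)).ne'
      refine ⟨ξ', (le_max_left _ _).trans h1, h2, ?_⟩
      show (V ξ').state ≤ _
      rw [Vn ξ' h1', h3]
      exact le_rfl
    · intro x hx
      obtain ⟨ξ, hξ, h⟩ := (hN.lt_iff_exists_lt hμ).1 hx
      exact ⟨ξ, hξ, fun ξ' h1 _ => h.trans_le (hN.monotone h1)⟩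
    · intro ξ hξ
      refine ⟨ξ, le_rfl, hξ, ?_⟩
      show (V ξ).head ≤ _
      by_cases h0 : ξ = 0
      · rw [h0, V0]; exact zero_le
      · rw [Vn ξ h0]
        show (if _ then _ else _) ≤ _
        split_ifs
        · exact hN.monotone hξ.le
        · exact zero_le
    · intro k ζ hv
      replace hv : M.flat δ (mix μ W W') k ζ = true := hv
      rcases lt_or_ge (ζ / M.K) μ with h | h
      · refine ⟨ζ / M.K + 1, hμ.add_one_lt h, fun ξ h1 h2 => ?_⟩
        have h3 : ζ / M.K < ξ := (lt_add_one _).trans_le h1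
        rw [← hv]
        exact ⟨hcong (by simp [mix, h, h3]), hcong (by simp [mix, h, h3.trans (lt_add_one ξ)])⟩
      · refine evBelow_of_forall hμ.bot_lt fun ξ hξ => ?_
        rw [← hv]
        exact ⟨hcong (by simp [mix, h.not_gt, (hξ.le.trans h).not_gt]),
          hcong (by simp [mix, h.not_gt, ((hμ.add_one_lt hξ).le.trans h).not_gt])⟩
    · intro k ζ hv
      replace hv : M.flat δ (mix μ W W') k ζ = false := hv
      refine EvBelow.cof ?_
      rcases lt_or_ge (ζ / M.K) μ with h | h
      · refine ⟨ζ / M.K + 1, hμ.add_one_lt h, fun ξ h1 h2 => ?_⟩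
        have h3 : ζ / M.K < ξ := (lt_add_one _).trans_le h1
        refine .inr ?_
        rw [← hv, Vtape]
        exact hcong (by simp [mix, h, h3])
      · refine evBelow_of_forall hμ.bot_lt fun ξ hξ => ?_
        refine .inr ?_
        rw [← hv, Vtape]
        exact hcong (by simp [mix, h.not_gt, (hξ.le.trans h).not_gt])
  · rintro ξ hξ k ζ ⟨h1, h2⟩
    have : ∀ η, M.flat δ (mix η W W') k ζ = true := by
      intro η
      rcases lt_or_ge (ζ / M.K) η with h | h
      · rw [← h2]; exact hcong (by simp [mix, h])
      · rw [← h1]; exact hcong (by simp [mix, h.not_gt])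
    exact ⟨this _, this _⟩
  · intro k ζ h
    exact ⟨0, hκ0, .inr (by rw [Vtape, mix_zero]; exact h)⟩

variable (M) in
/-- The snapshot at the beginning of a cycle (`none`), or at the beginning of a pass with the given
control state. -/
noncomputable def conf (δ : Ordinal.{u}) (c : Option M.Ctrl) (W : Ordinal.{u} → M.Cell) :
    Config.{u} M.program :=
  match c with
  | none => M.snap .boot 0 (M.flat δ W)
  | some c => M.snap (readState c none) 0 (M.flat δ W)

/-- A complete pass. -/
theorem seg_pass (hδ : M.Closed δ) {c : M.Ctrl} {W W' : Ordinal.{u} → M.Cell}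
    {st : Ordinal.{u} → Option M.Cell} (T : M.Trace c δ W W' st) :
    Seg δ (M.conf δ (some c) W) (M.conf δ (M.nx c (st δ)) W') 0 0
      (fun k ζ => M.flat δ W k ζ = true ∧ M.flat δ W' k ζ = true)
      (fun k ζ => M.flat δ W k ζ = false) := by
  have hδ0 := hδ.isSuccLimit.bot_lt
  have h1 := T.seg hδ hδ0 le_rfl
  have hK : ¬ (M.K : Ordinal.{u}) * δ < δ :=
    not_lt.2 (Ordinal.le_mul_right δ (pos_iff_ne_zero.2 natCast_K_ne))
  rw [if_neg hK] at h1
  have hmix : M.flat δ (mix δ W W') = M.flat δ W' := by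
    funext k ζ
    refine flat_congr (fun h => ?_) k
    have : ζ / M.K < δ := (Ordinal.lt_mul_iff_div_lt natCast_K_ne).1
      (h.trans_le (Ordinal.le_mul_right δ (pos_iff_ne_zero.2 natCast_K_ne)))
    simp [mix, this]
  rw [hmix] at h1
  have hm : M.flat δ W' 0 0 = true := by
    have := (flat_mark (M := M) W' (ξ := 0) hδ0).2 rfl
    simpa using this
  have h2 : Seg δ (M.snap (.node c (st δ) .arrive) 0 (M.flat δ W'))
      (M.conf δ (M.nx c (st δ)) W') 0 0 (fun k ζ => M.flat δ W' k ζ = true) (fun _ _ => False) := by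
    cases hn : M.nx c (st δ) with
    | none =>
      exact (Seg.single (snap_step_same (m := .stay) (by simp [trans, hm, hn]))).weaken
        (Fin.zero_le _) le_rfl (fun _ _ h => h) (fun _ _ h => h.elim)
    | some c' =>
      exact (Seg.single (snap_step_same (m := .stay)
        (by simp [trans, hm, hn, readState]))).weaken
        (Fin.zero_le _) le_rfl (fun _ _ h => h) (fun _ _ h => h.elim)
  exact (h1.trans (h2.weaken le_rfl le_rfl (fun _ _ h => h.2) fun _ _ h => h)).weaken le_rfl le_rfl
    (fun _ _ h => h) (fun _ _ h => .inl h)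

/-- The first step of a cycle. -/
theorem seg_boot (hδ : M.Closed δ) (W : Ordinal.{u} → M.Cell) :
    Seg δ (M.conf δ none W) (M.conf δ (some M.start) W) 0 0
      (fun k ζ => M.flat δ W k ζ = true) (fun k ζ => M.flat δ W k ζ = false) := by
  have hm : M.flat δ W 0 0 = true := by
    have := (flat_mark (M := M) W (ξ := 0) hδ.isSuccLimit.bot_lt).2 rfl
    simpa using this
  refine (Seg.single (snap_step_same (m := .stay) ?_)).weaken
    (Fin.zero_le _) le_rfl (fun _ _ h => h) (fun _ _ h => h)
  simp only [trans, readState]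
  congr 3
  funext k
  by_cases hk : k = 0
  · subst hk; simp [hm]
  · simp [hk]

/-- After the first step, the run of the program is the run from the blank tape of the pass
machine. -/
theorem run_eq (hδ : M.Closed δ) {t : Ordinal.{u}} (ht : 0 < t) :
    run δ M.program t = runFrom δ (M.conf δ none fun _ _ => false) t := by
  obtain ⟨r, rfl⟩ := exists_add_of_le (Order.add_one_le_of_lt ht)
  rw [run_eq_runFrom, runFrom_add _ _ (0 + 1), runFrom_add _ _ (0 + 1), runFrom_add_one,
    runFrom_add_one, runFrom_zero, runFrom_zero, init_eq]
  congr 1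
  have hfl : ∀ k ζ, M.flat δ (fun _ _ => false) k ζ = true ↔ k = 0 ∧ ζ = 0 := by
    intro k ζ
    rw [flat_eq_true]
    have := hδ.isSuccLimit.bot_lt
    constructor
    · rintro ⟨_, ⟨t, h⟩ | h⟩
      · simp at h
      · exact h
    · rintro ⟨h1, rfl⟩
      exact ⟨this, .inr ⟨h1, rfl⟩⟩
  have hr : M.conf δ none (fun _ _ => false) = M.snap .boot 0 (M.flat δ fun _ _ => false) := rfl
  rw [hr, snap_step (q' := .node M.start none (.read ⟨0, M.K_pos⟩ fun _ _ => false))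
      (m := .stay) rfl,
    snap_step (q' := .node M.start none (.read ⟨0, M.K_pos⟩ fun _ _ => false)) (m := .stay) rfl]
  congr 1
  funext k ζ
  by_cases hζ : ζ = 0
  · subst hζ
    by_cases hk : k = 0
    · subst hk; simp
    · have : M.flat δ (fun _ _ => false) k 0 = false := by
        rw [← Bool.not_eq_true, hfl]; simp [hk]
      simp [hk, this]
  · have : M.flat δ (fun _ _ => false) k ζ = false := by
      rw [← Bool.not_eq_true, hfl]; simp [hζ]
    simp [hζ, this]

theorem exists_tail_run (h : Ordinal.{u}) (tp : Fin 3 → Ordinal.{u} → Bool) (n : ℕ)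
    (hn : n ≤ M.tail.length) : ∃ t, runFrom δ (M.snap (.tail 0) h tp) t =
      M.snap (.tail ⟨n, Nat.lt_succ_of_le hn⟩) ((M.tail.take n).foldl (fun h m => m.apply δ h) h)
        tp := by
  induction n with
  | zero => exact ⟨0, by simp⟩
  | succ n ih =>
    obtain ⟨t, ht⟩ := ih (by omega)
    refine ⟨t + 1, ?_⟩
    have hlt : n < M.tail.length := by omega
    rw [runFrom_add_one, ht, snap_step_same (q' := .tail ⟨n + 1, by omega⟩) (m := M.tail[n])
      (by simp [trans, hlt])]
    rw [← List.take_concat_get' _ _ hlt, List.foldl_append]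
    rfl

/-- A pass which ends the run at cell `ξ`. -/
theorem exists_halted (hδ : M.Closed δ) {c : M.Ctrl} {ξ : Ordinal.{u}} (hξ : ξ < δ)
    {W W' : Ordinal.{u} → M.Cell} {st : Ordinal.{u} → Option M.Cell} (T : M.Trace c ξ W W' st)
    (hop : M.op c (st ξ) (W ξ) = none) :
    ∃ t, (runFrom δ (M.conf δ (some c) W) t).Halted ∧
      (runFrom δ (M.conf δ (some c) W) t).head =
        M.tail.foldl (fun h m => m.apply δ h) (M.K * ξ) := by
  have h1 : ∃ t, runFrom δ (M.conf δ (some c) W) t =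
      M.snap (readState c (st ξ)) (M.K * ξ) (M.flat δ (mix ξ W W')) := by
    rcases eq_or_ne ξ 0 with rfl | h0
    · exact ⟨0, by simp [conf, T.zero, mix_zero]⟩
    · have h2 := T.seg hδ (pos_iff_ne_zero.2 h0) hξ.le
      rw [if_pos (hδ.mul_lt ξ hξ)] at h2
      obtain ⟨t, _, ht, _⟩ := h2
      obtain ⟨t', _, ht', _⟩ := seg_arrive hδ (W := mix ξ W W') h0 c (st ξ)
      exact ⟨t + t', by rw [runFrom_add, conf, ht, ht']⟩
  obtain ⟨t1, h1⟩ := h1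
  have hmix : mix ξ W W' ξ = W ξ := by simp [mix]
  obtain ⟨t2, _, h2, _⟩ := seg_read hδ (W := mix ξ W W') hξ c (st ξ) (M.K - 1) ⟨0, M.K_pos⟩
    (fun _ _ => false) (by have := M.K_pos; simp only; omega)
    (fun k r' h => absurd h (by simp [Fin.lt_def]))
  obtain ⟨t3, _, h3, _⟩ := seg_back (δ := δ) (W := mix ξ W W') (ξ := ξ) c (st ξ)
    (M.rawAt δ (mix ξ W W') ξ) (q := .tail 0)
    (by intro b; simp [trans, decode_rawAt hδ _ hξ, hmix, hop]) M.K (Fin.last _) rfl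
  obtain ⟨t4, h4⟩ := exists_tail_run (M := M) (δ := δ) (M.K * ξ) (M.flat δ (mix ξ W W'))
    M.tail.length le_rfl
  simp only [Nat.cast_zero, add_zero, Fin.val_last] at h2 h3
  have : runFrom δ (M.conf δ (some c) W) (t1 + t2 + t3 + t4) =
      M.snap (.tail ⟨M.tail.length, Nat.lt_succ_self _⟩)
        (M.tail.foldl (fun h m => m.apply δ h) (M.K * ξ)) (M.flat δ (mix ξ W W')) := by
    rw [List.take_length] at h4
    rw [runFrom_add, runFrom_add, runFrom_add, h1, readState, h2, h3, h4]
  refine ⟨t1 + t2 + t3 + t4, ?_, ?_⟩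
  · rw [this]
    show (M.trans (M.stateIso (M.stateIso.symm _)) _).map _ = none
    rw [OrderIso.apply_symm_apply]
    simp [trans]
  · rw [this]
    simp [snap]

end PassMachine
end ITTM

namespace ITTM

/-! ### Cycles of passes as trees of commands -/

/-- A tree of passes over the tape. The content of a cell is the set of its tracks which carry `1`.

* `boot` ends the cycle.
* `scan P fb fp fa k` looks for the first cell whose content satisfies `P` (the pivot); it changes
  the cells before the pivot by `fb`, the pivot by `fp` and the later cells by `fa`, and goes on
  with `k`, applied to the old content of the pivot, or to `none` if there is no pivot.
* `carry n f k` has, in the cells `ω * x + y`, a local state which begins with `none` at `y = 0` and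
  is changed by `n` when a cell is passed; the cells are changed by `f`.
* `halt P` ends the run at the first cell whose content satisfies `P`. -/
inductive Cmd (Tr : Type) : Type
  | boot
  | scan (P : (Tr → Prop) → Prop) (fb fp fa : (Tr → Prop) → Tr → Prop)
      (k : Option (Tr → Prop) → Cmd Tr)
  | carry (n : Option (Tr → Prop) → (Tr → Prop) → Option (Tr → Prop))
      (f : Option (Tr → Prop) → (Tr → Prop) → Tr → Prop) (k : Cmd Tr)
  | halt (P : (Tr → Prop) → Prop)

namespace Cmd

variable {Tr : Type}

/-- The subtrees of a tree of passes. -/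
def subs : Cmd Tr → Set (Cmd Tr)
  | boot => {boot}
  | scan P fb fp fa k => insert (scan P fb fp fa k) (⋃ r, (k r).subs)
  | carry n f k => insert (carry n f k) k.subs
  | halt P => {halt P}

theorem mem_subs (c : Cmd Tr) : c ∈ c.subs := by
  cases c <;> simp [subs]

theorem finite_subs [Finite Tr] (c : Cmd Tr) : c.subs.Finite := by
  induction c with
  | boot => exact Set.finite_singleton _
  | scan P fb fp fa k ih => exact (Set.finite_iUnion ih).insert _
  | carry n f k ih => exact ih.insert _
  | halt P => exact Set.finite_singleton _

theorem subs_trans {c c' : Cmd Tr} (h : c' ∈ c.subs) : c'.subs ⊆ c.subs := by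
  induction c with
  | boot => rw [Set.mem_singleton_iff.1 h]
  | scan P fb fp fa k ih =>
    rcases h with rfl | h
    · exact subset_rfl
    · obtain ⟨r, hr⟩ := Set.mem_iUnion.1 h
      exact (ih r hr).trans ((Set.subset_iUnion (fun r => (k r).subs) r).trans
        (Set.subset_insert _ _))
  | carry n f k ih =>
    rcases h with rfl | h
    · exact subset_rfl
    · exact (ih h).trans (Set.subset_insert _ _)
  | halt P => rw [Set.mem_singleton_iff.1 h]

/-- The tree by which a cycle is continued after its first pass, with final local state `s`. -/
def cont : Cmd Tr → Option (Tr → Prop) → Cmd Tr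
  | boot, _ => boot
  | scan _ _ _ _ k, s => k s
  | carry _ _ k, _ => k
  | halt P, _ => halt P

theorem cont_mem {c c' : Cmd Tr} (h : c' ∈ c.subs) (s : Option (Tr → Prop)) :
    c'.cont s ∈ c.subs := by
  refine subs_trans h ?_
  cases c' with
  | boot => exact mem_subs _
  | scan P fb fp fa k => exact .inr (Set.mem_iUnion.2 ⟨s, mem_subs _⟩)
  | carry n f k => exact .inr (mem_subs _)
  | halt P => exact mem_subs _

open Classical in
/-- A content of a cell, as a function with values in `Bool`. -/
noncomputable def ofProp (γ : Tr → Prop) : Tr → Bool := fun t => decide (γ t)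

/-- The set of the tracks which carry `1`. -/
def toProp (γ : Tr → Bool) : Tr → Prop := fun t => γ t = true

open Classical in
@[simp] theorem toProp_ofProp (γ : Tr → Prop) : toProp (ofProp γ) = γ := by
  funext t
  exact decide_eq_true_eq

@[simp] theorem map_toProp_ofProp (s : Option (Tr → Prop)) :
    (s.map ofProp).map toProp = s := by
  cases s <;> simp

open Classical in
/-- The treatment of a cell with content `γ` and local state `s` during the first pass of a tree. -/
noncomputable def op : Cmd Tr → Option (Tr → Bool) → (Tr → Bool) →
    Option (Option (Tr → Bool) × (Tr → Bool))
  | boot, _, γ => some (none, γ)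
  | scan P fb fp _ _, none, γ =>
    if P (toProp γ) then some (some γ, ofProp (fp (toProp γ)))
    else some (none, ofProp (fb (toProp γ)))
  | scan _ _ _ fa _, some g, γ => some (some g, ofProp (fa (toProp γ)))
  | carry n f _, s, γ => some ((n (s.map toProp) (toProp γ)).map ofProp,
      ofProp (f (s.map toProp) (toProp γ)))
  | halt P, _, γ => if P (toProp γ) then none else some (none, γ)

end Cmd

/-- The way in which the tracks of a pass machine are stored in blocks of `K` cells. -/
structure Layout where
  K : ℕ
  Tr : Type
  finTr : Finite Tr
  pos : Tr → Fin 3 × Fin K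
  pos_inj : Function.Injective pos
  pos_ne : ∀ t, (pos t).1 = 0 → ((pos t).2 : ℕ) ≠ 0
  K_pos : 0 < K

namespace Layout

variable (Λ : Layout)

open Classical in
/-- The pass machine all of whose cycles are executions of `root`. -/
noncomputable def machine (root : Cmd Λ.Tr) (tail : List Move) : PassMachine where
  K := Λ.K
  Tr := Λ.Tr
  Ctrl := root.subs
  finTr := Λ.finTr
  finCtrl := by
    have := Λ.finTr
    exact root.finite_subs
  pos := Λ.pos
  pos_inj := Λ.pos_inj
  pos_ne := Λ.pos_ne
  K_pos := Λ.K_pos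
  start := ⟨root, root.mem_subs⟩
  op c s γ := c.1.op s γ
  nx c s :=
    if c.1.cont (s.map Cmd.toProp) = .boot then none
    else some ⟨c.1.cont (s.map Cmd.toProp), Cmd.cont_mem c.2 _⟩
  tail := tail

/-- A tape whose cells are indexed by an ordinal `x < d` and a number `y`; the cell `(x, y)` is the
cell with number `ω * x + y`. -/
abbrev Tape (d : Ordinal.{u}) : Type (u + 1) := Set.Iio d → ℕ → Λ.Tr → Prop

end Layout

/-- The finite part of an ordinal. -/
noncomputable def finPart (ξ : Ordinal.{u}) : ℕ :=
  (Ordinal.lt_omega0.1 (Ordinal.mod_lt ξ Ordinal.omega0_ne_zero)).choose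

theorem finPart_spec (ξ : Ordinal.{u}) : (finPart ξ : Ordinal.{u}) = ξ % Ordinal.omega0 :=
  (Ordinal.lt_omega0.1 (Ordinal.mod_lt ξ Ordinal.omega0_ne_zero)).choose_spec.symm

theorem finPart_mul_add (x : Ordinal.{u}) (y : ℕ) : finPart (Ordinal.omega0 * x + y) = y := by
  have := finPart_spec (Ordinal.omega0 * x + y)
  rw [Ordinal.mul_add_mod_self, Ordinal.natCast_mod_omega0] at this
  exact_mod_cast this

theorem mul_add_div_omega0 (x : Ordinal.{u}) (y : ℕ) :
    (Ordinal.omega0 * x + y) / Ordinal.omega0 = x := by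
  rw [Ordinal.mul_add_div _ Ordinal.omega0_ne_zero,
    Ordinal.div_eq_zero_of_lt (Ordinal.natCast_lt_omega0 y), add_zero]

theorem eq_mul_add (ξ : Ordinal.{u}) :
    ξ = Ordinal.omega0 * (ξ / Ordinal.omega0) + finPart ξ := by
  rw [finPart_spec, Ordinal.div_add_mod]

theorem mul_add_lt_mul {d x : Ordinal.{u}} (hx : x < d) (y : ℕ) :
    Ordinal.omega0 * x + y < Ordinal.omega0 * d := by
  rw [Ordinal.lt_mul_iff_div_lt Ordinal.omega0_ne_zero, mul_add_div_omega0]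
  exact hx

theorem mul_add_lt_mul_add {x x' : Ordinal.{u}} {y y' : ℕ} :
    Ordinal.omega0 * x + y < Ordinal.omega0 * x' + y' ↔ x < x' ∨ x = x' ∧ y < y' := by
  rcases lt_trichotomy x x' with h | rfl | h
  · simp only [h, true_or, iff_true]
    exact (mul_add_lt_mul h y).trans_le (le_add_of_nonneg_right zero_le)
  · simp
  · simp only [h.not_gt, h.ne', false_and, or_false, iff_false, not_lt]
    exact ((mul_add_lt_mul h y').trans_le (le_add_of_nonneg_right zero_le)).le

variable {Λ : Layout} {root : Cmd Λ.Tr} {tail : List Move} {d : Ordinal.{u}}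

open Classical in
variable (root tail) in
/-- The tape of the pass machine. -/
noncomputable def lin (V : Λ.Tape d) (ξ : Ordinal.{u}) : (Λ.machine root tail).Cell := fun t =>
  if h : ξ / Ordinal.omega0 < d then decide (V ⟨ξ / Ordinal.omega0, h⟩ (finPart ξ) t) else false

open Classical in
theorem lin_apply (V : Λ.Tape d) (x : Set.Iio d) (y : ℕ) :
    lin root tail V (Ordinal.omega0 * x.1 + y) = fun t => decide (V x y t) := by
  funext t
  unfold lin
  have hx : x.1 < d := x.2
  simp only [mul_add_div_omega0, finPart_mul_add, hx, dite_true]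

theorem closed (hd : 0 < d) : (Λ.machine root tail).Closed (Ordinal.omega0 * d) where
  isSuccLimit := Ordinal.isSuccLimit_mul_left Ordinal.isSuccLimit_omega0 hd
  mul_lt ξ hξ := by
    rw [Ordinal.lt_mul_iff_div_lt Ordinal.omega0_ne_zero] at hξ
    have := mul_add_lt_mul hξ ((Λ.machine root tail).K * finPart ξ)
    rw [eq_mul_add ξ, mul_add, ← mul_assoc,
      Ordinal.natCast_mul_omega0 (n := (Λ.machine root tail).K) Λ.K_pos]
    rw [Ordinal.natCast_mul] at this
    exact this

open PassMachine in
/-- At each place of the real tapes there is either a bit of a cell of the tape `V`, or a bit which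
does not depend on `V`. -/
theorem flat_lin_cases (k : Fin 3) (ζ : Ordinal.{u}) :
    (∃ x y t, ∀ V : Λ.Tape d, (Λ.machine root tail).flat (Ordinal.omega0 * d)
        (lin root tail V) k ζ =
      true ↔ V x y t) ∨
    (∃ b : Prop, ∀ V : Λ.Tape d, (Λ.machine root tail).flat (Ordinal.omega0 * d)
        (lin root tail V) k ζ
      = true ↔ b) := by
  by_cases h : ζ < Ordinal.omega0 * d ∧ ∃ t, (Λ.pos t).1 = k ∧
    (((Λ.pos t).2 : ℕ) : Ordinal.{u}) = ζ % Λ.K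
  · obtain ⟨hζ, t, h1, h2⟩ := h
    have hK : (Λ.K : Ordinal.{u}) ≠ 0 := by exact_mod_cast Λ.K_pos.ne'
    have hx : ζ / Λ.K / Ordinal.omega0 < d := by
      rw [← Ordinal.lt_mul_iff_div_lt Ordinal.omega0_ne_zero, ← Ordinal.lt_mul_iff_div_lt hK]
      exact hζ.trans_le (Ordinal.le_mul_right _ (pos_iff_ne_zero.2 hK))
    refine .inl ⟨⟨_, hx⟩, finPart (ζ / Λ.K), t, fun V => ?_⟩
    have h3 := flat_pos (M := Λ.machine root tail) (δ := Ordinal.omega0 * d) (W := lin root tail V)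
      (ξ := ζ / Λ.K) t
    have h4 : ((Λ.machine root tail).K : Ordinal.{u}) * (ζ / Λ.K) +
        ((((Λ.machine root tail).pos t).2 : ℕ) : Ordinal.{u}) = ζ := by
      have := Ordinal.div_add_mod ζ Λ.K
      rw [← h2] at this
      exact this
    rw [h4] at h3
    have h5 : ((Λ.machine root tail).pos t).1 = k := h1
    rw [h5] at h3
    rw [h3 hζ]
    simp [lin, hx]
  · refine .inr ⟨ζ < Ordinal.omega0 * d ∧ k = 0 ∧ ζ = 0, fun V => ?_⟩
    rw [flat_eq_true]
    constructor
    · rintro ⟨h1, ⟨t, h2, h3, _⟩ | h2⟩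
      · exact absurd ⟨h1, t, h2, h3⟩ h
      · exact ⟨h1, h2⟩
    · exact fun h => ⟨h.1, .inr h.2⟩

/-- The snapshot at which the execution of the tree `c` on the tape `V` begins. -/
noncomputable def start (root : Cmd Λ.Tr) (tail : List Move) (c : root.subs) (V : Λ.Tape d) :
    Config.{u} (Λ.machine root tail).program :=
  open Classical in
  (Λ.machine root tail).conf (Ordinal.omega0 * d) (if c.1 = .boot then none else some c)
    (lin root tail V)

/-- The snapshot at the beginning of a cycle. -/
noncomputable def bootConf (root : Cmd Λ.Tr) (tail : List Move) (V : Λ.Tape d) :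
    Config.{u} (Λ.machine root tail).program :=
  (Λ.machine root tail).conf (Ordinal.omega0 * d) none (lin root tail V)

/-- The run leads from `c` to a later snapshot `c'`; the bits which are `1` on `V` and on `V'`
constantly are `1` before the arrival at `c'`, and those which are `0` on `V` are `0` at some
time. -/
def Leads (root : Cmd Λ.Tr) (tail : List Move)
    (c c' : Config.{u} (Λ.machine root tail).program) (V V' : Λ.Tape d) : Prop :=
  Seg (Ordinal.omega0 * d) c c' 0 0
    (fun k ζ => (Λ.machine root tail).flat (Ordinal.omega0 * d) (lin root tail V) k ζ = true ∧
      (Λ.machine root tail).flat (Ordinal.omega0 * d) (lin root tail V') k ζ = true)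
    (fun k ζ => (Λ.machine root tail).flat (Ordinal.omega0 * d) (lin root tail V) k ζ = false)

theorem flat_mono {V V' V₁ : Λ.Tape d} (h : ∀ x y t, V x y t → V' x y t → V₁ x y t)
    (k : Fin 3) (ζ : Ordinal.{u})
    (h1 : (Λ.machine root tail).flat (Ordinal.omega0 * d) (lin root tail V) k ζ = true)
    (h2 : (Λ.machine root tail).flat (Ordinal.omega0 * d) (lin root tail V') k ζ = true) :
    (Λ.machine root tail).flat (Ordinal.omega0 * d) (lin root tail V₁) k ζ = true := by
  rcases flat_lin_cases (root := root) (tail := tail) (d := d) k ζ with ⟨x, y, t, hV⟩ | ⟨b, hV⟩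
  · rw [hV] at *; exact h x y t h1 h2
  · rw [hV] at *; exact h1

theorem Leads.trans {c c' c'' : Config.{u} (Λ.machine root tail).program}
    {V V' V'' : Λ.Tape d} (h1 : Leads root tail c c' V V') (h2 : Leads root tail c' c'' V' V'')
    (h : ∀ x y t, V x y t → V'' x y t → V' x y t) : Leads root tail c c'' V V'' := by
  have h3 := flat_mono (root := root) (tail := tail) h
  exact ((h1.weaken le_rfl le_rfl (L' := fun k ζ =>
    (Λ.machine root tail).flat (Ordinal.omega0 * d) (lin root tail V) k ζ = true ∧
      (Λ.machine root tail).flat (Ordinal.omega0 * d) (lin root tail V'') k ζ = true)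
    (fun k ζ h => ⟨h.1, h3 k ζ h.1 h.2⟩) (fun _ _ h => h)).trans
    (h2.weaken le_rfl le_rfl (fun k ζ h => ⟨h3 k ζ h.1 h.2, h.2⟩) (fun _ _ h => h))).weaken
    le_rfl le_rfl (fun _ _ h => h) (fun _ _ h => .inl h)

/-- From the beginning of a cycle with the tape `V`, the run leads to the beginning of a cycle with
the tape `V'`; in between, bits which are `1` on both tapes constantly are `1`. -/
def Reach (root : Cmd Λ.Tr) (tail : List Move) (V V' : Λ.Tape d) : Prop :=
  Leads root tail (bootConf root tail V) (bootConf root tail V') V V'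

theorem Reach.trans {V V' V'' : Λ.Tape d} (h1 : Reach root tail V V')
    (h2 : Reach root tail V' V'') (h : ∀ x y t, V x y t → V'' x y t → V' x y t) :
    Reach root tail V V'' := Leads.trans h1 h2 h

/-- A transfinite sequence of tapes is followed by the run if each tape leads to the next one and
if each tape with a limit index is the inferior limit of the previous ones. -/
theorem Reach.chain {κ : Ordinal.{u}} (hκ : 0 < κ) {V : Ordinal.{u} → Λ.Tape d}
    (hseg : ∀ j < κ, Reach root tail (V j) (V (j + 1)))
    (hlim : ∀ μ ≤ κ, IsSuccLimit μ → ∀ x y t, V μ x y t ↔ EvBelow μ fun j => V j x y t)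
    (h : ∀ j < κ, ∀ x y t, V 0 x y t → V κ x y t → V j x y t) :
    Reach root tail (V 0) (V κ) := by
  refine Seg.chain hκ hseg ?_ (fun _ _ => le_rfl) (fun _ _ => le_rfl) ?_ ?_
  · intro μ hμκ hμ
    refine ⟨evBelow_of_forall hμ.bot_lt fun k _ => ?_,
        (evBelow_of_forall hμ.bot_lt fun k _ => ?_).cof,
      ⟨0, by simp [bootConf, PassMachine.conf, PassMachine.snap], fun x hx => absurd hx not_lt_zero,
        (evBelow_of_forall hμ.bot_lt fun k _ => ?_).cof⟩, fun i ζ hv => ?_, fun i ζ hv => ?_⟩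
    · have : (Λ.machine root tail).stateIso.symm .boot ≤ 0 :=
        (OrderIso.symm_apply_le _).2 ((Λ.machine root tail).boot_le _)
      exact this
    · exact le_rfl
    · exact le_rfl
    · replace hv : (Λ.machine root tail).flat (Ordinal.omega0 * d) (lin root tail (V μ)) i ζ =
        true := hv
      rcases flat_lin_cases (root := root) (tail := tail) (d := d) i ζ with ⟨x, y, t, hV⟩ | ⟨b, hV⟩
      · simp only [hV] at hv ⊢
        obtain ⟨j, hj, hv⟩ := (hlim μ hμκ hμ x y t).1 hv
        exact ⟨j, hj, fun k hk hkμ => ⟨hv k hk hkμ,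
          hv _ (hk.trans (lt_add_one k).le) (hμ.add_one_lt hkμ)⟩⟩
      · simp only [hV] at hv ⊢
        exact evBelow_of_forall hμ.bot_lt fun k _ => ⟨hv, hv⟩
    · replace hv : (Λ.machine root tail).flat (Ordinal.omega0 * d) (lin root tail (V μ)) i ζ =
        false := hv
      refine CofBelow.mono (P := fun k => ¬ (Λ.machine root tail).flat (Ordinal.omega0 * d)
        (lin root tail (V k)) i ζ = true) ?_ fun k _ h => .inl (by simpa using h)
      rw [← Bool.not_eq_true] at hv
      rw [← not_evBelow]
      rcases flat_lin_cases (root := root) (tail := tail) (d := d) i ζ with ⟨x, y, t, hV⟩ | ⟨b, hV⟩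
      · simp only [hV] at hv ⊢
        rwa [← hlim μ hμκ hμ x y t]
      · simp only [hV] at hv ⊢
        rintro ⟨j, hj, h⟩
        exact hv (h j le_rfl hj)
  · intro j hj k ζ hL
    refine ⟨flat_mono (h j hj) k ζ hL.1 hL.2, ?_⟩
    rcases (Order.add_one_le_of_lt hj).lt_or_eq with h' | h'
    · exact flat_mono (h _ h') k ζ hL.1 hL.2
    · rw [h']; exact hL.2
  · intro k ζ hz
    exact ⟨0, hκ, .inl hz⟩

end ITTM

namespace ITTM

variable {Λ : Layout} {root : Cmd Λ.Tr} {tail : List Move} {d : Ordinal.{u}}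

theorem lin_mul_add (V : Λ.Tape d) (x : Set.Iio d) (y : ℕ) :
    lin root tail V (Ordinal.omega0 * x.1 + y) = Cmd.ofProp (V x y) := lin_apply V x y

theorem exists_mul_add {ξ : Ordinal.{u}} (hξ : ξ < Ordinal.omega0 * d) :
    ∃ (x : Set.Iio d) (y : ℕ), ξ = Ordinal.omega0 * x.1 + y :=
  ⟨⟨_, (Ordinal.lt_mul_iff_div_lt Ordinal.omega0_ne_zero).1 hξ⟩, _, eq_mul_add ξ⟩

theorem pass_leads (hd : 0 < d) {c : Cmd Λ.Tr} (h : c ∈ root.subs) (hne : c ≠ .boot)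
    {V V' : Λ.Tape d} {st : Ordinal.{u} → Option (Λ.machine root tail).Cell}
    (T : (Λ.machine root tail).Trace ⟨c, h⟩ (Ordinal.omega0 * d) (lin root tail V)
      (lin root tail V') st) {r : Option (Λ.Tr → Prop)}
    (hr : st (Ordinal.omega0 * d) = r.map Cmd.ofProp) :
    Leads root tail (start root tail ⟨c, h⟩ V)
      (start root tail ⟨c.cont r, Cmd.cont_mem h _⟩ V') V V' := by
  have hs := PassMachine.seg_pass (closed hd) T
  have hn : (Λ.machine root tail).nx ⟨c, h⟩ (r.map Cmd.ofProp) =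
      open Classical in
      if c.cont r = .boot then none else some ⟨c.cont r, Cmd.cont_mem h _⟩ := by
    classical
    have hh : ∀ r', r' = r → (if c.cont r' = .boot then none
        else some (⟨c.cont r', Cmd.cont_mem h _⟩ : root.subs)) =
        if c.cont r = .boot then none else some ⟨c.cont r, Cmd.cont_mem h _⟩ := by
      rintro _ rfl; rfl
    exact hh _ (Cmd.map_toProp_ofProp r)
  unfold Leads start
  rw [if_neg hne]
  have e : st (Ordinal.omega0 * d) = r.map Cmd.ofProp := hr
  convert hs using 2
  rw [e]
  exact hn.symm

/-- The effect of a scan: `r` is the content of the pivot, if there is one, and `V'` is the new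
tape. -/
def IsScan (P : (Λ.Tr → Prop) → Prop) (fb fp fa : (Λ.Tr → Prop) → Λ.Tr → Prop) (V V' : Λ.Tape d)
    (r : Option (Λ.Tr → Prop)) : Prop :=
  (r = none ∧ ∀ x y, ¬ P (V x y) ∧ V' x y = fb (V x y)) ∨
  ∃ x₀ y₀, r = some (V x₀ y₀) ∧ P (V x₀ y₀) ∧ V' x₀ y₀ = fp (V x₀ y₀) ∧
    (∀ x y, x < x₀ ∨ x = x₀ ∧ y < y₀ → ¬ P (V x y) ∧ V' x y = fb (V x y)) ∧
    ∀ x y, x₀ < x ∨ x = x₀ ∧ y₀ < y → V' x y = fa (V x y)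

/-- The first pass of a tree which begins with a scan. -/
theorem scan_leads (hd : 0 < d) {P : (Λ.Tr → Prop) → Prop}
    {fb fp fa : (Λ.Tr → Prop) → Λ.Tr → Prop} {k : Option (Λ.Tr → Prop) → Cmd Λ.Tr}
    (h : .scan P fb fp fa k ∈ root.subs) {V V' : Λ.Tape d} {r : Option (Λ.Tr → Prop)}
    (hs : IsScan P fb fp fa V V' r) :
    Leads root tail (start root tail ⟨_, h⟩ V)
      (start root tail ⟨k r, Cmd.cont_mem (c' := .scan P fb fp fa k) h r⟩ V') V V' := by
  classical
  -- the position of the pivot, or the length of the tape if there is no pivot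
  obtain ⟨ξ₀, h0, hb, hp, ha⟩ : ∃ ξ₀ : Ordinal.{u},
      ((if ξ₀ < Ordinal.omega0 * d then some (lin root tail V ξ₀) else none) =
        r.map Cmd.ofProp) ∧
      (∀ (x : Set.Iio d) (y : ℕ), Ordinal.omega0 * x.1 + y < ξ₀ →
        ¬ P (V x y) ∧ V' x y = fb (V x y)) ∧
      (∀ (x : Set.Iio d) (y : ℕ), Ordinal.omega0 * x.1 + y = ξ₀ →
        P (V x y) ∧ V' x y = fp (V x y)) ∧
      (∀ (x : Set.Iio d) (y : ℕ), ξ₀ < Ordinal.omega0 * x.1 + y → V' x y = fa (V x y)) := by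
    rcases hs with ⟨hr, hb⟩ | ⟨x₀, y₀, hr, hP, hp, hb, ha⟩
    · refine ⟨Ordinal.omega0 * d, by rw [if_neg (lt_irrefl _), hr]; rfl, fun x y _ => hb x y,
        fun x y h => ?_,
        fun x y h => ?_⟩
      · exact absurd h (mul_add_lt_mul x.2 y).ne
      · exact absurd h (mul_add_lt_mul x.2 y).not_gt
    · refine ⟨Ordinal.omega0 * x₀.1 + y₀, ?_, fun x y h => ?_, fun x y h => ?_, fun x y h => ?_⟩
      · rw [if_pos (mul_add_lt_mul x₀.2 y₀), lin_mul_add, hr]; rfl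
      · refine hb x y ?_
        rw [mul_add_lt_mul_add] at h
        exact h.imp id fun h => ⟨Subtype.ext h.1, h.2⟩
      · have h1 : x = x₀ := Subtype.ext (by
          have := congrArg (· / Ordinal.omega0) h
          simpa only [mul_add_div_omega0] using this)
        have h2 : y = y₀ := by
          have := congrArg finPart h
          simpa only [finPart_mul_add] using this
        subst h1 h2
        exact ⟨hP, hp⟩
      · refine ha x y ?_
        rw [mul_add_lt_mul_add] at h
        exact h.imp id fun h => ⟨Subtype.ext h.1.symm, h.2⟩
  refine pass_leads (tail := tail) hd h (by simp) (V := V) (V' := V')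
    (st := fun ξ => if ξ₀ < ξ then some (lin root tail V ξ₀) else none)
    ⟨by simp, fun ξ hξ => ?_, fun μ _ hμ => ?_⟩ h0
  · obtain ⟨x, y, rfl⟩ := exists_mul_add hξ
    show Cmd.op (.scan P fb fp fa k) _ _ = _
    rw [lin_mul_add V x y, lin_mul_add V' x y]
    rcases lt_trichotomy (Ordinal.omega0 * x.1 + y) ξ₀ with h1 | h1 | h1
    · have := hb x y h1
      rw [if_neg h1.not_gt, if_neg (by rw [Order.lt_add_one_iff]; exact h1.not_ge)]
      simp only [Cmd.op, Cmd.toProp_ofProp, this, if_false]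
      rfl
    · have := hp x y h1
      rw [if_neg h1.not_gt, if_pos (by rw [Order.lt_add_one_iff]; exact h1.ge), ← h1,
        lin_mul_add]
      simp only [Cmd.op, Cmd.toProp_ofProp, this, if_true]
      rfl
    · rw [if_pos h1, if_pos (h1.trans (lt_add_one _))]
      simp only [Cmd.op, Cmd.toProp_ofProp, ha x y h1]
      rfl
  · by_cases h1 : ξ₀ < μ
    · have : EvBelow μ fun ξ => (if ξ₀ < ξ then some (lin root tail V ξ₀) else none) =
          (if ξ₀ < μ then some (lin root tail V ξ₀) else none) :=
        ⟨ξ₀ + 1, hμ.add_one_lt h1, fun ξ h2 _ => by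
          show (if _ then _ else _) = _
          rw [if_pos h1, if_pos ((lt_add_one _).trans_le h2)]⟩
      exact ⟨this.mono fun _ _ h => .inr h, this.cof⟩
    · exact ⟨evBelow_of_forall hμ.bot_lt fun _ _ => .inl (if_neg h1),
        (evBelow_of_forall hμ.bot_lt fun ξ h2 => by
          rw [if_neg h1, if_neg fun h => h1 (h.trans h2)]).cof⟩

/-- The first pass of a tree which begins with a carry. The local states `σ x y` have to return to
`none` cofinally often, since `none` is the least of them and therefore the state in which the limit
cell `(x + 1, 0)` is reached. -/
theorem carry_leads (hd : 0 < d) {n : Option (Λ.Tr → Prop) → (Λ.Tr → Prop) → Option (Λ.Tr → Prop)}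
    {f : Option (Λ.Tr → Prop) → (Λ.Tr → Prop) → Λ.Tr → Prop} {k : Cmd Λ.Tr}
    (h : .carry n f k ∈ root.subs) {V V' : Λ.Tape d} (σ : Set.Iio d → ℕ → Option (Λ.Tr → Prop))
    (h0 : ∀ x, σ x 0 = none) (h1 : ∀ x y, σ x (y + 1) = n (σ x y) (V x y))
    (h2 : ∀ x y, ∃ y' ≥ y, σ x y' = none) (hV : ∀ x y, V' x y = f (σ x y) (V x y)) :
    Leads root tail (start root tail ⟨_, h⟩ V)
      (start root tail ⟨k, Cmd.cont_mem (c' := .carry n f k) h none⟩ V') V V' := by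
  classical
  obtain ⟨st, hst, hlim⟩ : ∃ st : Ordinal.{u} → Option (Λ.Tr → Bool),
      (∀ (x : Set.Iio d) (y : ℕ), st (Ordinal.omega0 * x.1 + y) = (σ x y).map Cmd.ofProp) ∧
      ∀ a, st (Ordinal.omega0 * a) = none := by
    refine ⟨fun ξ => (if h : ξ / Ordinal.omega0 < d then
      σ ⟨ξ / Ordinal.omega0, h⟩ (finPart ξ) else none).map Cmd.ofProp, fun x y => ?_, fun a => ?_⟩
    · have hx : x.1 < d := x.2
      simp only [mul_add_div_omega0, finPart_mul_add, hx, dite_true]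
    · have := finPart_mul_add a 0
      simp only [Nat.cast_zero, add_zero] at this
      beta_reduce
      split_ifs
      · rw [this, h0]; rfl
      · rfl
  refine pass_leads (tail := tail) hd h (by simp) (V := V) (V' := V') (r := none)
    (st := st) ⟨?_, fun ξ hξ => ?_, fun μ hμd hμ => ?_⟩ (hlim d)
  · have := hlim 0
    rw [mul_zero] at this
    exact this
  · obtain ⟨x, y, rfl⟩ := exists_mul_add hξ
    have e0 : Ordinal.omega0 * x.1 + y + 1 = Ordinal.omega0 * x.1 + (y + 1 : ℕ) := by
      rw [add_assoc, Nat.cast_succ]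
    show Cmd.op (.carry n f k) _ _ = _
    rw [e0, lin_mul_add V x y, lin_mul_add V' x y, hst, hst, h1, hV]
    simp only [Cmd.op, Cmd.toProp_ofProp, Cmd.map_toProp_ofProp]
    rfl
  · obtain ⟨a, rfl⟩ := Ordinal.isSuccPrelimit_iff_omega0_dvd.1 hμ.isSuccPrelimit
    refine ⟨evBelow_of_forall hμ.bot_lt fun _ _ => .inl (hlim a), fun ξ hξ => ?_⟩
    have hξa := (Ordinal.lt_mul_iff_div_lt Ordinal.omega0_ne_zero).1 hξ
    obtain ⟨x, y, rfl⟩ := exists_mul_add (hξ.trans_le hμd)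
    rw [mul_add_div_omega0] at hξa
    obtain ⟨y', hy, hy'⟩ := h2 x y
    refine ⟨Ordinal.omega0 * x.1 + y', ?_, mul_add_lt_mul hξa y', ?_⟩
    · gcongr
    · have e : st (Ordinal.omega0 * x.1 + y') = none := by rw [hst, hy']; rfl
      exact e.trans (hlim a).symm

/-- Executing the tree `c` on the tape `V` ends the cycle with the tape `V'`; in between, bits which
are `1` on both tapes constantly are `1`. -/
def Exec (root : Cmd Λ.Tr) (tail : List Move) (c : Cmd Λ.Tr) (V V' : Λ.Tape d) : Prop :=
  ∀ h : c ∈ root.subs, (c = .boot ∧ V = V') ∨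
    Leads root tail (start root tail ⟨c, h⟩ V) (bootConf root tail V') V V'

theorem Exec.boot {V : Λ.Tape d} : Exec root tail .boot V V := fun _ => .inl ⟨rfl, rfl⟩

theorem Exec.of_leads {c c' : Cmd Λ.Tr} {V V₁ V' : Λ.Tape d} (hc : c ∈ root.subs → c' ∈ root.subs)
    (h : ∀ (h : c ∈ root.subs) (h' : c' ∈ root.subs), Leads root tail (start root tail ⟨c, h⟩ V)
      (start root tail ⟨c', h'⟩ V₁) V V₁) (H : Exec root tail c' V₁ V')
    (hdip : ∀ x y t, V x y t → V' x y t → V₁ x y t) : Exec root tail c V V' := by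
  intro hm
  right
  rcases H (hc hm) with ⟨rfl, rfl⟩ | H
  · have := h hm (hc hm)
    unfold start at this ⊢
    rw [if_pos rfl] at this
    exact this
  · exact (h hm (hc hm)).trans H hdip

theorem Exec.scan (hd : 0 < d) {P : (Λ.Tr → Prop) → Prop}
    {fb fp fa : (Λ.Tr → Prop) → Λ.Tr → Prop} {k : Option (Λ.Tr → Prop) → Cmd Λ.Tr}
    {V V₁ V' : Λ.Tape d} {r : Option (Λ.Tr → Prop)}
    (hs : IsScan P fb fp fa V V₁ r) (H : Exec root tail (k r) V₁ V')
    (hdip : ∀ x y t, V x y t → V' x y t → V₁ x y t) :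
    Exec root tail (.scan P fb fp fa k) V V' :=
  Exec.of_leads (fun h => Cmd.cont_mem (c' := .scan P fb fp fa k) h r)
      (fun h _ => scan_leads hd h hs) H hdip

theorem Exec.carry (hd : 0 < d)
    {n : Option (Λ.Tr → Prop) → (Λ.Tr → Prop) → Option (Λ.Tr → Prop)}
    {f : Option (Λ.Tr → Prop) → (Λ.Tr → Prop) → Λ.Tr → Prop} {k : Cmd Λ.Tr} {V V₁ V' : Λ.Tape d}
    (σ : Set.Iio d → ℕ → Option (Λ.Tr → Prop))
    (h0 : ∀ x, σ x 0 = none) (h1 : ∀ x y, σ x (y + 1) = n (σ x y) (V x y))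
    (h2 : ∀ x y, ∃ y' ≥ y, σ x y' = none) (hV : ∀ x y, V₁ x y = f (σ x y) (V x y))
    (H : Exec root tail k V₁ V') (hdip : ∀ x y t, V x y t → V' x y t → V₁ x y t) :
    Exec root tail (.carry n f k) V V' :=
  Exec.of_leads (fun h => Cmd.cont_mem (c' := .carry n f k) h none)
      (fun h _ => carry_leads hd h σ h0 h1 h2 hV) H hdip

/-- A complete cycle. -/
theorem Reach.of_exec (hd : 0 < d) (hne : root ≠ .boot) {V V' : Λ.Tape d}
    (H : Exec root tail root V V') : Reach root tail V V' := by
  rcases H root.mem_subs with ⟨h, _⟩ | H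
  · exact absurd h hne
  · refine Leads.trans (V' := V) (c' := start root tail ⟨root, root.mem_subs⟩ V) ?_ H
      fun _ _ _ h _ => h
    unfold Leads start
    rw [if_neg hne]
    exact ((PassMachine.seg_boot (closed hd) (lin root tail V)).weaken le_rfl le_rfl
      (fun _ _ h => h.1) fun _ _ h => h)

/-- Executing the tree `c` on the tape `V` ends the run, with the head on cell `β`. -/
def Halts (root : Cmd Λ.Tr) (tail : List Move) (c : Cmd Λ.Tr) (V : Λ.Tape d)
    (β : Ordinal.{u}) : Prop :=
  ∀ h : c ∈ root.subs, ∃ t, (runFrom (Ordinal.omega0 * d) (start root tail ⟨c, h⟩ V) t).Halted ∧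
    (runFrom (Ordinal.omega0 * d) (start root tail ⟨c, h⟩ V) t).head = β

theorem Halts.scan (hd : 0 < d) {P : (Λ.Tr → Prop) → Prop}
    {fb fp fa : (Λ.Tr → Prop) → Λ.Tr → Prop} {k : Option (Λ.Tr → Prop) → Cmd Λ.Tr}
    {V V₁ : Λ.Tape d} {r : Option (Λ.Tr → Prop)} {β : Ordinal.{u}}
    (hs : IsScan P fb fp fa V V₁ r) (H : Halts root tail (k r) V₁ β) :
    Halts root tail (.scan P fb fp fa k) V β := by
  intro h
  obtain ⟨t, _, ht, _⟩ := scan_leads (tail := tail) hd h hs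
  obtain ⟨t', h1, h2⟩ := H (Cmd.cont_mem (c' := .scan P fb fp fa k) h r)
  exact ⟨t + t', by rw [runFrom_add, ht]; exact h1, by rw [runFrom_add, ht]; exact h2⟩

theorem Halts.halt (hd : 0 < d) {P : (Λ.Tr → Prop) → Prop} {V : Λ.Tape d} {x₀ : Set.Iio d} {y₀ : ℕ}
    (hP : P (V x₀ y₀)) (hb : ∀ x y, x < x₀ ∨ x = x₀ ∧ y < y₀ → ¬ P (V x y)) :
    Halts root tail (.halt P) V (tail.foldl (fun h m => m.apply (Ordinal.omega0 * d) h)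
      ((Λ.K : Ordinal.{u}) * (Ordinal.omega0 * x₀.1 + y₀))) := by
  classical
  intro h
  have hcl := closed (Λ := Λ) (root := root) (tail := tail) hd
  have := PassMachine.exists_halted (M := Λ.machine root tail) hcl (c := ⟨_, h⟩)
    (ξ := Ordinal.omega0 * x₀.1 + y₀) (mul_add_lt_mul x₀.2 y₀) (W := lin root tail V)
    (W' := lin root tail V) (st := fun _ => none) ⟨rfl, fun ξ hξ => ?_, fun μ _ hμ =>
      ⟨evBelow_of_forall hμ.bot_lt fun _ _ => .inl rfl,
        (evBelow_of_forall hμ.bot_lt fun _ _ => rfl).cof⟩⟩ ?_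
  · unfold start
    rw [if_neg (by simp)]
    exact this
  · obtain ⟨x, y, rfl⟩ := exists_mul_add (hξ.trans (mul_add_lt_mul x₀.2 y₀))
    rw [mul_add_lt_mul_add] at hξ
    rw [lin_mul_add]
    show Cmd.op (.halt P) none _ = _
    have := hb x y (hξ.imp id fun h => ⟨Subtype.ext h.1, h.2⟩)
    simp only [Cmd.op, Cmd.toProp_ofProp, this, if_false]
    rfl
  · rw [lin_mul_add]
    show Cmd.op (.halt P) none _ = _
    simp only [Cmd.op, Cmd.toProp_ofProp, hP, if_true]
    rfl

theorem exists_halted_of_halts (hne : root ≠ .boot) (hd : 0 < d) {V : Λ.Tape d} {β : Ordinal.{u}}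
    (H : Halts root tail root V β) :
    ∃ t, (runFrom (Ordinal.omega0 * d) (bootConf root tail V) t).Halted ∧
    (runFrom (Ordinal.omega0 * d) (bootConf root tail V) t).head = β := by
  obtain ⟨t', h1, h2⟩ := H root.mem_subs
  obtain ⟨t, _, ht, _⟩ := PassMachine.seg_boot (M := Λ.machine root tail) (closed hd)
    (lin root tail V)
  have e : runFrom (Ordinal.omega0 * d) (bootConf root tail V) t =
      start root tail ⟨root, root.mem_subs⟩ V := by
    unfold start bootConf
    rw [if_neg hne, ht]
    rfl
  exact ⟨t + t', by rw [runFrom_add, e]; exact h1, by rw [runFrom_add, e]; exact h2⟩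

end ITTM

namespace ITTM

/-! ### Rules for the execution of trees of passes -/

namespace Cmd

variable {Tr : Type}

/-- Look for the first cell whose content satisfies `P`, and go on with its content. -/
def get (P : (Tr → Prop) → Prop) (k : Option (Tr → Prop) → Cmd Tr) : Cmd Tr := scan P id id id k

/-- Ask whether there is a cell whose content satisfies `P`. -/
def ask (P : (Tr → Prop) → Prop) (yes no : Cmd Tr) : Cmd Tr :=
  get P fun r => match r with
    | some _ => yes
    | none => no

/-- Change the first cell whose content satisfies `P` by `fp`, and all others by `f`. -/
def upd (P : (Tr → Prop) → Prop) (f fp : (Tr → Prop) → Tr → Prop) (k : Cmd Tr) : Cmd Tr :=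
  scan P f fp f fun _ => k

/-- Change all cells by `f`. -/
def map (f : (Tr → Prop) → Tr → Prop) (k : Cmd Tr) : Cmd Tr := upd (fun _ => False) f id k

open Classical in
/-- Change each cell by `f`, which may depend on the content of the cell `(x, y - 1)` before the
cell `(x, y)`, provided that this content satisfies `Q`. -/
noncomputable def shift (Q : (Tr → Prop) → Prop)
    (f : Option (Tr → Prop) → (Tr → Prop) → Tr → Prop) (k : Cmd Tr) : Cmd Tr :=
  carry (fun _ γ => if Q γ then some γ else none) f k

end Cmd

variable {Λ : Layout} {root : Cmd Λ.Tr} {tail : List Move} {d : Ordinal.{u}}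

theorem exists_first {Q : Set.Iio d → ℕ → Prop} (h : ∃ x y, Q x y) :
    ∃ x₀ y₀, Q x₀ y₀ ∧ ∀ x y, x < x₀ ∨ x = x₀ ∧ y < y₀ → ¬ Q x y := by
  have hwf : WellFounded (Prod.Lex (α := Set.Iio d) (β := ℕ) (· < ·) (· < ·)) :=
    WellFounded.prod_lex wellFounded_lt wellFounded_lt
  obtain ⟨x, y, hxy⟩ := h
  let S : Set (Set.Iio d × ℕ) := {z | Q z.1 z.2}
  have hS : S.Nonempty := ⟨(x, y), hxy⟩
  refine ⟨(hwf.min S hS).1, (hwf.min S hS).2, hwf.min_mem S hS, fun x y hlt hQ => ?_⟩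
  refine hwf.not_lt_min S (x := (x, y)) hQ ?_
  rw [Prod.lex_def]
  exact hlt

variable {V V₁ V' : Λ.Tape d} {P : (Λ.Tr → Prop) → Prop}

theorem Exec.get_at (hd : 0 < d) {k : Option (Λ.Tr → Prop) → Cmd Λ.Tr} {x₀ : Set.Iio d} {y₀ : ℕ}
    (hP : P (V x₀ y₀)) (hb : ∀ x y, x < x₀ ∨ x = x₀ ∧ y < y₀ → ¬ P (V x y))
    (H : Exec root tail (k (some (V x₀ y₀))) V V') : Exec root tail (.get P k) V V' :=
  Exec.scan hd (.inr ⟨x₀, y₀, rfl, hP, rfl, fun x y h => ⟨hb x y h, rfl⟩, fun _ _ _ => rfl⟩) H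
    fun _ _ _ h _ => h

theorem Exec.get_none (hd : 0 < d) {k : Option (Λ.Tr → Prop) → Cmd Λ.Tr}
    (hP : ∀ x y, ¬ P (V x y)) (H : Exec root tail (k none) V V') :
    Exec root tail (.get P k) V V' :=
  Exec.scan hd (.inl ⟨rfl, fun x y => ⟨hP x y, rfl⟩⟩) H fun _ _ _ h _ => h

theorem Exec.get_any (hd : 0 < d) {k : Option (Λ.Tr → Prop) → Cmd Λ.Tr}
    (H : ∀ r, (∀ γ, r = some γ → P γ ∧ ∃ x y, γ = V x y) → Exec root tail (k r) V V') :
    Exec root tail (.get P k) V V' := by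
  by_cases h : ∃ x y, P (V x y)
  · obtain ⟨x₀, y₀, hP, hb⟩ := exists_first h
    exact Exec.get_at hd hP hb (H _ (by rintro γ ⟨⟩; exact ⟨hP, _, _, rfl⟩))
  · push Not at h
    exact Exec.get_none hd h (H _ (by rintro γ ⟨⟩))

theorem Exec.ask_yes (hd : 0 < d) {yes no : Cmd Λ.Tr} (hP : ∃ x y, P (V x y))
    (H : Exec root tail yes V V') : Exec root tail (.ask P yes no) V V' := by
  obtain ⟨x₀, y₀, hP, hb⟩ := exists_first hP
  exact Exec.get_at hd hP hb H

theorem Exec.ask_no (hd : 0 < d) {yes no : Cmd Λ.Tr} (hP : ∀ x y, ¬ P (V x y))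
    (H : Exec root tail no V V') : Exec root tail (.ask P yes no) V V' :=
  Exec.get_none hd hP H

theorem Exec.upd_none (hd : 0 < d) {f fp : (Λ.Tr → Prop) → Λ.Tr → Prop} {k : Cmd Λ.Tr}
    (hP : ∀ x y, ¬ P (V x y)) (hV : ∀ x y, V₁ x y = f (V x y))
    (H : Exec root tail k V₁ V') (hdip : ∀ x y t, V x y t → V' x y t → V₁ x y t) :
    Exec root tail (.upd P f fp k) V V' :=
  Exec.scan hd (.inl ⟨rfl, fun x y => ⟨hP x y, hV x y⟩⟩) H hdip

theorem Exec.map (hd : 0 < d) {f : (Λ.Tr → Prop) → Λ.Tr → Prop} {k : Cmd Λ.Tr}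
    (hV : ∀ x y, V₁ x y = f (V x y))
    (H : Exec root tail k V₁ V') (hdip : ∀ x y t, V x y t → V' x y t → V₁ x y t) :
    Exec root tail (.map f k) V V' :=
  Exec.upd_none hd (fun _ _ h => h) hV H hdip

theorem Exec.upd_at (hd : 0 < d) {f fp : (Λ.Tr → Prop) → Λ.Tr → Prop} {k : Cmd Λ.Tr}
    {x₀ : Set.Iio d} {y₀ : ℕ} (hP : P (V x₀ y₀))
    (hb : ∀ x y, x < x₀ ∨ x = x₀ ∧ y < y₀ → ¬ P (V x y)) (h1 : V₁ x₀ y₀ = fp (V x₀ y₀))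
    (h2 : ∀ x y, ¬ (x = x₀ ∧ y = y₀) → V₁ x y = f (V x y))
    (H : Exec root tail k V₁ V') (hdip : ∀ x y t, V x y t → V' x y t → V₁ x y t) :
    Exec root tail (.upd P f fp k) V V' := by
  refine Exec.scan hd (.inr ⟨x₀, y₀, rfl, hP, h1, fun x y h => ⟨hb x y h, h2 x y ?_⟩,
    fun x y h => h2 x y ?_⟩) H hdip
  · rintro ⟨rfl, rfl⟩; simp at h
  · rintro ⟨rfl, rfl⟩; simp at h

open Classical in
theorem Exec.shift (hd : 0 < d) {Q : (Λ.Tr → Prop) → Prop}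
    {f : Option (Λ.Tr → Prop) → (Λ.Tr → Prop) → Λ.Tr → Prop} {k : Cmd Λ.Tr}
    (hQ : ∀ x, ∃ y₀, ∀ y ≥ y₀, ¬ Q (V x y))
    (h0 : ∀ x, V₁ x 0 = f none (V x 0))
    (h1 : ∀ x y, V₁ x (y + 1) = f (if Q (V x y) then some (V x y) else none) (V x (y + 1)))
    (H : Exec root tail k V₁ V') (hdip : ∀ x y t, V x y t → V' x y t → V₁ x y t) :
    Exec root tail (.shift Q f k) V V' := by
  refine Exec.carry hd (fun x y => match y with
    | 0 => none
    | y + 1 => if Q (V x y) then some (V x y) else none) (fun _ => rfl) (fun x y => ?_)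
    (fun x y => ?_) (fun x y => ?_) H hdip
  · rfl
  · obtain ⟨y₀, h⟩ := hQ x
    exact ⟨max y y₀ + 1, by have := le_max_left y y₀; omega, if_neg (h _ (le_max_right _ _))⟩
  · cases y with
    | zero => exact h0 x
    | succ y => exact h1 x y

end ITTM

namespace ITTM

/-! ### The universal machine: tracks -/

/-- An instruction of a simulated program, for a given pair of states: the symbols which are read,
the symbols which are written, and the move (`0`: left, `1`: stay, `2`: right). -/
abbrev Instr : Type := (Fin 3 → Bool) × (Fin 3 → Bool) × Fin 3

/-- The registers of the universal machine, with ordinal values: `a`, `b`: the components of the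
current pair of numbers; `j`: the number of this pair, and `ω` when all pairs have been treated;
`c`: the number of stages in the computation of the wellfounded part (and a counter in the search
for the position on the left of the head); `e`: the rank of the distinguished number, as far as it
is known; `w`: the position on the left of the head; `r`: an auxiliary counter for finding the
distinguished number. -/
inductive Reg
  | a | b | j | c | e | w | r
  deriving DecidableEq

instance : Finite Reg := by
  refine Finite.of_surjective (fun i : Fin 7 =>
    (![.a, .b, .j, .c, .e, .w, .r] : Fin 7 → Reg) i) fun ρ => ?_
  cases ρ
  · exact ⟨0, rfl⟩
  · exact ⟨1, rfl⟩
  · exact ⟨2, rfl⟩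
  · exact ⟨3, rfl⟩
  · exact ⟨4, rfl⟩
  · exact ⟨5, rfl⟩
  · exact ⟨6, rfl⟩

/-- The tracks of the universal machine, except for those which are related to real cells.

In all rows: `X k` holds the tapes of the simulated program, `H` its head position and `Q` its
state. The track `row` marks the current row. Only there are used: `dig`, the table of the current
program; `reg`, the registers; `acc`, the accepted numbers, which form an initial part of the
wellfounded part; `bad`, the numbers with a predecessor which is not accepted; and `p0`, `p1`, the
phase: the search for the position on the left of the head (neither), the test (`p1`), the
simulation before (`p0`) and after (both) a step has been made. The tracks `ma`, `mb` mark the rows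
of the current pair of numbers; `lim` and `even` mark the cells `(x, 0)` and `(x, y)` with even `y`.
-/
inductive Base
  | X (k : Fin 3) | H | Q
  | dig (b : Instr) | reg (ρ : Reg) | acc | bad | row | ma | mb | lim | even | p0 | p1

instance : Finite Base := by
  refine Finite.of_surjective (fun i : Fin 3 ⊕ Instr ⊕ Reg ⊕ Fin 11 => (match i with
    | .inl k => .X k
    | .inr (.inl b) => .dig b
    | .inr (.inr (.inl ρ)) => .reg ρ
    | .inr (.inr (.inr i)) => (![.H, .Q, .acc, .bad, .row, .ma, .mb, .lim, .even, .p0, .p1] :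
        Fin 11 → Base) i : Base)) fun o => ?_
  cases o with
  | X k => exact ⟨.inl k, rfl⟩
  | dig b => exact ⟨.inr (.inl b), rfl⟩
  | reg ρ => exact ⟨.inr (.inr (.inl ρ)), rfl⟩
  | H => exact ⟨.inr (.inr (.inr 0)), rfl⟩
  | Q => exact ⟨.inr (.inr (.inr 1)), rfl⟩
  | acc => exact ⟨.inr (.inr (.inr 2)), rfl⟩
  | bad => exact ⟨.inr (.inr (.inr 3)), rfl⟩
  | row => exact ⟨.inr (.inr (.inr 4)), rfl⟩
  | ma => exact ⟨.inr (.inr (.inr 5)), rfl⟩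
  | mb => exact ⟨.inr (.inr (.inr 6)), rfl⟩
  | lim => exact ⟨.inr (.inr (.inr 7)), rfl⟩
  | even => exact ⟨.inr (.inr (.inr 8)), rfl⟩
  | p0 => exact ⟨.inr (.inr (.inr 9)), rfl⟩
  | p1 => exact ⟨.inr (.inr (.inr 10)), rfl⟩

/-- The length of the blocks. -/
noncomputable def blockLen : ℕ := Nat.card Base + 1

/-- The tracks of the universal machine. The tracks `jr r` and `out r` are stored in the place `r`
of the blocks of the second and of the third tape, so that the cell `n < ω` of these tapes
corresponds to `r = n % blockLen` in the block `n / blockLen`: `jr` marks the number of the current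
pair, and `out` holds the relation which is written. -/
inductive Track
  | base (o : Base) | jr (r : Fin blockLen) | out (r : Fin blockLen)

open Track Base

instance : Finite Track := by
  refine Finite.of_injective (fun t : Track => (match t with
    | base o => .inl o
    | jr r => .inr (.inl r)
    | out r => .inr (.inr r) : Base ⊕ Fin blockLen ⊕ Fin blockLen)) ?_
  intro t t' h
  cases t <;> cases t' <;> simp_all

open PassMachine in
theorem numbering_lt {α : Type} [Finite α] (a : α) : numbering α a < Nat.card α :=
  (Finite.equivFin α a).2

open PassMachine in
/-- The layout of the universal machine. -/
@[reducible] noncomputable def layout : Layout where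
  K := blockLen
  Tr := Track
  finTr := inferInstance
  pos
    | base o => (0, ⟨numbering Base o + 1, by
      have := numbering_lt o
      unfold blockLen
      omega⟩)
    | jr r => (1, r)
    | out r => (2, r)
  pos_inj := by
    intro t t' h
    cases t <;> cases t' <;> simp at h ⊢
    · exact numbering_injective _ h
    · exact h
    · exact h
  pos_ne t := by cases t <;> simp
  K_pos := Nat.succ_pos _

/-- The number of digits, that is, of sets of instructions. -/
noncomputable def digitBase : ℕ := Nat.card (Instr → Prop)

theorem digitBase_pos : 0 < digitBase := Nat.card_pos

theorem exists_digitEquiv :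
    ∃ e : (Instr → Prop) ≃ Fin digitBase, e (fun _ => False) = ⟨0, digitBase_pos⟩ := by
  obtain ⟨e⟩ : Nonempty ((Instr → Prop) ≃ Fin digitBase) := ⟨Finite.equivFin _⟩
  exact ⟨e.trans (Equiv.swap (e fun _ => False) ⟨0, digitBase_pos⟩), by simp⟩

/-- An injective numbering of the digits, in which the empty set has number `0`. -/
noncomputable def digitEquiv : (Instr → Prop) ≃ Fin digitBase := exists_digitEquiv.choose

theorem digitEquiv_empty : (digitEquiv (fun _ => False) : ℕ) = 0 :=
  congrArg Fin.val exists_digitEquiv.choose_spec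

/-- The digit with a given number (modulo the number of digits). -/
noncomputable def digit (n : ℕ) : Instr → Prop :=
  digitEquiv.symm ⟨n % digitBase, Nat.mod_lt _ digitBase_pos⟩

theorem digitEquiv_digit {n : ℕ} (hn : n < digitBase) : (digitEquiv (digit n) : ℕ) = n := by
  unfold digit
  rw [Equiv.apply_symm_apply]
  exact Nat.mod_eq_of_lt hn

theorem digit_digitEquiv (δ : Instr → Prop) : digit (digitEquiv δ) = δ := by
  unfold digit
  rw [Equiv.symm_apply_eq]
  exact Fin.ext (Nat.mod_eq_of_lt (digitEquiv δ).2)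

theorem digit_zero : digit 0 = fun _ => False := by
  have := digit_digitEquiv fun _ => False
  rwa [digitEquiv_empty] at this

/-! ### The universal machine: program -/

/-- The parameters of the universal machine: whether the wellfounded parts are computed, and then
for which number the rank is wanted, and on which tape the relation is coded. -/
abbrev Par : Type := Option (ℕ × Fin 3)

namespace Prog

open Cmd

/-- Increase a register by one. -/
def inc (ρ : Reg) (k : Cmd Track) : Cmd Track :=
  upd (fun γ => γ (base row) ∧ ¬ γ (base (reg ρ))) id
    (fun γ t => match t with
      | base (reg ρ') => if ρ' = ρ then True else γ (base (reg ρ'))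
      | t => γ t) k

/-- Increase a register by `n`. -/
def incs (ρ : Reg) : ℕ → Cmd Track → Cmd Track
  | 0, k => k
  | n + 1, k => inc ρ (incs ρ n k)

/-- Mark the cells `(x, 0)`, the cells `(x, y)` with even `y`, and the row `0`. -/
noncomputable def init : Cmd Track :=
  open Classical in
  carry (fun s γ => if s = none then some γ else none)
    (fun s γ t => match t with
      | base even => s = none
      | t => γ t)
    (carry (fun _ γ => if γ (base even) then none else some γ)
      (fun s γ t => match t with
        | base lim => γ (base even) ∧ s = none
        | base row => γ (base even) ∧ s = none
        | t => γ t) boot)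

/-- The end of the search for the predecessor of the head position. -/
def predEnd (cw ch : Prop) : Cmd Track :=
  map (fun γ t => match t with
    | base (reg .w) => γ (base (reg .w)) ∧ ¬ cw
    | base H => γ (base H) ∧ ¬ (ch ∧ γ (base row))
    | base (reg .c) => False
    | base p1 => γ (base row)
    | t => γ t) boot

/-- One step of the search for the predecessor of the head position: the register `c` counts up to
the head position, and the register `w` follows one step behind. At a limit position they agree in
the end, and then `w` is cleared; a head position which is not below the length of the tape (the
registers are full) is replaced by `0`. -/
def pred : Cmd Track :=
  ask (fun γ => γ (base row) ∧ ¬ (γ (base (reg .c)) ↔ γ (base H)))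
    (upd (fun γ => γ (base row) ∧ ¬ γ (base (reg .c)))
      (fun γ t => match t with
        | base (reg .w) => γ (base (reg .c))
        | t => γ t)
      (fun γ t => match t with
        | base (reg .w) => γ (base (reg .c))
        | base (reg .c) => True
        | t => γ t) boot)
    (ask (fun γ => γ (base row) ∧ ¬ (γ (base (reg .w)) ↔ γ (base (reg .c))))
      (predEnd False False)
      (ask (fun γ => γ (base row) ∧ ¬ γ (base H)) (predEnd True False) (predEnd True True)))

/-- The beginning of a pass through all pairs of numbers. -/
def rewind : Cmd Track :=
  scan (fun _ => True) id
    (fun γ t => match t with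
      | base ma => γ (base lim)
      | base mb => γ (base lim)
      | jr r => (r : ℕ) = 0
      | t => γ t)
    (fun γ t => match t with
      | base ma => γ (base lim)
      | base mb => γ (base lim)
      | t => γ t) fun _ => boot

/-- The beginning of a stage. In a test, the machine halts if the clock `c` is full; the head is
then at the value of the register `e`. -/
noncomputable def restart (par : Par) (q : Prop) : Cmd Track :=
  open Classical in
  if q then rewind else
  match par with
  | none => map (fun γ t => match t with
      | base p0 => γ (base row)
      | base p1 => False
      | t => γ t) boot
  | some _ => ask (fun γ => γ (base row) ∧ ¬ γ (base (reg .c))) rewind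
      (halt fun γ => γ (base row) ∧ ¬ γ (base (reg .e)))

/-- The transition to the next row. -/
noncomputable def next : Cmd Track :=
  scan (fun γ => γ (base row) ∧
      (digitEquiv (fun b => γ (base (dig b))) : ℕ) + 1 < digitBase)
    (fun γ t => match t with
      | base (dig b) => γ (base (dig b)) ∧ ¬ γ (base row)
      | t => γ t)
    (fun γ t => match t with
      | base (dig b) => digit (digitEquiv (fun b => γ (base (dig b))) + 1) b
      | t => γ t) id
    fun _ => shift (fun γ => γ (base row))
      (fun s γ t => match t with
        | base row => s ≠ none
        | base (dig b) => ∃ g, s = some g ∧ g (base (dig b))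
        | base (reg _) => False
        | base acc => False
        | base bad => False
        | base p0 => False
        | base p1 => False
        | out _ => False
        | t => γ t) boot

/-- After a stage in which new numbers have been found: the numbers which are not bad are accepted,
the clock `c` is increased, and so is `e` unless the distinguished number already was accepted. -/
noncomputable def progress (n₀ : ℕ) : Cmd Track :=
  open Classical in
  map (fun γ t => match t with
      | base acc => γ (base acc) ∨ γ (base (reg .j)) ∧ ¬ γ (base bad)
      | base (reg .j) => False
      | base bad => False
      | t => γ t)
    (inc .c (incs .r n₀ (get (fun γ => γ (base row) ∧ ¬ γ (base (reg .r))) fun o =>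
      let clear : Cmd Track := map (fun γ t => match t with
        | base (reg .r) => False
        | t => γ t) boot
      match o with
      | none => boot
      | some γ => if γ (base acc) then clear else inc .e clear)))

/-- The end of a stage: in the simulation, go on to the next row; in a test, go on to the next stage
if there are new numbers, and otherwise to the simulation. -/
noncomputable def boundary (par : Par) (q : Prop) : Cmd Track :=
  open Classical in
  if q then next else
  match par with
  | none => boot
  | some (n₀, _) =>
    ask (fun γ => γ (base row) ∧ γ (base (reg .j)) ∧ ¬ γ (base acc) ∧ ¬ γ (base bad))
      (progress n₀)
      (map (fun γ t => match t with
        | base p0 => γ (base row)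
        | base p1 => False
        | base acc => False
        | base bad => False
        | base (reg .c) => False
        | base (reg .e) => False
        | base (reg .j) => False
        | t => γ t) boot)

open Classical in
/-- Shift the marks `jr`, and `ma` or `mb`. -/
noncomputable def advShift (sa : Prop) (k : Cmd Track) : Cmd Track :=
  shift (fun γ => γ (base ma) ∨ γ (base mb) ∨ ∃ r, γ (jr r))
    (fun s γ t => match t with
      | base ma => if sa then ∃ g, s = some g ∧ g (base ma) else γ (base ma)
      | base mb => if sa then γ (base mb) else ∃ g, s = some g ∧ g (base mb)
      | jr r => if h : (r : ℕ) = 0 then ∃ g, s = some g ∧ g (jr (Fin.last _))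
          else γ (jr ⟨r - 1, by omega⟩)
      | t => γ t) k

/-- Go on to the next pair of numbers. -/
noncomputable def adv : Cmd Track :=
  open Classical in
  get (fun γ => γ (base ma) ∨ γ (base mb)) fun o => match o with
  | none => boot
  | some γ =>
    if γ (base ma) ∧ ¬ γ (base mb) then
      advShift True (inc .a (inc .j (ask (fun γ => γ (base ma) ∧ γ (base mb))
        (map (fun γ t => match t with
          | base mb => γ (base lim)
          | base (reg .b) => False
          | t => γ t) boot) boot)))
    else advShift False (inc .b (inc .j (if γ (base ma) then
        map (fun γ t => match t with
          | base ma => γ (base lim)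
          | base (reg .a) => False
          | t => γ t) boot else boot)))

/-- Mark the number `b` if the pair `(a, b)` belongs to the relation and `a` is not accepted. -/
noncomputable def test (kk : Fin 3) (k : Cmd Track) : Cmd Track :=
  open Classical in
  get (fun γ => γ (base row) ∧ ¬ γ (base (reg .j))) fun o => match o with
  | none => k
  | some γ => if γ (base (X kk)) then
      get (fun γ => γ (base row) ∧ ¬ γ (base (reg .a))) fun o' => match o' with
      | none => k
      | some γ' => if γ' (base acc) then k else
          upd (fun γ => γ (base row) ∧ ¬ γ (base (reg .b))) id
            (fun γ t => match t with
              | base bad => True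
              | t => γ t) k
    else k

/-- Write whether the head position of the program number `a` is less than that of the program
number `b`. -/
noncomputable def compare (k : Cmd Track) : Cmd Track :=
  open Classical in
  let fin (fa fb : Prop) : Cmd Track :=
    get (fun γ => (γ (base ma) ∧ (fa ∨ ¬ γ (base H))) ∨ (γ (base mb) ∧ (fb ∨ ¬ γ (base H))))
        fun o =>
      upd (fun γ => ∃ r, γ (jr r)) id
        (fun γ t => match t with
          | out r => if γ (jr r) then ∃ g, o = some g ∧ g (base ma) ∧ ¬ g (base mb) else γ (out r)
          | t => γ t) k
  let snd (fa : Prop) : Cmd Track :=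
    ask (fun γ => γ (base mb) ∧ ¬ γ (base H)) (fin fa False) (fin fa True)
  ask (fun γ => γ (base ma) ∧ ¬ γ (base H)) (snd False) (snd True)

open Classical in
/-- The symbols in a cell. -/
noncomputable def symbols (γ : Track → Prop) : Fin 3 → Bool := fun k => decide (γ (base (X k)))

/-- Change the state, write the symbols `w`, and make the move `m`. -/
def exec (w : Fin 3 → Bool) (m : Fin 3) (k : Cmd Track) : Cmd Track :=
  upd (fun γ => γ (base row) ∧ ¬ γ (base H))
    (fun γ t => match t with
      | base Q => (γ (base row) ∧ γ (base (reg .b))) ∨ (¬ γ (base row) ∧ γ (base Q))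
      | base H => if m = 0 then (γ (base row) ∧ γ (base (reg .w))) ∨ (¬ γ (base row) ∧ γ (base H))
          else γ (base H)
      | base p1 => γ (base row)
      | t => γ t)
    (fun γ t => match t with
      | base Q => γ (base (reg .b))
      | base H => if m = 0 then γ (base (reg .w)) else m = 2
      | base (X k) => w k = true
      | base p1 => True
      | t => γ t) k

/-- Carry out a step of the simulated program, if the digit contains a suitable instruction. -/
noncomputable def step (k : Cmd Track) : Cmd Track :=
  open Classical in
  ask (fun γ => γ (base row) ∧ ¬ (γ (base (reg .a)) ↔ γ (base Q))) k
    (get (fun γ => γ (base row) ∧ ¬ γ (base H)) fun o => match o with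
    | none => k
    | some γ => get (fun γ => γ (base row) ∧ ¬ γ (base (reg .j))) fun o' => match o' with
      | none => k
      | some γ' => if h : ∃ i : (Fin 3 → Bool) × Fin 3, γ' (base (dig (symbols γ, i))) then
          exec h.choose.1 h.choose.2 k else k)

/-- The treatment of a pair of numbers. -/
noncomputable def regular (par : Par) (q q' : Prop) : Cmd Track :=
  open Classical in
  if q then compare (if q' then adv else step adv) else
  match par with
  | none => adv
  | some (_, kk) => test kk adv

/-- A cycle of the universal machine. The absence of marks shows which limits have been passed:
there is no marked row at the beginning of a round, and no mark `jr` at the end of a stage. -/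
noncomputable def root (par : Par) : Cmd Track :=
  open Classical in
  get (fun γ => γ (base row)) fun o => match o with
  | none => init
  | some γ =>
    if ¬ γ (base p0) ∧ ¬ γ (base p1) then pred else
    ask (fun γ => ∃ r, γ (jr r)) (regular par (γ (base p0)) (γ (base p1)))
      (ask (fun γ => γ (base row) ∧ γ (base (reg .j))) (boundary par (γ (base p0)))
        (restart par (γ (base p0))))

end Prog
end ITTM

namespace ITTM

open Track Base

/-! ### The universal machine: description of its tapes -/

/-- The data of a simulated machine: the contents of its tapes, its head position, and its state. -/
structure Row : Type (u + 1) where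
  X : Fin 3 → Ordinal.{u} → Prop
  h : Ordinal.{u}
  q : Ordinal.{u}

/-- The data of the universal machine while it works on the simulated machine with number `cur`: for
each track its content, decoded. The values `ma`, `mb` and `jr` are the two marked rows and the
number of the marked pair, if there are any. -/
structure Rec : Type (u + 1) where
  D : ℕ → Row.{u}
  cur : ℕ
  dg : ℕ → Instr → Prop
  reg : Reg → Ordinal.{u}
  acc : ℕ → Prop
  bad : ℕ → Prop
  p0 : Prop
  p1 : Prop
  ma : Option ℕ
  mb : Option ℕ
  jr : Option ℕ
  out : ℕ → Prop

/-- The tape on which the data are written. Row `y` consists of the cells `(x, y)`. Ordinals are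
written in unary notation; the registers, the digits and the sets of numbers are written on the
current row. -/
def enc (d : Ordinal.{u}) (r : Rec.{u}) : layout.Tape d := fun x y t =>
  match t with
  | base (X k) => (r.D y).X k x
  | base H => x.1 < (r.D y).h
  | base Q => x.1 < (r.D y).q
  | base (dig b) => y = r.cur ∧ ∃ n : ℕ, x.1 = n ∧ r.dg n b
  | base (reg ρ) => y = r.cur ∧ x.1 < r.reg ρ
  | base acc => y = r.cur ∧ ∃ n : ℕ, x.1 = n ∧ r.acc n
  | base bad => y = r.cur ∧ ∃ n : ℕ, x.1 = n ∧ r.bad n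
  | base row => y = r.cur
  | base ma => r.ma = some y
  | base mb => r.mb = some y
  | base lim => y = 0
  | base even => Even y
  | base p0 => y = r.cur ∧ r.p0
  | base p1 => y = r.cur ∧ r.p1
  | jr i => x.1 = 0 ∧ r.jr = some (blockLen * y + i)
  | out i => x.1 = 0 ∧ r.out (blockLen * y + i)

variable {d : Ordinal.{u}} {par : Par} {tail : List Move} {r r₁ : Rec.{u}} {V' : layout.Tape d}
  {rt : Cmd Track}

theorem root_ne_boot : Prog.root par ≠ .boot := by
  simp [Prog.root, Cmd.get]

theorem reach_of_exec (hd : 0 < d) {V V' : layout.Tape d}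
    (H : Exec (Λ := layout) (Prog.root par) tail (Prog.root par) V V') :
    Reach (Λ := layout) (Prog.root par) tail V V' :=
  Reach.of_exec hd root_ne_boot H

theorem exec_root_pred (hd : 0 < d) (h0 : ¬ r.p0) (h1 : ¬ r.p1)
    (H : Exec (Λ := layout) rt tail Prog.pred (enc d r) V') :
    Exec (Λ := layout) rt tail (Prog.root par) (enc d r) V' := by
  refine Exec.get_at hd (x₀ := ⟨0, hd⟩) (y₀ := r.cur) (by simp [enc]) ?_ ?_
  · rintro x y (h | ⟨rfl, h⟩)
    · exact absurd (Subtype.mk_lt_mk.1 h) not_lt_zero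
    · simpa [enc] using h.ne
  · simpa [enc, h0, h1] using H

/-- A register is increased; this has no effect if the register is full. -/
theorem exec_inc (hd : 0 < d) {ρ : Reg} {k : Cmd Track}
    (h1 : r₁ = { r with reg := Function.update r.reg ρ (r.reg ρ + 1) })
    (H : Exec (Λ := layout) rt tail k (enc d r₁) V')
    (hdip : ∀ x y t, enc d r x y t → V' x y t → enc d r₁ x y t) :
    Exec (Λ := layout) rt tail (Prog.inc ρ k) (enc d r) V' := by
  subst h1
  rcases lt_or_ge (r.reg ρ) d with hρ | hρ
  · refine Exec.upd_at hd (x₀ := ⟨_, hρ⟩) (y₀ := r.cur) (by simp [enc]) ?_ ?_ ?_ H hdip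
    · rintro x y (h | ⟨rfl, h⟩)
      · have : x.1 < r.reg ρ := Subtype.mk_lt_mk.1 h
        simp [enc, this]
      · simp [enc, h.ne]
    · funext t
      rcases t with o | _ | _ <;> try rfl
      rcases o with _ | _ | _ | _ | ρ' | _ <;> try rfl
      by_cases hρ' : ρ' = ρ
      · subst hρ'; simp [enc]
      · simp [enc, hρ']
    · rintro ⟨x, hx⟩ y hxy
      funext t
      rcases t with o | _ | _ <;> try rfl
      rcases o with _ | _ | _ | _ | ρ' | _ <;> try rfl
      by_cases hρ' : ρ' = ρ
      · subst hρ'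
        simp only [enc, Function.update_self, id, Order.lt_add_one_iff, eq_iff_iff]
        refine and_congr_right fun hy => ⟨fun h => lt_of_le_of_ne h ?_, le_of_lt⟩
        rintro rfl
        exact hxy ⟨rfl, hy⟩
      · simp [enc, hρ']
  · refine Exec.upd_none hd (fun x y => ?_) (fun x y => ?_) H hdip
    · have : x.1 < r.reg ρ := (show x.1 < d from x.2).trans_le hρ
      simp [enc, this]
    · funext t
      rcases t with o | _ | _ <;> try rfl
      rcases o with _ | _ | _ | _ | ρ' | _ <;> try rfl
      by_cases hρ' : ρ' = ρ
      · subst hρ'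
        have : x.1 < r.reg ρ' := (show x.1 < d from x.2).trans_le hρ
        simp [enc, this, this.le]
      · simp [enc, hρ']

theorem reach_pred_step (hd : 0 < d) (h0 : ¬ r.p0) (h1 : ¬ r.p1)
    (hc : r.reg .c < (r.D r.cur).h) (hh : (r.D r.cur).h ≤ d)
    (hr : r₁ = { r with
      reg := Function.update (Function.update r.reg .c (r.reg .c + 1)) .w (r.reg .c) }) :
    Reach (Λ := layout) (Prog.root par) tail (enc d r) (enc d r₁) := by
  subst hr
  refine reach_of_exec hd (exec_root_pred hd h0 h1 ?_)
  have hcd := hc.trans_le hh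
  refine Exec.ask_yes hd ⟨⟨_, hcd⟩, r.cur, by simp [enc, hc]⟩ ?_
  refine Exec.upd_at hd (x₀ := ⟨_, hcd⟩) (y₀ := r.cur) (by simp [enc]) ?_ ?_ ?_ Exec.boot
    (fun _ _ _ _ h => h)
  · rintro x y (h | ⟨rfl, h⟩)
    · have : x.1 < r.reg .c := Subtype.mk_lt_mk.1 h
      simp [enc, this]
    · simp [enc, h.ne]
  · funext t
    rcases t with o | _ | _ <;> try rfl
    rcases o with _ | _ | _ | _ | ρ' | _ <;> try rfl
    cases ρ' <;> simp [enc]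
  · rintro ⟨x, hx⟩ y hxy
    funext t
    rcases t with o | _ | _ <;> try rfl
    rcases o with _ | _ | _ | _ | ρ' | _ <;> try rfl
    cases ρ' <;> simp [enc]
    refine fun hy => ⟨fun h => lt_of_le_of_ne h ?_, le_of_lt⟩
    rintro rfl
    exact hxy ⟨rfl, hy⟩

open Classical in
theorem exec_predEnd (hd : 0 < d) {cw ch : Prop}
    (hr : r₁ = { r with
      D := Function.update r.D r.cur { r.D r.cur with h := if ch then 0 else (r.D r.cur).h }
      reg := Function.update (Function.update r.reg .c 0) .w (if cw then 0 else r.reg .w)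
      p1 := True }) :
    Exec (Λ := layout) rt tail (Prog.predEnd cw ch) (enc d r) (enc d r₁) := by
  subst hr
  refine Exec.map hd (fun x y => ?_) Exec.boot (fun _ _ _ _ h => h)
  funext t
  rcases t with o | _ | _ <;> try rfl
  rcases o with k | _ | _ | _ | ρ | _ | _ | _ | _ | _ | _ | _ | _ | _ <;> try rfl
  · by_cases hy : y = r.cur
    · subst hy; simp [enc]
    · simp [enc, hy]
  · by_cases hy : y = r.cur
    · subst hy
      by_cases h : ch <;> simp [enc, h]
    · simp [enc, hy]
  · by_cases hy : y = r.cur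
    · subst hy; simp [enc]
    · simp [enc, hy]
  · cases ρ <;> simp [enc]
    by_cases h : cw <;> simp [h]
  · simp [enc]

open Classical in
/-- The search for the position on the left of the head ends when the register `c` has reached the
head position. The register `w` differs from it if and only if the position is a successor. -/
theorem reach_pred_end (hd : 0 < d) (h0 : ¬ r.p0) (h1 : ¬ r.p1)
    (hc : r.reg .c = (r.D r.cur).h) (hh : (r.D r.cur).h ≤ d) (hw : r.reg .w ≤ (r.D r.cur).h)
    (hr : r₁ = { r with
      D := Function.update r.D r.cur
        { r.D r.cur with h := if (r.D r.cur).h < d then (r.D r.cur).h else 0 }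
      reg := Function.update (Function.update r.reg .c 0) .w
        (if r.reg .w < (r.D r.cur).h then r.reg .w else 0)
      p1 := True }) (hcof : r.reg .w < (r.D r.cur).h → (r.D r.cur).h < d) :
    Reach (Λ := layout) (Prog.root par) tail (enc d r) (enc d r₁) := by
  subst hr
  refine reach_of_exec hd (exec_root_pred hd h0 h1 ?_)
  refine Exec.ask_no hd ?_ ?_
  · rintro x y ⟨hy, h⟩
    have hy : y = r.cur := hy
    subst hy
    simp [enc, hc] at h
  · rcases hw.lt_or_eq with hw | hw
    · have hlt := hcof hw
      refine Exec.ask_yes hd ⟨⟨_, hw.trans hlt⟩, r.cur, by simp [enc, hc, hw]⟩ ?_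
      refine exec_predEnd hd ?_
      simp [hw, hlt]
    · refine Exec.ask_no hd ?_ ?_
      · rintro x y ⟨hy, h⟩
        have hy : y = r.cur := hy
        subst hy
        simp [enc, hc, hw] at h
      · rcases hh.lt_or_eq with hlt | hlt
        · refine Exec.ask_yes hd ⟨⟨_, hlt⟩, r.cur, by simp [enc]⟩ ?_
          refine exec_predEnd hd ?_
          simp [hw, hlt]
        · refine Exec.ask_no hd ?_ ?_
          · rintro x y ⟨hy, h⟩
            have hy : y = r.cur := hy
            subst hy
            exact h (by simp [enc, hlt]; exact x.2)
          · refine exec_predEnd hd ?_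
            simp [hw, hlt]

theorem exec_root_other (hd : 0 < d) (h01 : r.p0 ∨ r.p1)
    (H : Exec (Λ := layout) rt tail (.ask (fun γ => ∃ i, γ (jr i)) (Prog.regular par r.p0 r.p1)
      (.ask (fun γ => γ (base row) ∧ γ (base (reg .j))) (Prog.boundary par r.p0)
        (Prog.restart par r.p0))) (enc d r) V') :
    Exec (Λ := layout) rt tail (Prog.root par) (enc d r) V' := by
  refine Exec.get_at hd (x₀ := ⟨0, hd⟩) (y₀ := r.cur) (by simp [enc]) ?_ ?_
  · rintro x y (h | ⟨rfl, h⟩)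
    · exact absurd (Subtype.mk_lt_mk.1 h) not_lt_zero
    · simpa [enc] using h.ne
  · have : ¬ (¬ r.p0 ∧ ¬ r.p1) := by tauto
    simpa only [enc, true_and, this, if_false] using H

theorem exec_root_regular (hd : 0 < d) (h01 : r.p0 ∨ r.p1) {n : ℕ} (hn : r.jr = some n)
    (H : Exec (Λ := layout) rt tail (Prog.regular par r.p0 r.p1) (enc d r) V') :
    Exec (Λ := layout) rt tail (Prog.root par) (enc d r) V' := by
  refine exec_root_other hd h01 (Exec.ask_yes hd ⟨⟨0, hd⟩, n / blockLen,
    ⟨n % blockLen, Nat.mod_lt _ (Nat.succ_pos _)⟩, ?_⟩ H)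
  simp [enc, hn, Nat.div_add_mod]

theorem exec_root_boundary (hd : 0 < d) (h01 : r.p0 ∨ r.p1) (hn : r.jr = none)
    (hj : 0 < r.reg .j)
    (H : Exec (Λ := layout) rt tail (Prog.boundary par r.p0) (enc d r) V') :
    Exec (Λ := layout) rt tail (Prog.root par) (enc d r) V' := by
  refine exec_root_other hd h01 (Exec.ask_no hd ?_ (Exec.ask_yes hd ⟨⟨0, hd⟩, r.cur, ?_⟩ H))
  · simp [enc, hn]
  · simp [enc, hj]

theorem exec_root_restart (hd : 0 < d) (h01 : r.p0 ∨ r.p1) (hn : r.jr = none)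
    (hj : r.reg .j = 0)
    (H : Exec (Λ := layout) rt tail (Prog.restart par r.p0) (enc d r) V') :
    Exec (Λ := layout) rt tail (Prog.root par) (enc d r) V' := by
  refine exec_root_other hd h01 (Exec.ask_no hd ?_ (Exec.ask_no hd ?_ H))
  · simp [enc, hn]
  · simp [enc, hj]

theorem exec_rewind (hd : 0 < d)
    (hr : r₁ = { r with ma := some 0, mb := some 0, jr := some 0 }) (hn : r.jr = none) :
    Exec (Λ := layout) rt tail Prog.rewind (enc d r) (enc d r₁) := by
  subst hr
  refine Exec.scan hd (.inr ⟨⟨0, hd⟩, 0, rfl, trivial, ?_, ?_, ?_⟩) Exec.boot (fun _ _ _ _ h => h)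
  · funext t
    rcases t with o | i | _ <;> try rfl
    · rcases o with k | _ | _ | _ | ρ | _ | _ | _ | _ | _ | _ | _ | _ | _ <;> try rfl
      · simp [enc]
      · simp [enc]
    · simp [enc, eq_comm]
  · rintro x y (h | ⟨_, h⟩)
    · exact absurd (Subtype.mk_lt_mk.1 h) not_lt_zero
    · omega
  · intro x y hxy
    funext t
    rcases t with o | i | _ <;> try rfl
    · rcases o with k | _ | _ | _ | ρ | _ | _ | _ | _ | _ | _ | _ | _ | _ <;> try rfl
      · simp [enc, eq_comm]
      · simp [enc, eq_comm]
    · have hb : 0 < blockLen := Nat.succ_pos _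
      simp only [enc, hn, Option.some.injEq, eq_iff_iff]
      constructor
      · rintro ⟨hx, h⟩
        rcases hxy with h' | ⟨_, h'⟩
        · have : (0 : Ordinal.{u}) < x.1 := Subtype.mk_lt_mk.1 h'
          exact absurd hx this.ne'
        · have : 0 < blockLen * y := Nat.mul_pos hb h'
          omega
      · rintro ⟨_, h⟩
        cases h

theorem reach_rewind (hd : 0 < d) (h01 : r.p0 ∨ r.p1) (hn : r.jr = none) (hj : r.reg .j = 0)
    (hp : r.p0 ∨ (par ≠ none ∧ r.reg .c < d))
    (hr : r₁ = { r with ma := some 0, mb := some 0, jr := some 0 }) :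
    Reach (Λ := layout) (Prog.root par) tail (enc d r) (enc d r₁) := by
  refine reach_of_exec hd (exec_root_restart hd h01 hn hj ?_)
  unfold Prog.restart
  split_ifs with h
  · exact exec_rewind hd hr hn
  · obtain ⟨hp1, hp2⟩ := hp.resolve_left h
    rcases par with _ | p
    · exact absurd rfl hp1
    · exact Exec.ask_yes hd ⟨⟨_, hp2⟩, r.cur, by simp [enc]⟩ (exec_rewind hd hr hn)

theorem reach_skip_test (hd : 0 < d) (h1 : r.p1) (h0 : ¬ r.p0) (hn : r.jr = none)
    (hj : r.reg .j = 0) (hr : r₁ = { r with p0 := True, p1 := False }) :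
    Reach (Λ := layout) (Prog.root none) tail (enc d r) (enc d r₁) := by
  subst hr
  refine reach_of_exec hd (exec_root_restart hd (.inr h1) hn hj ?_)
  unfold Prog.restart
  rw [if_neg h0]
  refine Exec.map hd (fun x y => ?_) Exec.boot (fun _ _ _ _ h => h)
  funext t
  rcases t with o | _ | _ <;> try rfl
  rcases o with k | _ | _ | _ | ρ | _ | _ | _ | _ | _ | _ | _ | _ | _ <;> simp [enc]

end ITTM

namespace ITTM

open Track Base

variable {d : Ordinal.{u}} {par : Par} {tail : List Move} {r r₁ : Rec.{u}} {V' : layout.Tape d}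
  {rt : Cmd Track}

/-- Sufficient conditions for the bits which are `1` on the tapes of `r` and `r'` to be `1` on the
tape of a record `s` in between, as it is required for composing runs. -/
theorem enc_dip {r s r' : Rec.{u}} (hcur : s.cur = r.cur)
    (hX : ∀ y k ξ, (r.D y).X k ξ → (r'.D y).X k ξ → (s.D y).X k ξ := by exact fun _ _ _ h _ => h)
    (hh : ∀ y, (r.D y).h ≤ (s.D y).h ∨ (r'.D y).h ≤ (s.D y).h := by exact fun _ => .inl le_rfl)
    (hq : ∀ y, (r.D y).q ≤ (s.D y).q ∨ (r'.D y).q ≤ (s.D y).q := by exact fun _ => .inl le_rfl)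
    (hdg : ∀ n b, r.dg n b → r'.dg n b → s.dg n b := by exact fun _ _ h _ => h)
    (hreg : ∀ ρ, r.reg ρ ≤ s.reg ρ ∨ r'.reg ρ ≤ s.reg ρ := by exact fun _ => .inl le_rfl)
    (hacc : ∀ n, r.acc n → r'.acc n → s.acc n := by exact fun _ h _ => h)
    (hbad : ∀ n, r.bad n → r'.bad n → s.bad n := by exact fun _ h _ => h)
    (h0 : r.p0 → r'.p0 → s.p0 := by exact fun h _ => h)
    (h1 : r.p1 → r'.p1 → s.p1 := by exact fun h _ => h)
    (hma : ∀ n, r.ma = some n → r'.ma = some n → s.ma = some n := by exact fun _ h _ => h)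
    (hmb : ∀ n, r.mb = some n → r'.mb = some n → s.mb = some n := by exact fun _ h _ => h)
    (hjr : ∀ n, r.jr = some n → r'.jr = some n → s.jr = some n := by exact fun _ h _ => h)
    (hout : ∀ n, r.out n → r'.out n → s.out n := by exact fun _ h _ => h) :
    ∀ x y t, enc d r x y t → enc d r' x y t → enc d s x y t := by
  intro x y t h h'
  have hn : ∀ {n n' : ℕ}, x.1 = n → x.1 = n' → n' = n := by
    intro n n' h1 h2
    rw [h1] at h2
    exact (by exact_mod_cast h2 : n = n').symm
  rcases t with o | _ | _
  · rcases o with k | _ | _ | _ | ρ | _ | _ | _ | _ | _ | _ | _ | _ | _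
    · exact hX _ _ _ h h'
    · exact (hh y).elim h.trans_le h'.trans_le
    · exact (hq y).elim h.trans_le h'.trans_le
    · obtain ⟨hy, n, hx, h⟩ := h
      obtain ⟨-, n', hx', h'⟩ := h'
      exact ⟨hcur ▸ hy, n, hx, hdg _ _ h (hn hx hx' ▸ h')⟩
    · exact ⟨hcur ▸ h.1, (hreg ρ).elim h.2.trans_le h'.2.trans_le⟩
    · obtain ⟨hy, n, hx, h⟩ := h
      obtain ⟨-, n', hx', h'⟩ := h'
      exact ⟨hcur ▸ hy, n, hx, hacc _ h (hn hx hx' ▸ h')⟩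
    · obtain ⟨hy, n, hx, h⟩ := h
      obtain ⟨-, n', hx', h'⟩ := h'
      exact ⟨hcur ▸ hy, n, hx, hbad _ h (hn hx hx' ▸ h')⟩
    · exact (show y = s.cur from hcur ▸ h)
    · exact hma _ h h'
    · exact hmb _ h h'
    · exact h
    · exact h
    · exact ⟨hcur ▸ h.1, h0 h.2 h'.2⟩
    · exact ⟨hcur ▸ h.1, h1 h.2 h'.2⟩
  · exact ⟨h.1, hjr _ h.2 h'.2⟩
  · exact ⟨h.1, hout _ h.2 h'.2⟩

theorem exec_incs (hd : 0 < d) {ρ : Reg} {k : Cmd Track} (n : ℕ) {r r₁ r' : Rec.{u}}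
    (h1 : r₁ = { r with reg := Function.update r.reg ρ (r.reg ρ + n) })
    (H : Exec (Λ := layout) rt tail k (enc d r₁) (enc d r'))
    (hρ : r'.reg ρ ≤ r.reg ρ) :
    Exec (Λ := layout) rt tail (Prog.incs ρ n k) (enc d r) (enc d r') := by
  induction n generalizing r with
  | zero =>
    have : r₁ = r := by rw [h1]; simp
    subst this
    exact H
  | succ n ih =>
    refine exec_inc hd rfl (ih ?_ ?_) (enc_dip rfl (hreg := ?_))
    · subst h1
      have : (1 : Ordinal.{u}) + n = n + 1 := by exact_mod_cast Nat.add_comm 1 n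
      simp only [Function.update_idem, Function.update_self, Nat.cast_succ, add_assoc, this]
    · simp only [Function.update_self]
      exact hρ.trans (by simp)
    · intro ρ'
      by_cases h : ρ' = ρ
      · subst h; left; simp
      · left; simp [h]

open Classical in
/-- The second half of the treatment of a stage in which new numbers have been accepted: the clock
is increased, and the stage at which the distinguished number is accepted is updated. -/
theorem exec_progress (hd : Ordinal.omega0 ≤ d) {n₀ : ℕ} {r r₁ : Rec.{u}}
    (hr0 : r.reg .r = 0) (hr : r₁ = { r with
      reg := Function.update (Function.update r.reg .c (r.reg .c + 1)) .e
        (if r.acc n₀ then r.reg .e else r.reg .e + 1) }) :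
    Exec (Λ := layout) rt tail (Prog.inc .c (Prog.incs .r n₀
      (Cmd.get (fun γ => γ (base row) ∧ ¬ γ (base (reg .r))) fun o =>
      let clear : Cmd Track := Cmd.map (fun γ t => match t with
        | base (reg .r) => False
        | t => γ t) .boot
      match o with
      | none => .boot
      | some γ => if γ (base acc) then clear else Prog.inc .e clear))) (enc d r) (enc d r₁) := by
  have hd0 : 0 < d := Ordinal.omega0_pos.trans_le hd
  have hlt : ∀ n : ℕ, (n : Ordinal.{u}) < Ordinal.omega0 := Ordinal.natCast_lt_omega0
  have hr1 : r₁.reg .r = 0 := by rw [hr]; simpa using hr0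
  refine exec_inc hd0 rfl ?_ (enc_dip rfl (hreg := ?_))
  · refine exec_incs hd0 n₀ rfl ?_ (by rw [hr1]; exact zero_le)
    refine Exec.get_at hd0 (x₀ := ⟨n₀, (hlt n₀).trans_le hd⟩) (y₀ := r.cur) ?_ ?_ ?_
    · simp [enc, hr0]
    · rintro x y (h | ⟨rfl, h⟩)
      · have : x.1 < n₀ := Subtype.mk_lt_mk.1 h
        simp [enc, hr0, this]
      · simp [enc, h.ne]
    · have hacc : (∃ n : ℕ, (n₀ : Ordinal.{u}) = n ∧ r.acc n) ↔ r.acc n₀ := by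
        constructor
        · rintro ⟨n, hn, h⟩
          have : n₀ = n := by exact_mod_cast hn
          rwa [this]
        · exact fun h => ⟨n₀, rfl, h⟩
      simp only [enc, hacc, true_and]
      split_ifs with hc
      · refine Exec.map hd0 (fun x y => ?_) Exec.boot (fun _ _ _ _ h => h)
        rw [hr]
        funext t
        rcases t with o | _ | _ <;> try rfl
        rcases o with k | _ | _ | _ | ρ | _ | _ | _ | _ | _ | _ | _ | _ | _ <;> try rfl
        cases ρ <;> simp [enc, hr0, hc]
      · refine exec_inc hd0 rfl ?_ (enc_dip rfl (hreg := ?_))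
        · refine Exec.map hd0 (fun x y => ?_) Exec.boot (fun _ _ _ _ h => h)
          rw [hr]
          funext t
          rcases t with o | _ | _ <;> try rfl
          rcases o with k | _ | _ | _ | ρ | _ | _ | _ | _ | _ | _ | _ | _ | _ <;> try rfl
          cases ρ <;> simp [enc, hr0, hc]
        · intro ρ
          left
          cases ρ <;> simp
  · intro ρ
    left
    cases ρ <;> simp

open Classical in
/-- The transition to the next stage of a test, if there is a new number which is not bad. -/
theorem reach_progress (hd : Ordinal.omega0 ≤ d) {n₀ : ℕ} {kk : Fin 3} (h0 : ¬ r.p0) (h1 : r.p1)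
    (hn : r.jr = none) (hj : r.reg .j = Ordinal.omega0) (hr0 : r.reg .r = 0)
    (hex : ∃ n, ¬ r.acc n ∧ ¬ r.bad n)
    (hr : r₁ = { r with
      acc := fun n => r.acc n ∨ ¬ r.bad n
      bad := fun _ => False
      reg := Function.update (Function.update (Function.update r.reg .j 0) .c (r.reg .c + 1)) .e
        (if r.acc n₀ ∨ ¬ r.bad n₀ then r.reg .e else r.reg .e + 1) }) :
    Reach (Λ := layout) (Prog.root (some (n₀, kk))) tail (enc d r) (enc d r₁) := by
  have hd0 : 0 < d := Ordinal.omega0_pos.trans_le hd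
  have hlt : ∀ n : ℕ, (n : Ordinal.{u}) < Ordinal.omega0 := Ordinal.natCast_lt_omega0
  refine reach_of_exec hd0 (exec_root_boundary hd0 (.inr h1) hn
    (by rw [hj]; exact Ordinal.omega0_pos) ?_)
  unfold Prog.boundary
  rw [if_neg h0]
  obtain ⟨n, hn1, hn2⟩ := hex
  refine Exec.ask_yes hd0 ⟨⟨n, (hlt n).trans_le hd⟩, r.cur, by simp [enc, hj, hn1, hn2]⟩ ?_
  refine Exec.map hd0 (V₁ := enc d { r with
      acc := fun n => r.acc n ∨ ¬ r.bad n
      bad := fun _ => False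
      reg := Function.update r.reg .j 0 }) (fun x y => ?_) ?_ (enc_dip rfl (hacc := ?_)
        (hbad := ?_) (hreg := ?_))
  · funext t
    rcases t with o | _ | _ <;> try rfl
    rcases o with k | _ | _ | _ | ρ | _ | _ | _ | _ | _ | _ | _ | _ | _ <;> try rfl
    · cases ρ <;> simp [enc]
    · simp only [enc, hj, eq_iff_iff]
      constructor
      · rintro ⟨hy, n, hx, h | h⟩
        · exact .inl ⟨hy, n, hx, h⟩
        · refine .inr ⟨⟨hy, by rw [hx]; exact hlt n⟩, ?_⟩
          rintro ⟨_, m, hx', h'⟩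
          rw [hx] at hx'
          have : n = m := by exact_mod_cast hx'
          exact h (this ▸ h')
      · rintro (⟨hy, n, hx, h⟩ | ⟨⟨hy, hx⟩, h⟩)
        · exact ⟨hy, n, hx, .inl h⟩
        · obtain ⟨n, hx⟩ := Ordinal.lt_omega0.1 hx
          exact ⟨hy, n, hx, .inr fun h' => h ⟨hy, n, hx, h'⟩⟩
    · simp [enc]
  · refine exec_progress hd (by simpa using hr0) ?_
    simp [hr]
  · subst hr
    intro ρ
    cases ρ <;> simp
  · exact fun n h _ => .inl h
  · subst hr; exact fun n _ h => h

/-- The end of a test without a new number: the registers are cleared for the simulation. -/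
theorem reach_fail (hd : Ordinal.omega0 ≤ d) {n₀ : ℕ} {kk : Fin 3} (h0 : ¬ r.p0) (h1 : r.p1)
    (hn : r.jr = none) (hj : r.reg .j = Ordinal.omega0)
    (hex : ∀ n, r.acc n ∨ r.bad n)
    (hr : r₁ = { r with
      acc := fun _ => False
      bad := fun _ => False
      p0 := True
      p1 := False
      reg := Function.update (Function.update (Function.update r.reg .j 0) .c 0) .e 0 }) :
    Reach (Λ := layout) (Prog.root (some (n₀, kk))) tail (enc d r) (enc d r₁) := by
  subst hr
  have hd0 : 0 < d := Ordinal.omega0_pos.trans_le hd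
  refine reach_of_exec hd0 (exec_root_boundary hd0 (.inr h1) hn
    (by rw [hj]; exact Ordinal.omega0_pos) ?_)
  unfold Prog.boundary
  rw [if_neg h0]
  refine Exec.ask_no hd0 ?_ ?_
  · rintro x y ⟨hy, ⟨_, hx⟩, h2, h3⟩
    rw [hj] at hx
    obtain ⟨n, hx⟩ := Ordinal.lt_omega0.1 hx
    rcases hex n with h | h
    · exact h2 ⟨hy, n, hx, h⟩
    · exact h3 ⟨hy, n, hx, h⟩
  · refine Exec.map hd0 (fun x y => ?_) Exec.boot (fun _ _ _ _ h => h)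
    funext t
    rcases t with o | _ | _ <;> try rfl
    rcases o with k | _ | _ | _ | ρ | _ | _ | _ | _ | _ | _ | _ | _ | _ <;> try rfl
    · cases ρ <;> simp [enc]
    all_goals simp [enc]

end ITTM

namespace ITTM

open Track Base

variable {d : Ordinal.{u}} {par : Par} {tail : List Move} {r r₁ : Rec.{u}} {V' : layout.Tape d}
  {rt : Cmd Track}

/-- The tape at the beginning of a round, before the first row is marked. The marks `lim` and `even`
are missing in the first round. -/
def pre (d : Ordinal.{u}) (D : ℕ → Row.{u}) (b : Prop) : layout.Tape d := fun x y t =>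
  match t with
  | base (X k) => (D y).X k x
  | base H => x.1 < (D y).h
  | base Q => x.1 < (D y).q
  | base lim => b ∧ y = 0
  | base even => b ∧ Even y
  | _ => False

/-- The record at the beginning of a round. -/
def Rec.start (D : ℕ → Row.{u}) : Rec.{u} where
  D := D
  cur := 0
  dg := fun _ _ => False
  reg := fun _ => 0
  acc := fun _ => False
  bad := fun _ => False
  p0 := False
  p1 := False
  ma := none
  mb := none
  jr := none
  out := fun _ => False

open Classical in
theorem reach_init (hd : 0 < d) (D : ℕ → Row.{u}) (b : Prop) :
    Reach (Λ := layout) (Prog.root par) tail (pre d D b) (enc d (Rec.start D)) := by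
  refine reach_of_exec hd ?_
  refine Exec.get_none hd (fun x y h => h) ?_
  set V₁ : layout.Tape d := fun x y t => match t with
    | base even => Even y
    | t => pre d D b x y t with hV₁
  refine Exec.carry hd (V₁ := V₁)
    (fun x y => if Even y then none else some (pre d D b x (y - 1))) ?_ ?_ ?_ ?_ ?_ ?_
  · intro x; simp
  · intro x y
    by_cases hy : Even y <;> simp [hy, Nat.even_add_one]
  · intro x y
    by_cases hy : Even y
    · exact ⟨y, le_rfl, by simp [hy]⟩
    · exact ⟨y + 1, by omega, by simp [Nat.even_add_one, hy]⟩
  · intro x y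
    funext t
    rcases t with o | _ | _ <;> try rfl
    rcases o with k | _ | _ | _ | ρ | _ | _ | _ | _ | _ | _ | _ | _ | _ <;> try rfl
    by_cases hy : Even y <;> simp [V₁, hy]
  · refine Exec.carry hd
      (fun x y => match y with
        | 0 => none
        | y + 1 => if Even y then none else some (V₁ x y)) (fun _ => rfl) ?_ ?_ ?_ Exec.boot
      (fun _ _ _ _ h => h)
    · intro x y
      by_cases hy : Even y <;> simp [V₁, hy]
    · intro x y
      by_cases hy : Even y
      · exact ⟨y + 1, by omega, by simp [hy]⟩
      · exact ⟨y + 2, by omega, by simp [Nat.even_add_one, hy]⟩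
    · intro x y
      funext t
      rcases t with o | _ | _
      · rcases o with k | _ | _ | _ | ρ | _ | _ | _ | _ | _ | _ | _ | _ | _
        case row | lim =>
          rcases y with _ | y
          · simp [enc, V₁, Rec.start]
          · by_cases hy : Even y <;> simp [enc, V₁, hy, Nat.even_add_one, Rec.start]
        all_goals simp [enc, V₁, pre, Rec.start]
      · simp [enc, V₁, pre, Rec.start]
      · simp [enc, V₁, pre, Rec.start]
  · intro x y t h h'
    rcases t with o | _ | _ <;> try exact h
    rcases o with k | _ | _ | _ | ρ | _ | _ | _ | _ | _ | _ | _ | _ | _ <;> try exact h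
    exact h.2

/-- The least number whose digit is not maximal. -/
noncomputable def firstDigit (dg : ℕ → Instr → Prop) : ℕ :=
  sInf {n | (digitEquiv (dg n) : ℕ) + 1 < digitBase}

open Classical in
/-- Addition of one to a number which is given by its digits. -/
noncomputable def succDigits (dg : ℕ → Instr → Prop) (n : ℕ) : Instr → Prop :=
  if n < firstDigit dg then fun _ => False
  else if n = firstDigit dg then digit (digitEquiv (dg n) + 1)
  else dg n

theorem enc_dig (n : ℕ) (hn : (n : Ordinal.{u}) < d) :
    (fun b => enc d r ⟨n, hn⟩ r.cur (base (dig b))) = r.dg n := by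
  funext b
  simp only [enc, true_and, eq_iff_iff]
  constructor
  · rintro ⟨m, hm, h⟩
    have : n = m := by exact_mod_cast hm
    rwa [this]
  · exact fun h => ⟨n, rfl, h⟩

/-- The record after the transition to the next row. -/
noncomputable def Rec.next (r : Rec.{u}) : Rec.{u} :=
  { r with
    cur := r.cur + 1
    dg := succDigits r.dg
    reg := fun _ => 0
    acc := fun _ => False
    bad := fun _ => False
    p0 := False
    p1 := False
    out := fun _ => False }

/-- The transition to the next row carries the digits along, increased by one, and clears the
registers. -/
theorem reach_next (hd : 0 < d) (h0 : r.p0) (hn : r.jr = none) (hj : 0 < r.reg .j)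
    (hma : r.ma = none) (hmb : r.mb = none)
    (hp : ∃ n : ℕ, (n : Ordinal.{u}) < d ∧ (digitEquiv (r.dg n) : ℕ) + 1 < digitBase) :
    Reach (Λ := layout) (Prog.root par) tail (enc d r) (enc d r.next) := by
  classical
  refine reach_of_exec hd (exec_root_boundary hd (.inl h0) hn hj ?_)
  unfold Prog.boundary
  rw [if_pos h0]
  obtain ⟨n, hnd, hn⟩ := hp
  have hf : (firstDigit r.dg : Ordinal.{u}) < d :=
    lt_of_le_of_lt (Nat.cast_le.2 (Nat.sInf_le hn : firstDigit r.dg ≤ n)) hnd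
  have hf1 : (digitEquiv (r.dg (firstDigit r.dg)) : ℕ) + 1 < digitBase :=
    Nat.sInf_mem (s := {n | (digitEquiv (r.dg n) : ℕ) + 1 < digitBase}) ⟨n, hn⟩
  refine Exec.scan hd (V₁ := enc d { r with dg := succDigits r.dg })
    (.inr ⟨⟨_, hf⟩, r.cur, rfl, ⟨rfl, ?_⟩, ?_, ?_, ?_⟩) ?_ (enc_dip rfl (hdg := fun _ _ _ h => h))
  · have := enc_dig (r := r) _ hf
    rw [this]
    exact hf1
  · funext t
    rcases t with o | _ | _ <;> try rfl
    rcases o with k | _ | _ | b | ρ | _ | _ | _ | _ | _ | _ | _ | _ | _ <;> try rfl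
    have := congrFun (enc_dig (r := { r with dg := succDigits r.dg }) _ hf) b
    refine this.trans ?_
    beta_reduce
    rw [enc_dig (r := r) _ hf]
    simp [succDigits]
  · rintro x y (h | ⟨rfl, h⟩)
    · have hx : x.1 < firstDigit r.dg := Subtype.mk_lt_mk.1 h
      obtain ⟨m, hm⟩ := Ordinal.lt_omega0.1 (hx.trans (Ordinal.natCast_lt_omega0 _))
      have hmf : m < firstDigit r.dg := by
        rw [hm] at hx; exact_mod_cast hx
      obtain ⟨x, hxd⟩ := x
      obtain rfl : x = m := hm
      constructor
      · rintro ⟨hy, h⟩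
        obtain rfl : y = r.cur := hy
        rw [enc_dig (r := r) _ hxd] at h
        exact Nat.notMem_of_lt_sInf hmf h
      · funext t
        rcases t with o | _ | _ <;> try rfl
        rcases o with k | _ | _ | b | ρ | _ | _ | _ | _ | _ | _ | _ | _ | _ <;> try rfl
        by_cases hy : y = r.cur
        · subst hy
          have := congrFun (enc_dig (r := { r with dg := succDigits r.dg }) _ hxd) b
          refine this.trans ?_
          simp [succDigits, hmf, enc]
        · simp [enc, hy]
    · constructor
      · rintro ⟨hy, _⟩
        exact h.ne hy
      · funext t
        rcases t with o | _ | _ <;> try rfl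
        rcases o with k | _ | _ | b | ρ | _ | _ | _ | _ | _ | _ | _ | _ | _ <;> try rfl
        simp [enc, h.ne]
  · intro x y hxy
    funext t
    rcases t with o | _ | _ <;> try rfl
    rcases o with k | _ | _ | b | ρ | _ | _ | _ | _ | _ | _ | _ | _ | _ <;> try rfl
    simp only [enc, id, eq_iff_iff]
    refine and_congr_right fun hy => exists_congr fun m => and_congr_right fun hm => ?_
    rcases hxy with h | ⟨rfl, h⟩
    · have hx : firstDigit r.dg < x.1 := Subtype.mk_lt_mk.1 h
      have : firstDigit r.dg < m := by
        rw [hm] at hx; exact_mod_cast hx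
      simp [succDigits, this.not_gt, this.ne']
    · exact absurd hy h.ne'
  · refine Exec.shift hd ?_ ?_ ?_ Exec.boot (fun _ _ _ _ h => h)
    · exact fun x => ⟨r.cur + 1, fun y hy h => by
        have : y = r.cur := h
        omega⟩
    · intro x
      funext t
      rcases t with o | _ | _
      · rcases o with k | _ | _ | b | ρ | _ | _ | _ | _ | _ | _ | _ | _ | _ <;>
          simp [enc, Rec.next, hma, hmb]
      · rfl
      · simp [enc, Rec.next]
    · intro x y
      funext t
      rcases t with o | _ | _
      · rcases o with k | _ | _ | b | ρ | _ | _ | _ | _ | _ | _ | _ | _ | _ <;>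
          simp [enc, Rec.next, hma, hmb]
      · rfl
      · simp [enc, Rec.next]

/-! ### The universal machine: pairs of numbers -/

/-- The successor in the enumeration of pairs. -/
def nextPair (z : ℕ × ℕ) : ℕ × ℕ :=
  if z.1 < z.2 then (if z.1 + 1 = z.2 then (z.1 + 1, 0) else (z.1 + 1, z.2))
  else if z.1 = z.2 then (0, z.2 + 1) else (z.1, z.2 + 1)

theorem unpair_add_one (n : ℕ) : Nat.unpair (n + 1) = nextPair (Nat.unpair n) := by
  obtain ⟨⟨a, b⟩, h⟩ : ∃ z : ℕ × ℕ, Nat.unpair n = z := ⟨_, rfl⟩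
  have hn : n = Nat.pair a b := by rw [← Nat.pair_unpair n, h]
  have key : Nat.pair (nextPair (a, b)).1 (nextPair (a, b)).2 = n + 1 := by
    rw [hn]
    simp only [nextPair, Nat.pair]
    split_ifs <;> simp only at * <;> first | omega | (subst_vars; ring)
  rw [h, ← key, Nat.unpair_pair]

/-- The marks and the registers point to the pair with number `n`. -/
structure Rec.At (r : Rec.{u}) (n : ℕ) : Prop where
  ma : r.ma = some (Nat.unpair n).1
  mb : r.mb = some (Nat.unpair n).2
  jr : r.jr = some n
  a : r.reg .a = (Nat.unpair n).1
  b : r.reg .b = (Nat.unpair n).2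
  j : r.reg .j = n

/-- The marks and the registers are set to the pair with number `n`. -/
noncomputable def Rec.goto (r : Rec.{u}) (n : ℕ) : Rec.{u} :=
  { r with
    ma := some (Nat.unpair n).1
    mb := some (Nat.unpair n).2
    jr := some n
    reg := Function.update (Function.update (Function.update r.reg
      .a (Nat.unpair n).1) .b (Nat.unpair n).2) .j n }

open Classical in
/-- The mark of the pair is moved on, together with the mark of one of the two rows. -/
theorem exec_advShift (hd : 0 < d) {sa : Prop} {k : Cmd Track} {a b n : ℕ}
    (ha : r.ma = some a) (hb : r.mb = some b) (hn : r.jr = some n)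
    (hr : r₁ = { r with
      ma := some (if sa then a + 1 else a)
      mb := some (if sa then b else b + 1)
      jr := some (n + 1) })
    (H : Exec (Λ := layout) rt tail k (enc d r₁) V')
    (hdip : ∀ x y t, enc d r x y t → V' x y t → enc d r₁ x y t) :
    Exec (Λ := layout) rt tail (Prog.advShift sa k) (enc d r) V' := by
  subst hr
  have hbl : 0 < blockLen := Nat.succ_pos _
  refine Exec.shift hd (fun x => ⟨a + b + n + 1, ?_⟩) (fun x => ?_) (fun x y => ?_) H hdip
  · rintro y hy (h | h | ⟨i, h⟩)
    · have h : r.ma = some y := h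
      rw [ha] at h
      cases h
      omega
    · have h : r.mb = some y := h
      rw [hb] at h
      cases h
      omega
    · have h : r.jr = some (blockLen * y + i) := h.2
      rw [hn] at h
      cases h
      have := Nat.le_mul_of_pos_left y hbl
      omega
  · funext t
    rcases t with o | i | _ <;> try rfl
    · rcases o with k | _ | _ | b | ρ | _ | _ | _ | _ | _ | _ | _ | _ | _ <;> try rfl
      · by_cases hsa : sa <;> simp [enc, hsa, ha]
      · by_cases hsa : sa <;> simp [enc, hsa, hb]
    · by_cases hi : (i : ℕ) = 0
      · simp [enc, hi]
      · simp only [enc, hi, hn, dif_neg, not_false_eq_true, Option.some.injEq, eq_iff_iff]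
        refine and_congr_right fun _ => ?_
        omega
  · funext t
    rcases t with o | i | _ <;> try rfl
    · rcases o with k | _ | _ | b | ρ | _ | _ | _ | _ | _ | _ | _ | _ | _ <;> try rfl
      · by_cases hsa : sa
        · by_cases hy : a = y <;> simp [enc, hsa, ha, hy]
        · simp [enc, hsa, ha]
      · by_cases hsa : sa
        · simp [enc, hsa, hb]
        · by_cases hy : b = y <;> simp [enc, hsa, hb, hy]
    · by_cases hi : (i : ℕ) = 0
      · have : blockLen * (y + 1) = blockLen * y + blockLen := by ring
        simp only [enc, hi, hn, this, dif_pos, Option.some.injEq, eq_iff_iff,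
          Option.ite_none_right_eq_some]
        have hl : ((Fin.last (Nat.card Base) : Fin blockLen) : ℕ) + 1 = blockLen := rfl
        constructor
        · rintro ⟨hx, h⟩
          exact ⟨_, ⟨.inr (.inr ⟨Fin.last _, hx, by omega⟩), rfl⟩, hx, by rw [hn]; congr 1; omega⟩
        · rintro ⟨_, ⟨_, rfl⟩, hx, h⟩
          have h : r.jr = some (blockLen * y + (Fin.last (Nat.card Base) : Fin blockLen)) := h
          rw [hn, Option.some.injEq] at h
          exact ⟨hx, by omega⟩
      · simp only [enc, hi, hn, dif_neg, not_false_eq_true, Option.some.injEq, eq_iff_iff]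
        refine and_congr_right fun _ => ?_
        omega

open Classical in
theorem exec_advShift_inc (hd : 0 < d) {sa : Prop} {k : Cmd Track} {a b n a' b' : ℕ} {ρ : Reg}
    {r' : Rec.{u}} (ha : r.ma = some a) (hb : r.mb = some b) (hn : r.jr = some n)
    (ha' : a' = if sa then a + 1 else a) (hb' : b' = if sa then b else b + 1)
    (hr : r₁ = { r with
      ma := some a'
      mb := some b'
      jr := some (n + 1)
      reg := Function.update (Function.update r.reg ρ (r.reg ρ + 1)) .j (r.reg .j + 1) })
    (hρ : ρ ≠ .j) (hda : r'.ma = some a' ∨ a' = a) (hdb : r'.mb = some b' ∨ b' = b)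
    (hdj : r'.jr = some (n + 1))
    (H : Exec (Λ := layout) rt tail k (enc d r₁) (enc d r')) :
    Exec (Λ := layout) rt tail (Prog.advShift sa (Prog.inc ρ (Prog.inc .j k)))
      (enc d r) (enc d r') := by
  let s1 : Rec.{u} := { r with ma := some a', mb := some b', jr := some (n + 1) }
  let s2 : Rec.{u} := { s1 with reg := Function.update r.reg ρ (r.reg ρ + 1) }
  refine exec_advShift (r₁ := s1) hd ha hb hn (by rw [← ha', ← hb']) ?_ (enc_dip rfl (hma := ?_)
    (hmb := ?_) (hjr := fun m _ h => hdj.symm.trans h))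
  · refine exec_inc (r₁ := s2) hd rfl ?_ (enc_dip rfl (hreg := ?_))
    · refine exec_inc (r₁ := r₁) hd ?_ H ?_
      · rw [hr]
        simp [s2, s1, hρ.symm]
      · rw [hr]
        refine enc_dip rfl (hreg := ?_)
        intro ρ'
        by_cases h : ρ' = .j
        · subst h; left; simp [s2, hρ.symm]
        · left; simp [s2, h]
    · intro ρ'
      by_cases h : ρ' = ρ
      · subst h; left; simp [s2, s1]
      · left; simp [s2, s1, h]
  · intro m h h'
    rcases hda with h1 | h1
    · exact h1.symm.trans h'
    · exact (congrArg some h1).trans (ha.symm.trans h)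
  · intro m h h'
    rcases hdb with h1 | h1
    · exact h1.symm.trans h'
    · exact (congrArg some h1).trans (hb.symm.trans h)

theorem Exec.boot_eq {Λ : Layout} {root : Cmd Λ.Tr} {V V' : Λ.Tape d} (h : V = V') :
    Exec root tail .boot V V' := h ▸ Exec.boot

/-- The marks and the registers are updated from one pair of numbers to the next one. -/
theorem exec_adv (hd : 0 < d) {n : ℕ} (h : r.At n) :
    Exec (Λ := layout) rt tail Prog.adv (enc d r) (enc d (r.goto (n + 1))) := by
  classical
  obtain ⟨⟨a, b⟩, hab⟩ : ∃ z : ℕ × ℕ, Nat.unpair n = z := ⟨_, rfl⟩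
  have hnx := unpair_add_one n
  obtain ⟨hma, hmb, hjr, ha, hb, hj⟩ := h
  rw [hab] at hma hmb ha hb hnx
  simp only at hma hmb ha hb
  have hg : ∀ {a' b' : ℕ}, nextPair (a, b) = (a', b') → r.goto (n + 1) = { r with
      ma := some a'
      mb := some b'
      jr := some (n + 1)
      reg := Function.update (Function.update (Function.update r.reg .a a') .b b') .j
        ((n + 1 : ℕ) : Ordinal.{u}) } := by
    intro a' b' h
    rw [h] at hnx
    simp [Rec.goto, hnx]
  refine Exec.get_at hd (x₀ := ⟨0, hd⟩) (y₀ := min a b) ?_ ?_ ?_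
  · rcases le_total a b with h | h
    · left; simp [enc, h, hma]
    · right; simp [enc, h, hmb]
  · rintro x y (h | ⟨rfl, h⟩)
    · exact absurd (Subtype.mk_lt_mk.1 h) not_lt_zero
    · have := lt_min_iff.1 h
      simp [enc, hma, hmb, this.1.ne', this.2.ne']
  rcases lt_trichotomy a b with h | h | h
  · have hcond : (enc d r ⟨0, hd⟩ (min a b) (base ma) ∧ ¬ enc d r ⟨0, hd⟩ (min a b) (base mb)) := by
      simp [enc, hma, hmb, h.le, h.ne']
    simp only [hcond, not_false_eq_true, and_self, if_true]
    by_cases h1 : a + 1 = b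
    · rw [hg (a' := a + 1) (b' := 0) (by simp [nextPair, h, h1])]
      refine exec_advShift_inc hd hma hmb hjr (a' := a + 1) (b' := b) (by simp) (by simp) rfl
        (by simp) (.inl rfl) (.inr rfl) rfl ?_
      refine Exec.ask_yes hd ⟨⟨0, hd⟩, a + 1, by simp [enc, h1]⟩ ?_
      refine Exec.map hd (fun x y => ?_) Exec.boot (fun _ _ _ _ h => h)
      funext t
      rcases t with o | i | _ <;> try rfl
      rcases o with k | _ | _ | b | ρ | _ | _ | _ | _ | _ | _ | _ | _ | _ <;> try rfl
      · cases ρ <;> simp [enc, ha, hj]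
      · simp [enc, eq_comm]
    · rw [hg (a' := a + 1) (b' := b) (by simp [nextPair, h, h1])]
      refine exec_advShift_inc hd hma hmb hjr (a' := a + 1) (b' := b) (by simp) (by simp) rfl
        (by simp) (.inl rfl) (.inr rfl) rfl ?_
      refine Exec.ask_no hd ?_ ?_
      · rintro x y ⟨h2, h3⟩
        have h2 : some (a + 1) = some y := h2
        have h3 : some b = some y := h3
        simp_all
      · refine Exec.boot_eq ?_
        congr 2
        funext ρ
        cases ρ <;> simp [ha, hb, hj]
  · subst h
    have hcond : enc d r ⟨0, hd⟩ (min a a) (base mb) := by simp [enc, hmb]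
    have hcond' : enc d r ⟨0, hd⟩ (min a a) (base ma) := by simp [enc, hma]
    simp only [hcond, hcond', not_true, and_false, if_true, if_false]
    rw [hg (a' := 0) (b' := a + 1) (by simp [nextPair])]
    refine exec_advShift_inc hd hma hmb hjr (a' := a) (b' := a + 1) (by simp) (by simp) rfl
        (by simp) (.inr rfl) (.inl rfl) rfl ?_
    refine Exec.map hd (fun x y => ?_) Exec.boot (fun _ _ _ _ h => h)
    funext t
    rcases t with o | i | _ <;> try rfl
    rcases o with k | _ | _ | b | ρ | _ | _ | _ | _ | _ | _ | _ | _ | _ <;> try rfl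
    · cases ρ <;> simp [enc, hb, hj]
    · simp [enc, eq_comm]
  · have hcond : ¬ (enc d r ⟨0, hd⟩ (min a b) (base ma)) := by
      simp [enc, hma, h.le, h.ne']
    simp only [hcond, false_and, if_false]
    rw [hg (a' := a) (b' := b + 1) (by simp [nextPair, h.not_gt, h.ne'])]
    refine exec_advShift_inc hd hma hmb hjr (a' := a) (b' := b + 1) (by simp) (by simp) rfl
        (by simp) (.inr rfl) (.inl rfl) rfl ?_
    refine Exec.boot_eq ?_
    congr 2
    funext ρ
    cases ρ <;> simp [ha, hb, hj]

end ITTM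

namespace ITTM

open Track Base

variable {d : Ordinal.{u}} {par : Par} {tail : List Move} {r r₁ r' : Rec.{u}}
  {rt k : Cmd Track}

/-! ### The universal machine: the treatment of a pair of numbers -/

theorem enc_natCast (P : ℕ → Prop) (n : ℕ) :
    (∃ m : ℕ, (n : Ordinal.{u}) = m ∧ P m) ↔ P n := by
  constructor
  · rintro ⟨m, hm, h⟩
    have : n = m := by exact_mod_cast hm
    rwa [this]
  · exact fun h => ⟨n, rfl, h⟩

/-- The first cell of the current row which is not in a register. -/
theorem exec_get_reg (hd : 0 < d) {ρ : Reg} (hρ : r.reg ρ < d)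
    {f : Option (Track → Prop) → Cmd Track}
    {V' : layout.Tape d}
    (H : Exec (Λ := layout) rt tail (f (some (enc d r ⟨_, hρ⟩ r.cur))) (enc d r) V') :
    Exec (Λ := layout) rt tail (.get (fun γ => γ (base row) ∧ ¬ γ (base (reg ρ))) f)
      (enc d r) V' := by
  refine Exec.get_at hd (x₀ := ⟨_, hρ⟩) (y₀ := r.cur) (by simp [enc]) ?_ H
  rintro x y (h | ⟨rfl, h⟩)
  · have : x.1 < r.reg ρ := Subtype.mk_lt_mk.1 h
    simp [enc, this]
  · simp [enc, h.ne]

/-- The record after the treatment of the pair with number `n` in a test on the tape `kk`. -/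
def Rec.test (r : Rec.{u}) (kk : Fin 3) (n : ℕ) : Rec.{u} :=
  { r with bad := fun m => r.bad m ∨
      m = (Nat.unpair n).2 ∧ (r.D r.cur).X kk n ∧ ¬ r.acc (Nat.unpair n).1 }

theorem exec_test (hd : Ordinal.omega0 ≤ d) {n : ℕ} {kk : Fin 3} (h : r.At n)
    (H : Exec (Λ := layout) rt tail k (enc d (r.test kk n)) (enc d r')) :
    Exec (Λ := layout) rt tail (Prog.test kk k) (enc d r) (enc d r') := by
  classical
  have hd0 : 0 < d := Ordinal.omega0_pos.trans_le hd
  have hlt : ∀ n : ℕ, (n : Ordinal.{u}) < d := fun n => (Ordinal.natCast_lt_omega0 n).trans_le hd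
  have hsame : ¬ ((r.D r.cur).X kk n ∧ ¬ r.acc (Nat.unpair n).1) →
      Exec (Λ := layout) rt tail k (enc d r) (enc d r') := by
    intro h
    have : r.test kk n = r := by simp [Rec.test, h]
    rwa [this] at H
  unfold Prog.test
  refine exec_get_reg hd0 (h.j ▸ hlt n) ?_
  simp only
  split_ifs with hX
  · have hX : (r.D r.cur).X kk n := h.j ▸ hX
    refine exec_get_reg hd0 (h.a ▸ hlt _) ?_
    simp only
    split_ifs with hA
    · refine hsame fun h' => h'.2 ?_
      obtain ⟨-, m, hm, hA⟩ := hA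
      have hm : r.reg .a = m := hm
      rw [h.a] at hm
      have : (Nat.unpair n).1 = m := by exact_mod_cast hm
      rwa [this]
    · have hA : ¬ r.acc (Nat.unpair n).1 := fun h' => hA ⟨rfl, _, h.a, h'⟩
      refine Exec.upd_at hd0 (x₀ := ⟨(Nat.unpair n).2, hlt _⟩) (y₀ := r.cur) ?_ ?_ ?_ ?_ H
        (enc_dip rfl (hbad := fun _ h _ => .inl h))
      · simp [enc, h.b]
      · rintro x y (h' | ⟨rfl, h'⟩)
        · have : x.1 < (Nat.unpair n).2 := Subtype.mk_lt_mk.1 h'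
          simp [enc, h.b, this]
        · simp [enc, h'.ne]
      · funext t
        rcases t with o | i | _ <;> try rfl
        rcases o with k | _ | _ | b | ρ | _ | _ | _ | _ | _ | _ | _ | _ | _ <;> try rfl
        simp [enc, Rec.test, hX, hA]
      · intro x y hxy
        funext t
        rcases t with o | i | _ <;> try rfl
        rcases o with k | _ | _ | b | ρ | _ | _ | _ | _ | _ | _ | _ | _ | _ <;> try rfl
        simp only [enc, Rec.test, id, eq_iff_iff]
        refine and_congr_right fun hy => exists_congr fun m => and_congr_right fun hm => ?_
        refine or_iff_left ?_
        rintro ⟨rfl, -⟩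
        exact hxy ⟨Subtype.ext hm, hy⟩
  · exact hsame fun h' => hX (show (r.D r.cur).X kk (r.reg .j) by rw [h.j]; exact h'.1)

theorem reach_test (hd : Ordinal.omega0 ≤ d) {n n₀ : ℕ} {kk : Fin 3} (h : r.At n) (h0 : ¬ r.p0)
    (h1 : r.p1) : Reach (Λ := layout) (Prog.root (some (n₀, kk))) tail (enc d r)
      (enc d ((r.test kk n).goto (n + 1))) := by
  have hd0 : 0 < d := Ordinal.omega0_pos.trans_le hd
  refine reach_of_exec hd0 (exec_root_regular hd0 (.inr h1) h.jr ?_)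
  unfold Prog.regular
  rw [if_neg h0]
  exact exec_test hd h (exec_adv hd0 ⟨h.ma, h.mb, h.jr, h.a, h.b, h.j⟩)

open Classical in
/-- The position which corresponds to the machine `z`: its head position, if this is less than `d`,
followed by the number of the machine. -/
noncomputable def place (d : Ordinal.{u}) (D : ℕ → Row.{u}) (z : ℕ) : Ordinal.{u} :=
  Ordinal.omega0 * (if (D z).h < d then (D z).h else 0) + z

open Classical in
/-- The record after the comparison of the pair with number `n`. -/
noncomputable def Rec.compare (d : Ordinal.{u}) (r : Rec.{u}) (n : ℕ) : Rec.{u} :=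
  { r with out := fun m => if m = n then place d r.D (Nat.unpair n).1 < place d r.D (Nat.unpair n).2
      else r.out m }

open Classical in
/-- The comparison of two places needs no arithmetic: a place is determined by the first cell of its
row which is not marked in the track `H`, and of two cells the one with the smaller place is found
first. -/
theorem exec_compare (hd : 0 < d) {n : ℕ} (h : r.At n) (hr' : r'.out = (r.compare d n).out)
    (H : Exec (Λ := layout) rt tail k (enc d (r.compare d n)) (enc d r')) :
    Exec (Λ := layout) rt tail (Prog.compare k) (enc d r) (enc d r') := by
  obtain ⟨⟨a, b⟩, hab⟩ : ∃ z : ℕ × ℕ, Nat.unpair n = z := ⟨_, rfl⟩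
  obtain ⟨hma, hmb, hjr, -, -, -⟩ := h
  rw [hab] at hma hmb
  simp only at hma hmb
  have hbl : 0 < blockLen := Nat.succ_pos _
  -- the first cells which represent the two positions
  have hx : ∀ z, ∃ x : Set.Iio d, x.1 = if (r.D z).h < d then (r.D z).h else 0 := by
    intro z
    split_ifs with h
    · exact ⟨⟨_, h⟩, rfl⟩
    · exact ⟨⟨0, hd⟩, rfl⟩
  obtain ⟨xa, hxa⟩ := hx a
  obtain ⟨xb, hxb⟩ := hx b
  have hP : ∀ {z : ℕ} {xz : Set.Iio d} (_ : xz.1 = if (r.D z).h < d then (r.D z).h else 0)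
      {f : Prop} (_ : f ↔ ¬ (r.D z).h < d) (x : Set.Iio d),
      (f ∨ ¬ x.1 < (r.D z).h) ↔ xz ≤ x := by
    intro z xz hxz f hf x
    rw [← Subtype.coe_le_coe, hxz, hf]
    by_cases h : (r.D z).h < d
    · simp [h]
    · simp [h]
  have key : ∀ {fa fb : Prop}, (fa ↔ ¬ (r.D a).h < d) → (fb ↔ ¬ (r.D b).h < d) →
      Exec (Λ := layout) rt tail (.get (fun γ => (γ (base ma) ∧ (fa ∨ ¬ γ (base Base.H))) ∨
          (γ (base mb) ∧ (fb ∨ ¬ γ (base Base.H)))) fun o =>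
        .upd (fun γ => ∃ r, γ (jr r)) id
        (fun γ t => match t with
          | out r => if γ (jr r) then ∃ g, o = some g ∧ g (base ma) ∧ ¬ g (base mb) else γ (out r)
          | t => γ t) k) (enc d r) (enc d r') := by
    intro fa fb hfa hfb
    have hcell : ∀ (x : Set.Iio d) (y : ℕ),
        ((enc d r x y (base ma) ∧ (fa ∨ ¬ enc d r x y (base Base.H))) ∨
          (enc d r x y (base mb) ∧ (fb ∨ ¬ enc d r x y (base Base.H)))) ↔
        (y = a ∧ xa ≤ x) ∨ (y = b ∧ xb ≤ x) := by
      intro x y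
      simp only [enc, hma, hmb, Option.some.injEq]
      refine or_congr ?_ ?_
      · constructor
        · rintro ⟨rfl, h⟩; exact ⟨rfl, (hP hxa hfa x).1 h⟩
        · rintro ⟨rfl, h⟩; exact ⟨rfl, (hP hxa hfa x).2 h⟩
      · constructor
        · rintro ⟨rfl, h⟩; exact ⟨rfl, (hP hxb hfb x).1 h⟩
        · rintro ⟨rfl, h⟩; exact ⟨rfl, (hP hxb hfb x).2 h⟩
    have hpl : place d r.D a < place d r.D b ↔ xa < xb ∨ xa = xb ∧ a < b := by
      rw [place, place, ← hxa, ← hxb, mul_add_lt_mul_add, Subtype.coe_lt_coe, Subtype.coe_inj]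
    -- the first of the two cells
    obtain ⟨x₀, y₀, hP₀, hb₀, hlt⟩ : ∃ (x₀ : Set.Iio d) (y₀ : ℕ),
        ((y₀ = a ∧ xa ≤ x₀) ∨ (y₀ = b ∧ xb ≤ x₀)) ∧
        (∀ x y, x < x₀ ∨ x = x₀ ∧ y < y₀ → ¬ ((y = a ∧ xa ≤ x) ∨ (y = b ∧ xb ≤ x))) ∧
        ((y₀ = a ∧ ¬ y₀ = b) ↔ xa < xb ∨ xa = xb ∧ a < b) := by
      by_cases hlt : xa < xb ∨ xa = xb ∧ a < b
      · refine ⟨xa, a, .inl ⟨rfl, le_rfl⟩, ?_, ?_⟩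
        · rintro x y h (⟨rfl, h'⟩ | ⟨rfl, h'⟩)
          · rcases h with h | ⟨rfl, h⟩
            · exact absurd h h'.not_gt
            · exact lt_irrefl _ h
          · rcases hlt with h2 | ⟨rfl, h2⟩
            · rcases h with h | ⟨rfl, h⟩
              · exact absurd (h.trans h2) h'.not_gt
              · exact absurd h2 h'.not_gt
            · rcases h with h | ⟨rfl, h⟩
              · exact absurd h h'.not_gt
              · exact absurd h h2.not_gt
        · refine ⟨fun _ => hlt, fun _ => ⟨rfl, ?_⟩⟩
          rintro rfl
          rcases hlt with h2 | ⟨-, h2⟩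
          · have e : xa.1 = xb.1 := hxa.trans hxb.symm
            exact h2.ne (Subtype.ext e)
          · exact lt_irrefl _ h2
      · refine ⟨xb, b, .inr ⟨rfl, le_rfl⟩, ?_, ?_⟩
        · push Not at hlt
          rintro x y h (⟨rfl, h'⟩ | ⟨rfl, h'⟩)
          · rcases h with h | ⟨rfl, h⟩
            · exact absurd (h'.trans_lt h) hlt.1.not_gt
            · have e := le_antisymm hlt.1 h'
              exact absurd h (hlt.2 e.symm).not_gt
          · rcases h with h | ⟨rfl, h⟩
            · exact absurd h h'.not_gt
            · exact lt_irrefl _ h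
        · refine ⟨fun h => absurd rfl h.2, fun h => absurd h hlt⟩
    refine Exec.get_at hd (x₀ := x₀) (y₀ := y₀) ((hcell _ _).2 hP₀)
      (fun x y h => fun h' => hb₀ x y h ((hcell x y).1 h')) ?_
    have hcond : (∃ g, some (enc d r x₀ y₀) = some g ∧ g (base ma) ∧ ¬ g (base mb)) ↔
        place d r.D a < place d r.D b := by
      rw [hpl, ← hlt]
      simp only [Option.some.injEq, exists_eq_left', enc, hma, hmb, @eq_comm _ _ y₀]
    refine Exec.upd_at hd (x₀ := ⟨0, hd⟩) (y₀ := n / blockLen) ?_ ?_ ?_ ?_ H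
      (enc_dip rfl (hout := fun m _ h => hr' ▸ h))
    · exact ⟨⟨n % blockLen, Nat.mod_lt _ hbl⟩, by simp [enc, hjr, Nat.div_add_mod]⟩
    · rintro x y (h | ⟨rfl, h⟩) ⟨i, hi⟩
      · exact absurd (Subtype.mk_lt_mk.1 h) not_lt_zero
      · have hi : r.jr = some (blockLen * y + i) := hi.2
        rw [hjr, Option.some.injEq] at hi
        rw [hi, Nat.mul_add_div hbl, Nat.div_eq_of_lt i.2] at h
        omega
    · funext t
      rcases t with o | i | i <;> try rfl
      · rcases o with k | _ | _ | b | ρ | _ | _ | _ | _ | _ | _ | _ | _ | _ <;> rfl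
      simp only [enc, Rec.compare, hjr, Option.some.injEq, true_and, hab]
      by_cases hi : n = blockLen * (n / blockLen) + i
      · rw [if_pos hi, if_pos hi.symm]
        exact propext (hcond.symm.trans (by simp only [Option.some.injEq]))
      · rw [if_neg hi, if_neg (Ne.symm hi)]
    · intro x y hxy
      funext t
      rcases t with o | i | i <;> try rfl
      · rcases o with k | _ | _ | b | ρ | _ | _ | _ | _ | _ | _ | _ | _ | _ <;> rfl
      simp only [enc, Rec.compare, id, eq_iff_iff]
      refine and_congr_right fun hx => ?_
      rw [if_neg]
      intro hi
      refine hxy ⟨Subtype.ext hx, ?_⟩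
      rw [← hi, Nat.mul_add_div hbl, Nat.div_eq_of_lt i.2, add_zero]
  have hask : ∀ {c : Base} {z : ℕ}, (∀ x y, enc d r x y (base c) ↔ y = z) →
      ∀ {f g : Cmd Track},
      ((r.D z).h < d → Exec (Λ := layout) rt tail f (enc d r) (enc d r')) →
      (¬ (r.D z).h < d → Exec (Λ := layout) rt tail g (enc d r) (enc d r')) →
      Exec (Λ := layout) rt tail (.ask (fun γ => γ (base c) ∧ ¬ γ (base Base.H)) f g)
        (enc d r) (enc d r') := by
    intro c z hc f g hf hg
    by_cases h : (r.D z).h < d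
    · refine Exec.ask_yes hd ⟨⟨_, h⟩, z, (hc _ _).2 rfl, ?_⟩ (hf h)
      simp [enc]
    · refine Exec.ask_no hd ?_ (hg h)
      rintro x y ⟨h1, h2⟩
      obtain rfl := (hc _ _).1 h1
      exact h2 ((show x.1 < d from x.2).trans_le (not_lt.1 h))
  unfold Prog.compare
  refine hask (z := a) (fun x y => by simp [enc, hma, eq_comm]) (fun h1 => ?_) fun h1 => ?_
  · refine hask (z := b) (fun x y => by simp [enc, hmb, eq_comm]) (fun h2 => ?_) fun h2 => ?_
    · exact key (by simp [h1]) (by simp [h2])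
    · exact key (by simp [h1]) (by simp [h2])
  · refine hask (z := b) (fun x y => by simp [enc, hmb, eq_comm]) (fun h2 => ?_) fun h2 => ?_
    · exact key (by simp [h1]) (by simp [h2])
    · exact key (by simp [h1]) (by simp [h2])

/-! ### The universal machine: steps of the simulated machines -/

open Classical in
/-- The symbols at the head position. -/
noncomputable def Row.symbols (R : Row.{u}) : Fin 3 → Bool := fun k => decide (R.X k R.h)

/-- The effect of an instruction: the symbols `w` are written, the head makes the move `m` (for
which `left` is the position on the left), and the new state is `q`. -/
noncomputable def Row.exec (R : Row.{u}) (w : Fin 3 → Bool) (m : Fin 3) (q left : Ordinal.{u}) :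
    Row.{u} where
  X := fun k ξ => (ξ = R.h ∧ w k = true) ∨ (ξ ≠ R.h ∧ R.X k ξ)
  h := if m = 0 then left else if m = 2 then R.h + 1 else R.h
  q := q

open Classical in
/-- The effect of an instruction with states `a`, `b` in the set `dg`, if there is a suitable one.
-/
noncomputable def Row.tryStep (R : Row.{u}) (dg : Instr → Prop) (a b left : Ordinal.{u}) :
    Option Row.{u} :=
  if R.q = a then
    if h : ∃ i : (Fin 3 → Bool) × Fin 3, dg (R.symbols, i) then
      some (R.exec h.choose.1 h.choose.2 b left)
    else none
  else none

/-- The record after the simulated machine was changed to `R`. -/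
noncomputable def Rec.update (r : Rec.{u}) (R : Row.{u}) : Rec.{u} :=
  { r with D := Function.update r.D r.cur R, p1 := True }

/-- The record after the attempt to simulate a step. -/
noncomputable def Rec.step (r : Rec.{u}) (n : ℕ) : Rec.{u} :=
  ((r.D r.cur).tryStep (r.dg n) (Nat.unpair n).1 (Nat.unpair n).2 (r.reg .w)).elim r r.update

/-- The machine carries out an instruction of the simulated program. -/
theorem exec_exec (hd : 0 < d) {w : Fin 3 → Bool} {m : Fin 3} (hh : (r.D r.cur).h < d)
    (hr : r₁ = r.update ((r.D r.cur).exec w m (r.reg .b) (r.reg .w)))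
    (H : Exec (Λ := layout) rt tail k (enc d r₁) (enc d r'))
    (hD : r'.D = r₁.D) :
    Exec (Λ := layout) rt tail (Prog.exec w m k) (enc d r) (enc d r') := by
  subst hr
  refine Exec.upd_at hd (x₀ := ⟨_, hh⟩) (y₀ := r.cur) (by simp [enc]) ?_ ?_ ?_ H
    (enc_dip rfl (hX := ?_) (hh := ?_) (hq := ?_) (h1 := fun _ _ => trivial))
  · rintro x y (h | ⟨rfl, h⟩)
    · have : x.1 < (r.D r.cur).h := Subtype.mk_lt_mk.1 h
      simp only [enc, not_and, not_not]
      rintro rfl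
      exact this
    · simp [enc, h.ne]
  · funext t
    rcases t with o | i | _ <;> try rfl
    rcases o with k | _ | _ | b | ρ | _ | _ | _ | _ | _ | _ | _ | _ | _ <;> try rfl
    · simp [enc, Rec.update, Row.exec]
    · by_cases hm : m = 0
      · simp [enc, Rec.update, Row.exec, hm]
      · by_cases hm2 : m = 2 <;> simp [enc, Rec.update, Row.exec, hm, hm2]
    · simp [enc, Rec.update, Row.exec]
    · simp [enc, Rec.update]
  · intro x y hxy
    funext t
    rcases t with o | i | _ <;> try rfl
    rcases o with k | _ | _ | b | ρ | _ | _ | _ | _ | _ | _ | _ | _ | _ <;> try rfl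
    · by_cases hy : y = r.cur
      · subst hy
        have hx : x.1 ≠ (r.D r.cur).h := fun h => hxy ⟨Subtype.ext h, rfl⟩
        simp [enc, Rec.update, Row.exec, hx]
      · simp [enc, Rec.update, hy]
    · by_cases hy : y = r.cur
      · subst hy
        have hx : x.1 ≠ (r.D r.cur).h := fun h => hxy ⟨Subtype.ext h, rfl⟩
        by_cases hm : m = 0
        · simp [enc, Rec.update, Row.exec, hm]
        · by_cases hm2 : m = 2
          · simp [enc, Rec.update, Row.exec, hm2, le_iff_lt_or_eq, hx]
          · simp [enc, Rec.update, Row.exec, hm, hm2]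
      · by_cases hm : m = 0 <;> simp [enc, Rec.update, hy, hm]
    · by_cases hy : y = r.cur
      · subst hy
        simp [enc, Rec.update, Row.exec]
      · simp [enc, Rec.update, hy]
    · simp [enc, Rec.update]
  · exact fun y k ξ _ h => hD ▸ h
  · exact fun y => .inr (by rw [hD])
  · exact fun y => .inr (by rw [hD])

/-- The search for an instruction whose first state is the current state. -/
theorem exec_step_state (hd : 0 < d) {n : ℕ} (h : r.At n) (hd' : Ordinal.omega0 ≤ d)
    (hh : (r.D r.cur).h < d)
    (H : Exec (Λ := layout) rt tail k (enc d (r.step n)) (enc d r')) (hD : r'.D = (r.step n).D) :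
    Exec (Λ := layout) rt tail (Prog.step k) (enc d r) (enc d r') := by
  classical
  have hlt : ∀ n : ℕ, (n : Ordinal.{u}) < d := fun n => (Ordinal.natCast_lt_omega0 n).trans_le hd'
  unfold Prog.step
  by_cases hqa : (r.D r.cur).q = (Nat.unpair n).1
  · refine Exec.ask_no hd ?_ ?_
    · rintro x y ⟨hy, h'⟩
      obtain rfl : y = r.cur := hy
      exact h' (by simp [enc, h.a, hqa])
    · refine Exec.get_at hd (x₀ := ⟨_, hh⟩) (y₀ := r.cur) (by simp [enc]) ?_ ?_
      · rintro x y (h | ⟨rfl, h⟩)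
        · have : x.1 < (r.D r.cur).h := Subtype.mk_lt_mk.1 h
          simp only [enc, not_and, not_not]
          rintro rfl
          exact this
        · simp [enc, h.ne]
      · refine exec_get_reg hd (h.j ▸ hlt n) ?_
        simp only
        have hsym : Prog.symbols (enc d r ⟨_, hh⟩ r.cur) = (r.D r.cur).symbols := rfl
        have hdg : ∀ b, enc d r ⟨r.reg .j, h.j ▸ hlt n⟩ r.cur (base (dig b)) ↔ r.dg n b := by
          intro b
          simp only [enc, h.j, true_and]
          exact enc_natCast (fun n => r.dg n b) n
        have hex : (fun i : (Fin 3 → Bool) × Fin 3 => enc d r ⟨r.reg .j, h.j ▸ hlt n⟩ r.cur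
            (base (dig (Prog.symbols (enc d r ⟨_, hh⟩ r.cur), i)))) =
            fun i => r.dg n ((r.D r.cur).symbols, i) := by
          funext i
          rw [hsym]
          exact propext (hdg _)
        have key : ∀ p : (Fin 3 → Bool) × Fin 3 → Prop,
            p = (fun i => r.dg n ((r.D r.cur).symbols, i)) →
            Exec (Λ := layout) rt tail (if h : ∃ i, p i then
              Prog.exec h.choose.1 h.choose.2 k else k) (enc d r) (enc d r') := by
          rintro p rfl
          split_ifs with hi
          · have hs : r.step n = r.update ((r.D r.cur).exec hi.choose.1 hi.choose.2
                (r.reg .b) (r.reg .w)) := by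
              unfold Rec.step Row.tryStep
              rw [if_pos hqa, dif_pos hi, h.b]
              rfl
            exact exec_exec hd hh hs H hD
          · have hs : r.step n = r := by
              unfold Rec.step Row.tryStep
              rw [if_pos hqa, dif_neg hi]
              rfl
            rwa [hs] at H
        exact key _ hex
  · have hs : r.step n = r := by simp [Rec.step, Row.tryStep, hqa]
    rw [hs] at H
    refine Exec.ask_yes hd ?_ H
    rcases lt_or_gt_of_ne hqa with h' | h'
    · exact ⟨⟨_, h'.trans (hlt _)⟩, r.cur, by simp [enc, h.a, h']⟩
    · exact ⟨⟨_, hlt (Nat.unpair n).1⟩, r.cur, by simp [enc, h.a, h']⟩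

theorem exec_step_empty (hd : 0 < d) (h : ∀ n b, ¬ r.dg n b)
    (H : Exec (Λ := layout) rt tail k (enc d r) (enc d r')) :
    Exec (Λ := layout) rt tail (Prog.step k) (enc d r) (enc d r') := by
  classical
  unfold Prog.step
  refine Exec.get_any hd fun o _ => ?_
  rcases o with _ | _
  · refine Exec.get_any hd fun o _ => ?_
    rcases o with _ | γ
    · exact H
    · refine Exec.get_any hd fun o ho => ?_
      rcases o with _ | γ'
      · exact H
      · obtain ⟨-, x, y, rfl⟩ := ho γ' rfl
        simp only
        split_ifs with hi
        · obtain ⟨i, -, n, -, hi⟩ := hi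
          exact absurd hi (h _ _)
        · exact H
  · exact H

/-- The record after the treatment of the pair with number `n` in a stage without tests. -/
noncomputable def Rec.regular (d : Ordinal.{u}) (r : Rec.{u}) (n : ℕ) : Rec.{u} :=
  open Classical in if r.p1 then r.compare d n else (r.compare d n).step n

theorem Rec.step_of_empty (h : ∀ n b, ¬ r.dg n b) (n : ℕ) : r.step n = r := by
  simp [Rec.step, Row.tryStep, h]

theorem Rec.step_eq (r : Rec.{u}) (n : ℕ) : r.step n = r ∨ ∃ R, r.step n = r.update R := by
  unfold Rec.step
  cases (r.D r.cur).tryStep (r.dg n) (Nat.unpair n).1 (Nat.unpair n).2 (r.reg .w) with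
  | none => exact .inl rfl
  | some R => exact .inr ⟨R, rfl⟩

theorem Rec.At.step {n m : ℕ} (h : r.At n) : (r.step m).At n := by
  rcases r.step_eq m with e | ⟨R, e⟩ <;> rw [e]
  · exact h
  · exact ⟨h.ma, h.mb, h.jr, h.a, h.b, h.j⟩

theorem Rec.out_step (m : ℕ) : (r.step m).out = r.out := by
  rcases r.step_eq m with e | ⟨R, e⟩ <;> rw [e]
  rfl

theorem reach_regular (hd : 0 < d) {n : ℕ} (h : r.At n) (h0 : r.p0)
    (hs : ¬ r.p1 → Ordinal.omega0 ≤ d ∧ (r.D r.cur).h < d ∨ ∀ n b, ¬ r.dg n b) :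
    Reach (Λ := layout) (Prog.root par) tail (enc d r)
      (enc d ((r.regular d n).goto (n + 1))) := by
  refine reach_of_exec hd (exec_root_regular hd (.inl h0) h.jr ?_)
  unfold Prog.regular
  rw [if_pos h0]
  have hc : (r.compare d n).At n := ⟨h.ma, h.mb, h.jr, h.a, h.b, h.j⟩
  refine exec_compare hd h ?_ ?_
  · unfold Rec.regular
    split_ifs
    · rfl
    · exact Rec.out_step _
  · by_cases h1 : r.p1
    · rw [if_pos h1, Rec.regular, if_pos h1]
      exact exec_adv hd hc
    · rw [if_neg h1, Rec.regular, if_neg h1]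
      have ha := exec_adv (rt := Prog.root par) (tail := tail) hd (hc.step (m := n))
      rcases hs h1 with ⟨h1, h2⟩ | hs
      · exact exec_step_state hd hc h1 h2 ha rfl
      · refine exec_step_empty hd hs ?_
        rwa [Rec.step_of_empty (r := r.compare d n) hs] at ha ⊢

end ITTM

namespace ITTM

open Track Base

variable {d : Ordinal.{u}} {par : Par} {tail : List Move} {r r₁ r' : Rec.{u}}

/-! ### The universal machine: sequences of cycles -/

theorem evBelow_const {μ : Ordinal.{u}} (hμ : 0 < μ) {P : Prop} : P ↔ EvBelow μ fun _ => P :=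
  ⟨fun h => evBelow_of_forall hμ fun _ _ => h, fun ⟨t, ht, h⟩ => h t le_rfl ht⟩

theorem evBelow_congr {μ : Ordinal.{u}} {P Q : Ordinal.{u} → Prop} (h : ∀ t < μ, P t ↔ Q t) :
    EvBelow μ P ↔ EvBelow μ Q :=
  exists_congr fun _ => and_congr_right fun _ => forall_congr' fun t => forall_congr' fun _ =>
    forall_congr' fun ht => h t ht

theorem evBelow_and_iff {μ : Ordinal.{u}} {P : Prop} {Q : Ordinal.{u} → Prop} :
    (EvBelow μ fun j => P ∧ Q j) ↔ P ∧ EvBelow μ Q := by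
  constructor
  · exact fun ⟨t, ht, h⟩ => ⟨(h t le_rfl ht).1, t, ht, fun j h1 h2 => (h j h1 h2).2⟩
  · exact fun ⟨hP, t, ht, h⟩ => ⟨t, ht, fun j h1 h2 => ⟨hP, h j h1 h2⟩⟩

theorem evBelow_natCast {μ ξ : Ordinal.{u}} {P : ℕ → Prop}
    {Q : Ordinal.{u} → ℕ → Prop} (h : ∀ n, P n ↔ EvBelow μ fun j => Q j n) :
    (∃ n : ℕ, ξ = n ∧ P n) ↔ EvBelow μ fun j => ∃ n : ℕ, ξ = n ∧ Q j n := by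
  by_cases hξ : ∃ m : ℕ, ξ = m
  · obtain ⟨m, rfl⟩ := hξ
    rw [enc_natCast, h]
    exact evBelow_congr fun j _ => (enc_natCast _ _).symm
  · constructor
    · rintro ⟨n, rfl, -⟩; exact absurd ⟨n, rfl⟩ hξ
    · rintro ⟨t, ht, h⟩
      obtain ⟨n, rfl, -⟩ := h t le_rfl ht
      exact absurd ⟨n, rfl⟩ hξ

/-- A record describes the limit of a sequence of tapes if this is true for each of its fields. -/
theorem enc_limit {μ : Ordinal.{u}} (hμ : 0 < μ) {s : Ordinal.{u} → Rec.{u}} {r : Rec.{u}}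
    (hcur : ∀ j < μ, (s j).cur = r.cur := by exact fun _ _ => rfl)
    (hX : ∀ y k ξ, (r.D y).X k ξ ↔ EvBelow μ fun j => ((s j).D y).X k ξ := by
      exact fun _ _ _ => evBelow_const ‹_›)
    (hh : ∀ y ξ, ξ < (r.D y).h ↔ EvBelow μ fun j => ξ < ((s j).D y).h := by
      exact fun _ _ => evBelow_const ‹_›)
    (hq : ∀ y ξ, ξ < (r.D y).q ↔ EvBelow μ fun j => ξ < ((s j).D y).q := by
      exact fun _ _ => evBelow_const ‹_›)
    (hdg : ∀ n b, r.dg n b ↔ EvBelow μ fun j => (s j).dg n b := by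
      exact fun _ _ => evBelow_const ‹_›)
    (hreg : ∀ ρ ξ, ξ < r.reg ρ ↔ EvBelow μ fun j => ξ < (s j).reg ρ := by
      exact fun _ _ => evBelow_const ‹_›)
    (hacc : ∀ n, r.acc n ↔ EvBelow μ fun j => (s j).acc n := by
      exact fun _ => evBelow_const ‹_›)
    (hbad : ∀ n, r.bad n ↔ EvBelow μ fun j => (s j).bad n := by
      exact fun _ => evBelow_const ‹_›)
    (h0 : r.p0 ↔ EvBelow μ fun j => (s j).p0 := by exact evBelow_const ‹_›)
    (h1 : r.p1 ↔ EvBelow μ fun j => (s j).p1 := by exact evBelow_const ‹_›)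
    (hma : ∀ y, r.ma = some y ↔ EvBelow μ fun j => (s j).ma = some y := by
      exact fun _ => evBelow_const ‹_›)
    (hmb : ∀ y, r.mb = some y ↔ EvBelow μ fun j => (s j).mb = some y := by
      exact fun _ => evBelow_const ‹_›)
    (hjr : ∀ n, r.jr = some n ↔ EvBelow μ fun j => (s j).jr = some n := by
      exact fun _ => evBelow_const ‹_›)
    (hout : ∀ n, r.out n ↔ EvBelow μ fun j => (s j).out n := by
      exact fun _ => evBelow_const ‹_›) :
    ∀ x y t, enc d r x y t ↔ EvBelow μ fun j => enc d (s j) x y t := by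
  intro x y t
  have key : ∀ {P : Prop} {Q : Ordinal.{u} → Prop}, (P ↔ EvBelow μ Q) →
      (y = r.cur ∧ P ↔ EvBelow μ fun j => y = (s j).cur ∧ Q j) := by
    intro P Q h
    rw [h, ← evBelow_and_iff]
    exact evBelow_congr fun j hj => by rw [hcur j hj]
  have key' : ∀ {P : Prop} {Q : Ordinal.{u} → Prop}, (P ↔ EvBelow μ Q) →
      (x.1 = 0 ∧ P ↔ EvBelow μ fun j => x.1 = 0 ∧ Q j) := by
    intro P Q h
    rw [h, ← evBelow_and_iff]
  rcases t with o | i | i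
  · rcases o with k | _ | _ | b | ρ | _ | _ | _ | _ | _ | _ | _ | _ | _
    · exact hX _ _ _
    · exact hh _ _
    · exact hq _ _
    · exact key (evBelow_natCast fun n => hdg n b)
    · exact key (hreg _ _)
    · exact key (evBelow_natCast hacc)
    · exact key (evBelow_natCast hbad)
    · exact (evBelow_const hμ).trans (evBelow_congr fun j hj => by
        simp only [enc, hcur j hj])
    · exact hma _
    · exact hmb _
    · exact evBelow_const hμ
    · exact evBelow_const hμ
    · exact key h0
    · exact key h1
  · exact key' (hjr _)
  · exact key' (hout _)

theorem evBelow_lt {μ : Ordinal.{u}} (hμ : IsSuccLimit μ) {ξ : Ordinal.{u}} :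
    ξ < μ ↔ EvBelow μ fun j => ξ < j := by
  constructor
  · exact fun h => ⟨ξ + 1, hμ.add_one_lt h, fun t h1 _ => Order.add_one_le_iff.1 h1⟩
  · exact fun ⟨t, ht, h⟩ => (h t le_rfl ht).trans ht

theorem evBelow_lt_pred {μ : Ordinal.{u}} (hμ : IsSuccLimit μ) {ξ : Ordinal.{u}} :
    ξ < μ ↔ EvBelow μ fun j => ξ < j.pred := by
  constructor
  · intro h
    refine ⟨ξ + 1 + 1, hμ.add_one_lt (hμ.add_one_lt h), fun t h1 _ => ?_⟩
    show ξ < t.pred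
    rw [← not_le, Ordinal.pred_le_iff_le_succ, not_le]
    exact Order.add_one_le_iff.1 h1
  · exact fun ⟨t, ht, h⟩ => (h t le_rfl ht).trans_le ((Ordinal.pred_le_self _).trans ht.le)

open Classical in
/-- The head position at a limit is normalized: it returns to `0` if it has left the tape. -/
noncomputable def Row.norm (d : Ordinal.{u}) (R : Row.{u}) : Row.{u} :=
  { R with h := if R.h < d then R.h else 0 }

open Classical in
/-- The position on the left of `ξ`. -/
noncomputable def leftOf (ξ : Ordinal.{u}) : Ordinal.{u} := if IsSuccPrelimit ξ then 0 else ξ.pred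

theorem isSuccPrelimit_iff_pred_eq {ξ : Ordinal.{u}} : IsSuccPrelimit ξ ↔ ¬ ξ.pred < ξ := by
  rw [Ordinal.pred_lt_iff_not_isSuccPrelimit, not_not]

/-- The record after the computation of the position on the left of the head. -/
noncomputable def Rec.pred (d : Ordinal.{u}) (r : Rec.{u}) : Rec.{u} :=
  { r with
    D := Function.update r.D r.cur ((r.D r.cur).norm d)
    reg := Function.update r.reg .w (leftOf ((r.D r.cur).norm d).h)
    p1 := True }

/-- The register `c` counts through all ordinals up to the head position, and at each time `w` is
the predecessor of `c`, where `Ordinal.pred` is the identity at limits. -/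
theorem reach_pred (hd : 0 < d) (h0 : ¬ r.p0) (h1 : ¬ r.p1) (hc : r.reg .c = 0) (hw : r.reg .w = 0)
    (hh : (r.D r.cur).h ≤ d) (hlim : (r.D r.cur).h = d → IsSuccPrelimit d) :
    Reach (Λ := layout) (Prog.root par) tail (enc d r) (enc d (r.pred d)) := by
  set s : Ordinal.{u} → Rec.{u} := fun β => { r with
    reg := Function.update (Function.update r.reg .c β) .w β.pred } with hs
  have hs0 : s 0 = r := by
    have : Function.update (Function.update r.reg .c 0) .w (Ordinal.pred 0) = r.reg := by
      funext ρ
      cases ρ <;> simp [hc, hw]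
    simp only [hs, this]
  have hreg : ∀ {β : Ordinal.{u}}, ∀ ρ, r.reg ρ ≤ (s β).reg ρ := by
    intro β ρ
    cases ρ <;> simp [s, hc, hw]
  have hend : Reach (Λ := layout) (Prog.root par) tail (enc d (s (r.D r.cur).h))
      (enc d (r.pred d)) := by
    refine reach_pred_end hd h0 h1 (by simp [s]) hh ?_ ?_ ?_
    · simp only [s, Function.update_self]
      exact Ordinal.pred_le_self _
    · simp only [s, Rec.pred, Row.norm, leftOf, Rec.mk.injEq, true_and, and_true]
      funext ρ
      cases ρ <;> simp [hc]
      rcases hh.lt_or_eq with hlt | heq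
      · by_cases h : IsSuccPrelimit (r.D r.cur).h
        · simp [hlt, h, isSuccPrelimit_iff_pred_eq.1 h]
        · simp [hlt, h, not_not.1 (mt isSuccPrelimit_iff_pred_eq.2 h)]
      · simp [heq, isSuccPrelimit_iff_pred_eq.1 (hlim heq)]
    · intro h
      simp only [s, Function.update_self] at h
      refine lt_of_le_of_ne hh fun heq => ?_
      exact isSuccPrelimit_iff_pred_eq.1 (heq ▸ hlim heq) h
  rcases eq_or_ne (r.D r.cur).h 0 with hz | hz
  · rw [hz, hs0] at hend
    exact hend
  · have hch : Reach (Λ := layout) (Prog.root par) tail (enc d (s 0))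
      (enc d (s (r.D r.cur).h)) := by
      refine Reach.chain (V := fun β => enc d (s β)) (pos_iff_ne_zero.2 hz) (fun β hβ => ?_) ?_ ?_
      · refine reach_pred_step hd h0 h1 (by simpa [s] using hβ) hh ?_
        simp only [s, Rec.mk.injEq, true_and, and_true]
        funext ρ
        cases ρ <;> simp
      · intro μ _ hlim
        have hμ : 0 < μ := hlim.bot_lt
        refine enc_limit hμ (hreg := fun ρ ξ => ?_)
        by_cases hρc : ρ = .c
        · subst hρc
          simpa [s] using evBelow_lt hlim
        by_cases hρw : ρ = .w
        · subst hρw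
          have : μ.pred = μ := Ordinal.pred_eq_of_isSuccPrelimit hlim.isSuccPrelimit
          simpa [s, this] using evBelow_lt_pred hlim
        simpa [s, hρc, hρw] using evBelow_const hμ
      · rw [hs0]
        exact fun β _ => enc_dip rfl (hreg := fun ρ => .inl (hreg ρ))
    rw [hs0] at hch
    exact hch.trans hend (enc_dip rfl (hreg := fun ρ => .inl (hreg ρ)))

/-- The number below `ω` as a natural number. -/
noncomputable def index (j : Ordinal.{u}) : ℕ := Cardinal.toNat j.card

@[simp] theorem index_natCast (n : ℕ) : index (n : Ordinal.{u}) = n := by simp [index]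

theorem evBelow_omega0 {P : ℕ → Prop} :
    (EvBelow Ordinal.omega0 fun j : Ordinal.{u} => P (index j)) ↔ ∃ N, ∀ n ≥ N, P n := by
  constructor
  · rintro ⟨t, ht, h⟩
    obtain ⟨N, rfl⟩ := Ordinal.lt_omega0.1 ht
    refine ⟨N, fun n hn => ?_⟩
    simpa using h n (by exact_mod_cast hn) (Ordinal.natCast_lt_omega0 n)
  · rintro ⟨N, h⟩
    refine ⟨N, Ordinal.natCast_lt_omega0 N, fun t h1 h2 => ?_⟩
    obtain ⟨n, rfl⟩ := Ordinal.lt_omega0.1 h2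
    rw [index_natCast]
    exact h n (by exact_mod_cast h1)

theorem exists_unpair_fst (a N : ℕ) : ∃ n ≥ N, (Nat.unpair n).1 = a :=
  ⟨Nat.pair a N, Nat.right_le_pair _ _, by simp⟩

theorem exists_unpair_snd (b N : ℕ) : ∃ n ≥ N, (Nat.unpair n).2 = b :=
  ⟨Nat.pair N b, Nat.left_le_pair _ _, by simp⟩

/-- The conditions under which `r` is the limit of a sequence `s` of records in which all pairs of
numbers are treated. -/
structure StageLimit (s : ℕ → Rec.{u}) (r : Rec.{u}) : Prop where
  loc : ∀ n, (s n).At n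
  cur : ∀ n, (s n).cur = r.cur
  dg : ∀ n, (s n).dg = r.dg
  reg : ∀ n ρ, ρ ≠ .a → ρ ≠ .b → ρ ≠ .j → (s n).reg ρ = r.reg ρ
  acc : ∀ n, (s n).acc = r.acc
  p0 : ∀ n, (s n).p0 = r.p0
  D : ∃ N, ∀ n ≥ N, (s n).D = r.D ∧ (s n).p1 = r.p1
  bad : ∀ m, r.bad m ↔ ∃ N, ∀ n ≥ N, (s n).bad m
  out : ∀ m, r.out m ↔ ∃ N, ∀ n ≥ N, (s n).out m
  a : r.reg .a = 0
  b : r.reg .b = 0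
  j : r.reg .j = Ordinal.omega0
  ma : r.ma = none
  mb : r.mb = none
  jr : r.jr = none

/-- A sequence of cycles in which all pairs are treated one after another. Each cell carries the
marks of the pairs only for a bounded time or is left again cofinally often, so that there are no
marks in the limit. -/
theorem reach_stage {s : ℕ → Rec.{u}} (hs : StageLimit s r₁)
    (hseg : ∀ n, Reach (Λ := layout) (Prog.root par) tail (enc d (s n)) (enc d (s (n + 1))))
    (hdip : ∀ n x y t, enc d (s 0) x y t → enc d r₁ x y t → enc d (s n) x y t) :
    Reach (Λ := layout) (Prog.root par) tail (enc d (s 0)) (enc d r₁) := by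
  classical
  have hω : (0 : Ordinal.{u}) < Ordinal.omega0 := Ordinal.omega0_pos
  set V : Ordinal.{u} → layout.Tape d := fun j =>
    if j < Ordinal.omega0 then enc d (s (index j)) else enc d r₁ with hV
  have hVn : ∀ n : ℕ, V n = enc d (s n) := by
    intro n
    simp [V, Ordinal.natCast_lt_omega0 n]
  have hVω : V Ordinal.omega0 = enc d r₁ := by simp [V]
  have hV0 : V 0 = enc d (s 0) := by exact_mod_cast hVn 0
  have hlim : ∀ x y t, enc d r₁ x y t ↔ EvBelow Ordinal.omega0 fun j => enc d
      (s (index j)) x y t := by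
    obtain ⟨N, hN⟩ := hs.D
    have hfin : ∀ {P : Prop} {Q : ℕ → Prop}, (∀ n ≥ N, (Q n ↔ P)) →
        (P ↔ EvBelow Ordinal.omega0 fun j : Ordinal.{u} => Q (index j)) := by
      intro P Q h
      rw [evBelow_omega0]
      exact ⟨fun hP => ⟨N, fun n hn => (h n hn).2 hP⟩, fun ⟨N', h'⟩ =>
        (h (max N N') (le_max_left _ _)).1 (h' _ (le_max_right _ _))⟩
    have hnot : ∀ {Q : ℕ → Prop}, (∀ N, ∃ n ≥ N, ¬ Q n) →
        ¬ EvBelow Ordinal.omega0 fun j : Ordinal.{u} => Q (index j) := by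
      intro Q h
      rw [evBelow_omega0]
      rintro ⟨N, hN⟩
      obtain ⟨n, hn, h⟩ := h N
      exact h (hN n hn)
    refine enc_limit hω (s := fun j => s (index j)) (fun _ _ => hs.cur _)
      (fun y k ξ => hfin (Q := fun n => ((s n).D y).X k ξ) fun n hn => ?_)
      (fun y ξ => hfin (Q := fun n => ξ < ((s n).D y).h) fun n hn => ?_)
      (fun y ξ => hfin (Q := fun n => ξ < ((s n).D y).q) fun n hn => ?_)
      (fun n b => hfin (Q := fun m => (s m).dg n b) fun m hm => ?_) (fun ρ ξ => ?_)
      (fun m => hfin (Q := fun n => (s n).acc m) fun n hn => ?_)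
      (fun m => ?_) (hfin (Q := fun n => (s n).p0) fun n hn => ?_)
      (hfin (Q := fun n => (s n).p1) fun n hn => ?_) (fun y => ?_) (fun y => ?_)
      (fun n => ?_) (fun m => ?_)
    · rw [(hN n hn).1]
    · rw [(hN n hn).1]
    · rw [(hN n hn).1]
    · rw [hs.dg]
    · have h0 : ∀ (f : ℕ → ℕ), (∀ N, ∃ n ≥ N, f n = 0) →
          ¬ EvBelow Ordinal.omega0 fun j : Ordinal.{u} => ξ < (f (index j) : Ordinal.{u}) := by
        intro f hf
        refine hnot (Q := fun n => ξ < (f n : Ordinal.{u})) fun N => ?_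
        obtain ⟨n, hn, h⟩ := hf N
        exact ⟨n, hn, by simp [h]⟩
      by_cases ha : ρ = .a
      · subst ha
        simp only [hs.a, (hs.loc _).a, not_lt_zero, false_iff]
        exact h0 (fun n => (Nat.unpair n).1) (exists_unpair_fst 0)
      by_cases hb : ρ = .b
      · subst hb
        simp only [hs.b, (hs.loc _).b, not_lt_zero, false_iff]
        exact h0 (fun n => (Nat.unpair n).2) (exists_unpair_snd 0)
      by_cases hj : ρ = .j
      · subst hj
        simp only [hs.j, (hs.loc _).j]
        rw [evBelow_omega0 (P := fun n => ξ < (n : Ordinal.{u}))]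
        constructor
        · intro h
          obtain ⟨m, rfl⟩ := Ordinal.lt_omega0.1 h
          exact ⟨m + 1, fun n hn => by exact_mod_cast hn⟩
        · rintro ⟨N, h⟩
          exact (h N le_rfl).trans (Ordinal.natCast_lt_omega0 N)
      · exact hfin (Q := fun n => ξ < (s n).reg ρ) fun n _ => by rw [hs.reg n ρ ha hb hj]
    · rw [hs.acc]
    · rw [hs.bad, ← evBelow_omega0]
    · rw [hs.p0]
    · rw [(hN n hn).2]
    · simp only [hs.ma, (hs.loc _).ma, reduceCtorEq, false_iff, Option.some.injEq]
      refine hnot (Q := fun n => (Nat.unpair n).1 = y) fun N => ?_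
      obtain ⟨n, hn, h⟩ := exists_unpair_fst (y + 1) N
      exact ⟨n, hn, by omega⟩
    · simp only [hs.mb, (hs.loc _).mb, reduceCtorEq, false_iff, Option.some.injEq]
      refine hnot (Q := fun n => (Nat.unpair n).2 = y) fun N => ?_
      obtain ⟨n, hn, h⟩ := exists_unpair_snd (y + 1) N
      exact ⟨n, hn, by omega⟩
    · simp only [hs.jr, (hs.loc _).jr, reduceCtorEq, false_iff, Option.some.injEq]
      exact hnot (Q := fun m => m = n) fun N => ⟨N + n + 1, by omega, by omega⟩
    · rw [hs.out, ← evBelow_omega0]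
  have := Reach.chain (root := Prog.root par) (tail := tail) hω (V := V) (fun j hj => ?_)
      (fun μ hμω hμ => ?_)
    (fun j hj => ?_)
  · rwa [hVω, hV0] at this
  · obtain ⟨n, rfl⟩ := Ordinal.lt_omega0.1 hj
    have h1 := hVn (n + 1)
    rw [Nat.cast_succ] at h1
    rw [hVn, h1]
    exact hseg n
  · obtain rfl : μ = Ordinal.omega0 := le_antisymm hμω (Ordinal.omega0_le_of_isSuccLimit hμ)
    intro x y t
    rw [hVω, hlim]
    refine evBelow_congr fun j hj => ?_
    simp only [V, if_pos hj]
  · obtain ⟨n, rfl⟩ := Ordinal.lt_omega0.1 hj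
    rw [hVn, hV0, hVω]
    exact hdip n

end ITTM

namespace ITTM

open Track Base

variable {d : Ordinal.{u}} {par : Par} {tail : List Move} {r r₁ r' : Rec.{u}}

/-! ### The universal machine: the wellfounded part of a coded relation -/

/-- No pair of numbers is treated. -/
structure Rec.Idle (r : Rec.{u}) : Prop where
  a : r.reg .a = 0
  b : r.reg .b = 0
  j : r.reg .j = 0
  ma : r.ma = none
  mb : r.mb = none
  jr : r.jr = none

theorem Rec.at_goto (r : Rec.{u}) (n : ℕ) : (r.goto n).At n := by
  constructor <;> simp [Rec.goto]

theorem Rec.goto_goto (r : Rec.{u}) (n m : ℕ) : (r.goto n).goto m = r.goto m := by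
  simp only [Rec.goto, Rec.mk.injEq, true_and, and_true]
  funext ρ
  cases ρ <;> simp

theorem Rec.Idle.goto_zero (h : r.Idle) :
    r.goto 0 = { r with ma := some 0, mb := some 0, jr := some 0 } := by
  simp only [Rec.goto, Rec.mk.injEq, Nat.unpair_zero, Prod.fst_zero, Prod.snd_zero, true_and,
    and_true]
  funext ρ
  cases ρ <;> simp [h.a, h.b, h.j]

theorem Rec.Idle.reg_le (h : r.Idle) (n : ℕ) (ρ : Reg) : r.reg ρ ≤ (r.goto n).reg ρ := by
  cases ρ <;> simp [Rec.goto, h.a, h.b, h.j]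

/-- The pairs with numbers less than `n` have been treated in a test on the tape `kk`. -/
def Rec.tested (r : Rec.{u}) (kk : Fin 3) (n : ℕ) : Rec.{u} :=
  { r with bad := fun m => ∃ i < n, m = (Nat.unpair i).2 ∧ (r.D r.cur).X kk i ∧
      ¬ r.acc (Nat.unpair i).1 }

/-- All pairs have been treated in a test on the tape `kk`. -/
noncomputable def Rec.testEnd (r : Rec.{u}) (kk : Fin 3) : Rec.{u} :=
  { r with
    bad := fun m => ∃ l : ℕ, (r.D r.cur).X kk (Nat.pair l m : ℕ) ∧ ¬ r.acc l
    reg := Function.update r.reg .j Ordinal.omega0 }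

/-- A stage of a test marks all numbers with a predecessor which is not yet accepted. -/
theorem reach_test_stage (hd : Ordinal.omega0 ≤ d) {n₀ : ℕ} {kk : Fin 3} (h0 : ¬ r.p0) (h1 : r.p1)
    (hi : r.Idle) (hb : ∀ n, ¬ r.bad n) (hc : r.reg .c < d) :
    Reach (Λ := layout) (Prog.root (some (n₀, kk))) tail (enc d r) (enc d (r.testEnd kk)) := by
  have hd0 : 0 < d := Ordinal.omega0_pos.trans_le hd
  have hz : (r.tested kk 0).goto 0 = r.goto 0 := by
    simp only [Rec.goto, Rec.tested, not_lt_zero, false_and, exists_false, Rec.mk.injEq, true_and,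
      and_true]
    funext m
    simp [hb]
  have hrw : Reach (Λ := layout) (Prog.root (some (n₀, kk))) tail (enc d r)
      (enc d ((r.tested kk 0).goto 0)) := by
    rw [hz]
    exact reach_rewind hd0 (.inr h1) hi.jr hi.j (.inr ⟨by simp, hc⟩) hi.goto_zero
  have hreg : ∀ n ρ, r.reg ρ ≤ ((r.tested kk n).goto n).reg ρ := fun n ρ => hi.reg_le n ρ
  refine hrw.trans (reach_stage (s := fun n => (r.tested kk n).goto n) ?_ (fun n => ?_)
    fun n => ?_) ?_
  · refine ⟨fun n => Rec.at_goto _ n, fun n => rfl, fun n => rfl, fun n ρ ha hb hj => ?_,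
      fun n => rfl, fun n => rfl, ⟨0, fun n _ => ⟨rfl, rfl⟩⟩, fun m => ?_, fun m => ?_,
      by simpa [Rec.testEnd] using hi.a, by simpa [Rec.testEnd] using hi.b,
      by simp [Rec.testEnd], hi.ma, hi.mb, hi.jr⟩
    · cases ρ <;> simp_all [Rec.goto, Rec.testEnd, Rec.tested]
    · constructor
      · rintro ⟨l, h1, h2⟩
        exact ⟨Nat.pair l m + 1, fun n hn => ⟨Nat.pair l m, hn, by simp, h1, by simpa using h2⟩⟩
      · rintro ⟨N, h⟩
        obtain ⟨i, -, rfl, h1, h2⟩ := h N le_rfl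
        exact ⟨(Nat.unpair i).1, by simpa using h1, h2⟩
    · exact ⟨fun h => ⟨0, fun _ _ => h⟩, fun ⟨N, h⟩ => h N le_rfl⟩
  · have e : (r.tested kk (n + 1)).goto (n + 1) =
        (((r.tested kk n).goto n).test kk n).goto (n + 1) := by
      rw [← Rec.goto_goto (r.tested kk (n + 1)) n]
      refine congrArg (fun r => Rec.goto r (n + 1)) ?_
      simp only [Rec.goto, Rec.test, Rec.tested, Rec.mk.injEq, true_and, and_true]
      funext m
      simp only [Order.lt_add_one_iff, eq_iff_iff]
      constructor
      · rintro ⟨i, hi, h⟩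
        rcases hi.lt_or_eq with hi | rfl
        · exact .inl ⟨i, hi, h⟩
        · exact .inr h
      · rintro (⟨i, hi, h⟩ | h)
        · exact ⟨i, hi.le, h⟩
        · exact ⟨n, le_rfl, h⟩
    rw [e]
    exact reach_test hd (Rec.at_goto _ n) h0 h1
  · refine enc_dip rfl (hbad := fun m h _ => ?_) (hreg := fun ρ => ?_)
      (hma := fun n _ h => absurd (hi.ma.symm.trans h) (by simp))
      (hmb := fun n _ h => absurd (hi.mb.symm.trans h) (by simp))
      (hjr := fun n _ h => absurd (hi.jr.symm.trans h) (by simp))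
    · left
      exact (show ((r.tested kk 0).goto 0).reg ρ = r.reg ρ by rw [hz, hi.goto_zero]) ▸ hreg n ρ
    · obtain ⟨i, hi, _⟩ := h
      exact absurd hi not_lt_zero
  · exact enc_dip rfl (hbad := fun m h _ => absurd h (hb m)) (hreg := fun ρ => .inl (hreg 0 ρ))
      (hma := fun n h _ => absurd (hi.ma.symm.trans h) (by simp))
      (hmb := fun n h _ => absurd (hi.mb.symm.trans h) (by simp))
      (hjr := fun n h _ => absurd (hi.jr.symm.trans h) (by simp))

/-- The numbers whose rank in the relation `E` is less than `β`. -/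
def rankLT (E : ℕ → ℕ → Prop) (β : Ordinal.{u}) : ℕ → Prop :=
  fun n => ∃ γ : Set.Iio β, ∀ m, E m n → rankLT E γ.1 m
termination_by β
decreasing_by exact γ.2

theorem rankLT_iff {E : ℕ → ℕ → Prop} {β : Ordinal.{u}} {n : ℕ} :
    rankLT E β n ↔ ∃ γ < β, ∀ m, E m n → rankLT E γ m := by
  rw [rankLT]
  exact ⟨fun ⟨γ, h⟩ => ⟨γ.1, γ.2, h⟩, fun ⟨γ, hγ, h⟩ => ⟨⟨γ, hγ⟩, h⟩⟩

theorem rankLT_mono {E : ℕ → ℕ → Prop} {β γ : Ordinal.{u}} (h : β ≤ γ) {n : ℕ}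
    (hn : rankLT E β n) : rankLT E γ n := by
  rw [rankLT_iff] at hn ⊢
  obtain ⟨ζ, hζ, hn⟩ := hn
  exact ⟨ζ, hζ.trans_le h, hn⟩

theorem rankLT_zero {E : ℕ → ℕ → Prop} {n : ℕ} : ¬ rankLT E (0 : Ordinal.{u}) n := by
  rw [rankLT_iff]
  rintro ⟨γ, hγ, -⟩
  exact not_lt_zero hγ

theorem rankLT_add_one {E : ℕ → ℕ → Prop} {β : Ordinal.{u}} {n : ℕ} :
    rankLT E (β + 1) n ↔ ∀ m, E m n → rankLT E β m := by
  rw [rankLT_iff]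
  constructor
  · rintro ⟨γ, hγ, h⟩ m hm
    exact rankLT_mono (Order.lt_add_one_iff.1 hγ) (h m hm)
  · exact fun h => ⟨β, Order.lt_add_one_iff.2 le_rfl, h⟩

theorem rankLT_limit {E : ℕ → ℕ → Prop} {μ : Ordinal.{u}} (hμ : IsSuccLimit μ) {n : ℕ} :
    rankLT E μ n ↔ EvBelow μ fun β => rankLT E β n := by
  constructor
  · intro h
    rw [rankLT_iff] at h
    obtain ⟨γ, hγ, h⟩ := h
    exact ⟨γ + 1, hμ.add_one_lt hγ, fun t ht _ => rankLT_mono ht (rankLT_add_one.2 h)⟩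
  · exact fun ⟨t, ht, h⟩ => rankLT_mono ht.le (h t le_rfl ht)

/-- The rank of `n` in `E`, bounded by `β`. -/
noncomputable def rankMin (E : ℕ → ℕ → Prop) (n : ℕ) (β : Ordinal.{u}) : Ordinal.{u} :=
  sInf (insert β {γ | rankLT E (γ + 1) n})

theorem lt_rankMin_iff {E : ℕ → ℕ → Prop} {n : ℕ} {β ξ : Ordinal.{u}} :
    ξ < rankMin E n β ↔ ξ < β ∧ ∀ γ, rankLT E (γ + 1) n → ξ < γ := by
  have hne : (insert β {γ | rankLT E (γ + 1) n}).Nonempty := ⟨β, .inl rfl⟩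
  constructor
  · exact fun h => ⟨h.trans_le (csInf_le' (.inl rfl)), fun γ hγ => h.trans_le (csInf_le' (.inr hγ))⟩
  · rintro ⟨h1, h2⟩
    rcases csInf_mem hne with h | h
    · exact h1.trans_eq h.symm
    · exact h2 _ h

theorem rankMin_zero (E : ℕ → ℕ → Prop) (n : ℕ) : rankMin E n (0 : Ordinal.{u}) = 0 := by
  refine eq_of_forall_lt_iff fun ξ => ?_
  simp [lt_rankMin_iff]

open Classical in
theorem rankMin_add_one (E : ℕ → ℕ → Prop) (n : ℕ) (β : Ordinal.{u}) : rankMin E n (β + 1) =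
    if rankLT E (β + 1) n then rankMin E n β else rankMin E n β + 1 := by
  have h1 : ¬ rankLT E (β + 1) n → ∀ γ, rankLT E (γ + 1) n → β < γ := by
    intro h γ hγ
    by_contra hγβ
    exact h (rankLT_mono (add_le_add_left (not_lt.1 hγβ) 1) hγ)
  split_ifs with h
  · refine eq_of_forall_lt_iff fun ξ => ?_
    rw [lt_rankMin_iff, lt_rankMin_iff]
    exact ⟨fun h' => ⟨h'.2 β h, h'.2⟩, fun h' => ⟨h'.1.trans (Order.lt_add_one_iff.2 le_rfl), h'.2⟩⟩
  · have e1 : rankMin E n β = β := eq_of_forall_lt_iff fun ξ => by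
      rw [lt_rankMin_iff]
      exact ⟨fun h' => h'.1, fun h' => ⟨h', fun γ hγ => h'.trans (h1 h γ hγ)⟩⟩
    rw [e1]
    refine eq_of_forall_lt_iff fun ξ => ?_
    rw [lt_rankMin_iff]
    exact ⟨fun h' => h'.1, fun h' => ⟨h', fun γ hγ =>
      (Order.lt_add_one_iff.1 h').trans_lt (h1 h γ hγ)⟩⟩

/-- The relation which is coded on the tape `kk` of the current row. -/
def Rec.rel (r : Rec.{u}) (kk : Fin 3) (m n : ℕ) : Prop :=
  (r.D r.cur).X kk (Nat.pair m n : ℕ)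

/-- The record after `β` stages of the computation of the wellfounded part. -/
noncomputable def Rec.ranks (r : Rec.{u}) (n₀ : ℕ) (kk : Fin 3) (β : Ordinal.{u}) : Rec.{u} :=
  { r with
    acc := rankLT (r.rel kk) β
    reg := Function.update (Function.update r.reg .c β) .e (rankMin (r.rel kk) n₀ β) }

/-- The state of the control of the universal machine before a test. -/
structure Rec.Ready (r : Rec.{u}) : Prop extends r.Idle where
  p0 : ¬ r.p0
  p1 : r.p1
  acc : ∀ n, ¬ r.acc n
  bad : ∀ n, ¬ r.bad n
  c : r.reg .c = 0
  e : r.reg .e = 0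
  r : r.reg .r = 0

theorem Rec.Ready.ranks_zero (h : r.Ready) (n₀ : ℕ) (kk : Fin 3) : r.ranks n₀ kk 0 = r := by
  have e1 : rankLT (r.rel kk) (0 : Ordinal.{u}) = r.acc := by
    funext n
    simp [h.acc, rankLT_zero]
  have e2 : Function.update (Function.update r.reg .c 0) .e (rankMin (r.rel kk) n₀ 0) = r.reg := by
    funext ρ
    cases ρ <;> simp [h.c, h.e, rankMin_zero]
  simp only [Rec.ranks, e1, e2]

theorem Rec.Ready.idle_ranks (h : r.Ready) (n₀ : ℕ) (kk : Fin 3) (β : Ordinal.{u}) :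
    (r.ranks n₀ kk β).Idle :=
  ⟨by simpa [Rec.ranks] using h.a, by simpa [Rec.ranks] using h.b, by simpa [Rec.ranks] using h.j,
    h.ma, h.mb, h.jr⟩

theorem Rec.Ready.reg_le (h : r.Ready) (n₀ : ℕ) (kk : Fin 3) (β : Ordinal.{u}) (ρ : Reg) :
    r.reg ρ ≤ (r.ranks n₀ kk β).reg ρ := by
  cases ρ <;> simp [Rec.ranks, h.c, h.e]

/-- A stage of a test accepts the numbers all of whose predecessors have been accepted. -/
theorem reach_ranks_add_one (hd : Ordinal.omega0 ≤ d) {n₀ : ℕ} {kk : Fin 3} (h : r.Ready)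
    {β : Ordinal.{u}} (hβ : β < d) (hE : ∃ n, rankLT (r.rel kk) (β + 1) n ∧ ¬ rankLT
        (r.rel kk) β n) :
    Reach (Λ := layout) (Prog.root (some (n₀, kk))) tail (enc d (r.ranks n₀ kk β))
      (enc d (r.ranks n₀ kk (β + 1))) := by
  have hi := h.idle_ranks n₀ kk β
  have hbad : ∀ n, ((r.ranks n₀ kk β).testEnd kk).bad n ↔ ¬ rankLT (r.rel kk) (β + 1) n := by
    intro n
    rw [rankLT_add_one]
    push Not
    rfl
  have hor : ∀ n, rankLT (r.rel kk) β n ∨ ¬ ((r.ranks n₀ kk β).testEnd kk).bad n ↔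
      rankLT (r.rel kk) (β + 1) n := by
    intro n
    rw [hbad, not_not]
    exact or_iff_right_of_imp (rankLT_mono (Order.lt_add_one_iff.2 le_rfl).le)
  refine (reach_test_stage (r := r.ranks n₀ kk β) hd h.p0 h.p1 hi h.bad
    (by simpa [Rec.ranks] using hβ)).trans
    (reach_progress (r := (r.ranks n₀ kk β).testEnd kk) hd h.p0 h.p1 h.jr (by simp [Rec.testEnd])
      (by simpa [Rec.testEnd, Rec.ranks] using h.r) ?_ ?_) ?_
  · obtain ⟨n, h1, h2⟩ := hE
    exact ⟨n, h2, fun h' => (hbad n).1 h' h1⟩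
  · have e := rankMin_add_one (r.rel kk) n₀ β
    rw [Rec.ranks, Rec.mk.injEq]
    refine ⟨rfl, rfl, rfl, ?_, ?_, ?_, rfl, rfl, rfl, rfl, rfl, rfl⟩
    · have hn := hor n₀
      funext ρ
      cases ρ
      case e =>
        simp only [Function.update_self, e, ← hn]
        simp only [Rec.ranks, Rec.testEnd, ne_eq, reduceCtorEq, not_false_eq_true,
          Function.update_of_ne, Function.update_self]
        classical exact if_congr hn.symm rfl rfl
      case j => simpa using h.j
      all_goals simp [Rec.ranks, Rec.testEnd]
    · funext n
      exact propext (hor n).symm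
    · funext n
      exact propext (iff_false_intro (h.bad n))
  · refine enc_dip rfl (hbad := fun m h' _ => absurd h' (h.bad m)) (hreg := fun ρ => ?_)
    left
    by_cases hρ : ρ = .j
    · subst hρ
      rw [hi.j]
      exact zero_le
    · simp [Rec.testEnd, hρ]

/-- The construction of the wellfounded part through transfinitely many stages: since the sets of
accepted numbers increase, their inferior limit is their union. -/
theorem reach_ranks (hd : Ordinal.omega0 ≤ d) {n₀ : ℕ} {kk : Fin 3} (h : r.Ready)
    {κ : Ordinal.{u}} (hκ0 : 0 < κ) (hκ : κ ≤ d)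
    (hE : ∀ β < κ, ∃ n, rankLT (r.rel kk) (β + 1) n ∧ ¬ rankLT (r.rel kk) β n) :
    Reach (Λ := layout) (Prog.root (some (n₀, kk))) tail (enc d r)
      (enc d (r.ranks n₀ kk κ)) := by
  have := Reach.chain (root := Prog.root (some (n₀, kk))) (tail := tail) hκ0
    (V := fun β => enc d (r.ranks n₀ kk β))
    (fun β hβ => ?_) (fun μ _ hlim => ?_) ?_
  · rw [h.ranks_zero] at this
    exact this
  · exact reach_ranks_add_one (β := β) hd h (hβ.trans_le hκ) (hE β hβ)
  · have hμ : 0 < μ := hlim.bot_lt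
    refine enc_limit (s := fun β => r.ranks n₀ kk β) (r := r.ranks n₀ kk μ) hμ
      (hreg := fun ρ ξ => ?_) (hacc := fun n => rankLT_limit hlim)
    by_cases hρc : ρ = .e
    · subst hρc
      simp only [Rec.ranks, Function.update_self]
      rw [lt_rankMin_iff]
      constructor
      · rintro ⟨h1, h2⟩
        obtain ⟨t, ht, h1⟩ := (evBelow_lt hlim).1 h1
        exact ⟨t, ht, fun j h3 h4 => lt_rankMin_iff.2 ⟨h1 j h3 h4, h2⟩⟩
      · rintro ⟨t, ht, h⟩
        obtain ⟨h1, h2⟩ := lt_rankMin_iff.1 (h t le_rfl ht)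
        exact ⟨h1.trans ht, h2⟩
    by_cases hρw : ρ = .c
    · subst hρw
      simpa [Rec.ranks] using evBelow_lt hlim
    simpa [Rec.ranks, hρc, hρw] using evBelow_const hμ
  · rw [h.ranks_zero]
    exact fun β _ => enc_dip rfl (hacc := fun n h' _ => absurd h' (h.acc n))
      (hreg := fun ρ => .inl (h.reg_le _ _ _ ρ))

/-- If the construction of the wellfounded part ends before stage `d`, the machine goes on to the
next phase. -/
theorem reach_test_fail (hd : Ordinal.omega0 ≤ d) {n₀ : ℕ} {kk : Fin 3} (h : r.Ready)
    (hE : ¬ ∀ β < d, ∃ n, rankLT (r.rel kk) (β + 1) n ∧ ¬ rankLT (r.rel kk) β n) :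
    Reach (Λ := layout) (Prog.root (some (n₀, kk))) tail (enc d r)
      (enc d { r with p0 := True, p1 := False }) := by
  push Not at hE
  -- The first stage without a new number is where the test ends.
  let S : Set Ordinal.{u} := {β | β < d ∧ ∀ n, rankLT (r.rel kk) (β + 1) n → rankLT (r.rel kk) β n}
  have hS : S.Nonempty := hE
  obtain ⟨hκ, hfix⟩ : sInf S ∈ S := csInf_mem hS
  have hmin : ∀ β < sInf S, ∃ n, rankLT (r.rel kk) (β + 1) n ∧ ¬ rankLT (r.rel kk) β n := by
    intro β hβ
    by_contra hne
    push Not at hne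
    exact notMem_of_lt_csInf' hβ ⟨hβ.trans hκ, hne⟩
  set κ := sInf S with hκdef
  have hi := h.idle_ranks n₀ kk κ
  have hend : Reach (Λ := layout) (Prog.root (some (n₀, kk))) tail (enc d (r.ranks n₀ kk κ))
      (enc d { r with p0 := True, p1 := False }) := by
    refine (reach_test_stage (r := r.ranks n₀ kk κ) hd h.p0 h.p1 hi h.bad
      (by simpa [Rec.ranks] using hκ)).trans
      (reach_fail (r := (r.ranks n₀ kk κ).testEnd kk) hd h.p0 h.p1 h.jr (by simp [Rec.testEnd])
      ?_ ?_) ?_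
    · intro n
      by_cases hn : rankLT (r.rel kk) κ n
      · exact .inl hn
      · have := mt (hfix n) hn
        rw [rankLT_add_one] at this
        push Not at this
        exact .inr this
    · rw [Rec.mk.injEq]
      refine ⟨rfl, rfl, rfl, ?_, ?_, ?_, rfl, rfl, rfl, rfl, rfl, rfl⟩
      · funext ρ
        cases ρ
        case j => simpa using h.j
        case e => simpa using h.e
        case c => simpa using h.c
        all_goals simp [Rec.ranks, Rec.testEnd]
      · funext n
        exact propext (iff_false_intro (h.acc n))
      · funext n
        exact propext (iff_false_intro (h.bad n))
    · refine enc_dip rfl (hbad := fun m h' _ => absurd h' (h.bad m)) (hreg := fun ρ => ?_)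
      left
      by_cases hρ : ρ = .j
      · subst hρ
        rw [hi.j]
        exact zero_le
      · simp [Rec.testEnd, hρ]
  rcases eq_or_ne κ 0 with hz | hz
  · rw [hz, h.ranks_zero] at hend
    exact hend
  · exact (reach_ranks hd h (pos_iff_ne_zero.2 hz) hκ.le hmin).trans hend
      (enc_dip rfl (hacc := fun n h' _ => absurd h' (h.acc n))
      (hreg := fun ρ => .inl (h.reg_le _ _ _ ρ)))

/-- From the beginning of a cycle with the tape `V`, the run halts, with the head on cell `β`. -/
def Stops (root : Cmd Track) (tail : List Move) (V : layout.Tape d) (β : Ordinal.{u}) : Prop :=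
  ∃ t, (runFrom (Ordinal.omega0 * d) (bootConf (Λ := layout) root tail V) t).Halted ∧
    (runFrom (Ordinal.omega0 * d) (bootConf (Λ := layout) root tail V) t).head = β

theorem Stops.of_reach {root : Cmd Track} {V V' : layout.Tape d} {β : Ordinal.{u}}
    (h : Reach (Λ := layout) root tail V V') (H : Stops root tail V' β) : Stops root tail V β := by
  obtain ⟨t, -, ht, -⟩ := h
  obtain ⟨t', h1, h2⟩ := H
  exact ⟨t + t', by rw [runFrom_add, ht]; exact h1, by rw [runFrom_add, ht]; exact h2⟩

theorem Halts.get_at {Λ : Layout} {root : Cmd Λ.Tr} (hd : 0 < d) {P : (Λ.Tr → Prop) → Prop}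
    {V : Λ.Tape d} {k : Option (Λ.Tr → Prop) → Cmd Λ.Tr} {x₀ : Set.Iio d} {y₀ : ℕ}
    {β : Ordinal.{u}} (hP : P (V x₀ y₀)) (hb : ∀ x y, x < x₀ ∨ x = x₀ ∧ y < y₀ → ¬ P (V x y))
    (H : Halts root tail (k (some (V x₀ y₀))) V β) : Halts root tail (.get P k) V β :=
  Halts.scan hd (.inr ⟨x₀, y₀, rfl, hP, rfl, fun x y h => ⟨hb x y h, rfl⟩, fun _ _ _ => rfl⟩) H

theorem Halts.ask_no {Λ : Layout} {root : Cmd Λ.Tr} (hd : 0 < d) {P : (Λ.Tr → Prop) → Prop}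
    {V : Λ.Tape d} {yes no : Cmd Λ.Tr} {β : Ordinal.{u}} (hP : ∀ x y, ¬ P (V x y))
    (H : Halts root tail no V β) : Halts root tail (.ask P yes no) V β :=
  Halts.scan hd (.inl ⟨rfl, fun x y => ⟨hP x y, rfl⟩⟩) H

/-- If the construction of the wellfounded part does not end before stage `d`, the machine halts at
the cell which is given by the rank of the distinguished number. -/
theorem stops_of_ranks (hd : Ordinal.omega0 ≤ d) {n₀ : ℕ} {kk : Fin 3} (h : r.Ready)
    (hE : ∀ β < d, ∃ n, rankLT (r.rel kk) (β + 1) n ∧ ¬ rankLT (r.rel kk) β n)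
    (hn : rankMin (r.rel kk) n₀ d < d) :
    Stops (d := d) (Prog.root (some (n₀, kk))) tail (enc d r)
      (tail.foldl (fun h m => m.apply (Ordinal.omega0 * d) h)
      ((blockLen : Ordinal.{u}) * (Ordinal.omega0 * rankMin (r.rel kk) n₀ d + r.cur))) := by
  have hd0 : 0 < d := Ordinal.omega0_pos.trans_le hd
  refine Stops.of_reach (reach_ranks hd h hd0 le_rfl hE) ?_
  refine exists_halted_of_halts root_ne_boot hd0 ?_
  have hi := h.idle_ranks n₀ kk d
  refine Halts.get_at hd0 (x₀ := ⟨0, hd0⟩) (y₀ := r.cur) (by simp [enc, Rec.ranks]) ?_ ?_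
  · rintro x y (h | ⟨rfl, h⟩)
    · exact absurd (Subtype.mk_lt_mk.1 h) not_lt_zero
    · simpa [enc, Rec.ranks] using h.ne
  · have h0 : ¬ enc d (r.ranks n₀ kk d) ⟨0, hd0⟩ r.cur (base p0) := fun h' => h.p0 h'.2
    have h1 : enc d (r.ranks n₀ kk d) ⟨0, hd0⟩ r.cur (base p1) := ⟨rfl, h.p1⟩
    simp only [h0, h1, not_true, and_false, if_false]
    refine Halts.ask_no hd0 ?_ (Halts.ask_no hd0 ?_ ?_)
    · rintro x y ⟨i, -, h'⟩
      have h' : r.jr = _ := h'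
      rw [h.jr] at h'
      cases h'
    · rintro x y ⟨-, -, h'⟩
      rw [hi.j] at h'
      exact not_lt_zero h'
    · unfold Prog.restart
      rw [if_neg (by simp)]
      refine Halts.ask_no hd0 ?_ ?_
      · rintro x y ⟨hy, h'⟩
        refine h' ⟨hy, ?_⟩
        simp only [Rec.ranks]
        exact x.2
      · refine Halts.halt hd0 (x₀ := ⟨_, hn⟩) (y₀ := r.cur) ?_ ?_
        · simp [enc, Rec.ranks]
        · rintro x y (h | ⟨rfl, h⟩)
          · have : x.1 < rankMin (r.rel kk) n₀ d := Subtype.mk_lt_mk.1 h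
            simp [enc, Rec.ranks, this]
          · simp [enc, Rec.ranks, h.ne]

end ITTM

namespace ITTM

open Track Base

variable {d : Ordinal.{u}} {par : Par} {tail : List Move} {r r₁ r' : Rec.{u}}

/-! ### The universal machine: stages of the simulation -/

/-- The effect of the pair of states with number `n`. -/
noncomputable def Row.tryAt (R : Row.{u}) (dg : ℕ → Instr → Prop) (left : Ordinal.{u}) (n : ℕ) :
    Option Row.{u} :=
  R.tryStep (dg n) (Nat.unpair n).1 (Nat.unpair n).2 left

open Classical in
/-- The effect of a step of the simulated machine with the table `dg`. -/
noncomputable def Row.advance (R : Row.{u}) (dg : ℕ → Instr → Prop) (left : Ordinal.{u}) :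
    Row.{u} :=
  if h : ∃ n, R.tryAt dg left n ≠ none then (R.tryAt dg left (Nat.find h)).getD R else R

/-- The records of a stage of the simulation. -/
noncomputable def Rec.stage (d : Ordinal.{u}) (r : Rec.{u}) : ℕ → Rec.{u}
  | 0 => r.goto 0
  | n + 1 => ((r.stage d n).regular d n).goto (n + 1)

open Classical in
/-- During a stage, the simulated machine makes its step at the first pair of states which admits an
instruction; the later pairs do not change it, because then `p1` holds. -/
theorem Rec.stage_eq (h1 : ¬ r.p1) (n : ℕ) : ∃ O : ℕ → Prop, r.stage d n = { r.goto n with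
    D := if ∃ i < n, (r.D r.cur).tryAt r.dg (r.reg .w) i ≠ none then
      Function.update r.D r.cur ((r.D r.cur).advance r.dg (r.reg .w)) else r.D
    p1 := ∃ i < n, (r.D r.cur).tryAt r.dg (r.reg .w) i ≠ none
    out := O } := by
  induction n with
  | zero =>
    refine ⟨r.out, ?_⟩
    simp only [Rec.stage, Rec.goto, not_lt_zero, false_and, exists_false, if_false, h1]
  | succ n ih =>
    obtain ⟨O, hO⟩ := ih
    by_cases hn : ∃ i < n, (r.D r.cur).tryAt r.dg (r.reg .w) i ≠ none
    · have hn' : ∃ i < n + 1, (r.D r.cur).tryAt r.dg (r.reg .w) i ≠ none := by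
        obtain ⟨i, hi, h⟩ := hn
        exact ⟨i, by omega, h⟩
      simp only [hn, hn', if_true] at hO ⊢
      refine ⟨((r.stage d n).compare d n).out, ?_⟩
      have hp : (r.stage d n).p1 := by rw [hO]; trivial
      simp only [Rec.stage, Rec.regular, if_pos hp]
      rw [hO]
      simp only [Rec.compare, Rec.goto, Rec.mk.injEq, true_and, and_true]
      funext ρ
      cases ρ <;> simp
    · have hp : ¬ (r.stage d n).p1 := by rw [hO]; exact hn
      simp only [hn, if_false] at hO
      refine ⟨((r.stage d n).compare d n).out, ?_⟩
      simp only [Rec.stage, Rec.regular, if_neg hp]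
      have hlt : ∀ P : ℕ → Prop, (∃ i < n + 1, P i) ↔ (∃ i < n, P i) ∨ P n := by
        intro P
        constructor
        · rintro ⟨i, hi, h⟩
          rcases (Nat.lt_succ_iff.1 hi).lt_or_eq with hi | rfl
          · exact .inl ⟨i, hi, h⟩
          · exact .inr h
        · rintro (⟨i, hi, h⟩ | h)
          · exact ⟨i, by omega, h⟩
          · exact ⟨n, by omega, h⟩
      simp only [hlt, hn, false_or]
      have htry : ((r.stage d n).compare d n).step n = (((r.D r.cur).tryAt r.dg (r.reg .w) n).elim
          ((r.stage d n).compare d n) ((r.stage d n).compare d n).update) := by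
        rw [hO]
        simp [Rec.step, Rec.compare, Rec.goto, Row.tryAt]
      rw [htry]
      cases hT : (r.D r.cur).tryAt r.dg (r.reg .w) n with
      | none =>
        simp only [Option.elim_none, ne_eq, not_true, if_false]
        rw [hO]
        simp only [Rec.compare, Rec.goto, Rec.mk.injEq, true_and, and_true]
        funext ρ
        cases ρ <;> simp
      | some R =>
        have hex : ∃ n, (r.D r.cur).tryAt r.dg (r.reg .w) n ≠ none := ⟨n, by simp [hT]⟩
        have hfind : Nat.find hex = n := by
          rw [Nat.find_eq_iff]
          refine ⟨by simp [hT], fun m hm hne => hn ⟨m, hm, hne⟩⟩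
        have hadv : (r.D r.cur).advance r.dg (r.reg .w) = R := by
          unfold Row.advance
          rw [dif_pos hex, hfind, hT]
          rfl
        simp only [Option.elim_some, ne_eq, reduceCtorEq, not_false_eq_true, if_true, hadv]
        rw [hO]
        simp only [Rec.compare, Rec.update, Rec.goto, Rec.mk.injEq, true_and, and_true]
        funext ρ
        cases ρ <;> simp

theorem Rec.out_stage_of_lt {m n : ℕ} (h : m < n) :
    (r.stage d n).out m = (r.stage d (m + 1)).out m := by
  induction n, h using Nat.le_induction with
  | base => rfl
  | succ n hn ih =>
    rw [← ih]
    have hm : m ≠ n := by have : m + 1 ≤ n := hn; omega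
    simp only [Rec.stage, Rec.goto, Rec.regular]
    split_ifs
    · simp [Rec.compare, hm]
    · rw [Rec.out_step]
      simp [Rec.compare, hm]

theorem Rec.out_stage (n : ℕ) : (r.stage d (n + 1)).out n =
    (place d (r.stage d n).D (Nat.unpair n).1 < place d (r.stage d n).D (Nat.unpair n).2) := by
  simp only [Rec.stage, Rec.goto, Rec.regular]
  split_ifs
  · simp [Rec.compare]
  · rw [Rec.out_step]
    simp [Rec.compare]

/-- The record after a stage of the simulation. -/
noncomputable def Rec.stageEnd (r : Rec.{u}) (P : Prop) (O : ℕ → Prop) : Rec.{u} :=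
  { r with
    D := Function.update r.D r.cur ((r.D r.cur).advance r.dg (r.reg .w))
    p1 := P
    out := O
    reg := Function.update r.reg .j Ordinal.omega0 }

/-- A stage of the simulation: the current machine makes a step, and the order of the places is
written to the track `out`. With an empty table nothing changes in between, so that the order is
that of the initial places. Without instructions the length `d` may be finite. -/
theorem reach_step_stage (hd : 0 < d) (h0 : r.p0) (h1 : ¬ r.p1) (hi : r.Idle)
    (hout : ∀ n, ¬ r.out n) (hs : Ordinal.omega0 ≤ d ∧ (r.D r.cur).h < d ∨ ∀ n b, ¬ r.dg n b) :
    ∃ (P : Prop) (O : ℕ → Prop), Reach (Λ := layout) (Prog.root par) tail (enc d r)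
      (enc d (r.stageEnd P O)) ∧
      ((∀ n b, ¬ r.dg n b) →
        ∀ n, O n ↔ place d r.D (Nat.unpair n).1 < place d r.D (Nat.unpair n).2) := by
  classical
  set R := r.D r.cur with hR
  refine ⟨∃ i, R.tryAt r.dg (r.reg .w) i ≠ none, fun n => (r.stage d (n + 1)).out n, ?_, ?_⟩
  · choose O hO using Rec.stage_eq (d := d) h1
    have hD : ∀ n, (r.stage d n).D = if ∃ i < n, R.tryAt r.dg (r.reg .w) i ≠ none then
        Function.update r.D r.cur (R.advance r.dg (r.reg .w)) else r.D := fun n => by rw [hO]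
    have hp : ∀ n, (r.stage d n).p1 = ∃ i < n, R.tryAt r.dg (r.reg .w) i ≠ none :=
      fun n => by rw [hO]
    have hloc : ∀ n, (r.stage d n).At n := by
      intro n
      have := r.at_goto n
      rw [hO]
      exact ⟨this.ma, this.mb, this.jr, this.a, this.b, this.j⟩
    have hzero : (r.stage d 0) = r.goto 0 := rfl
    have hregle : ∀ n ρ, r.reg ρ ≤ (r.stage d n).reg ρ := by
      intro n ρ
      rw [hO]
      exact hi.reg_le n ρ
    refine (reach_rewind hd (.inl h0) hi.jr hi.j (.inl h0) hi.goto_zero).trans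
      (reach_stage (s := r.stage d) ?_ (fun n => ?_) fun n => ?_) ?_
    · refine ⟨hloc, fun n => by rw [hO]; rfl, fun n => by rw [hO]; rfl, fun n ρ ha hb hj => ?_,
        fun n => by rw [hO]; rfl, fun n => by rw [hO]; rfl, ?_, fun m => ?_, fun m => ?_,
        by simpa [Rec.stageEnd] using hi.a, by simpa [Rec.stageEnd] using hi.b,
        by simp [Rec.stageEnd], hi.ma, hi.mb, hi.jr⟩
      · rw [hO]
        cases ρ <;> simp_all [Rec.goto, Rec.stageEnd]
      · by_cases hex : ∃ i, R.tryAt r.dg (r.reg .w) i ≠ none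
        · obtain ⟨i, hi⟩ := id hex
          refine ⟨i + 1, fun n hn => ?_⟩
          have : ∃ i < n, R.tryAt r.dg (r.reg .w) i ≠ none := ⟨i, hn, hi⟩
          rw [hD, hp, if_pos this]
          exact ⟨rfl, propext (iff_of_true this hex)⟩
        · refine ⟨0, fun n _ => ?_⟩
          have : ¬ ∃ i < n, R.tryAt r.dg (r.reg .w) i ≠ none := fun ⟨i, _, hi⟩ => hex ⟨i, hi⟩
          rw [hD, hp, if_neg this]
          refine ⟨?_, propext (iff_of_false this hex)⟩
          have : R.advance r.dg (r.reg .w) = R := by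
            unfold Row.advance
            rw [dif_neg hex]
          show r.D = Function.update r.D r.cur (R.advance r.dg (r.reg .w))
          rw [this]
          exact (Function.update_eq_self _ _).symm
      · have : ∀ n, (r.stage d n).bad = r.bad := fun n => by rw [hO]; rfl
        simp only [this]
        exact ⟨fun h => ⟨0, fun _ _ => h⟩, fun ⟨N, h⟩ => h N le_rfl⟩
      · constructor
        · exact fun h => ⟨m + 1, fun n hn => by rw [Rec.out_stage_of_lt hn]; exact h⟩
        · rintro ⟨N, h⟩
          have := h (max N (m + 1)) (le_max_left _ _)
          rwa [Rec.out_stage_of_lt (lt_of_lt_of_le (Nat.lt_succ_self m) (le_max_right _ _))] at this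
    · refine reach_regular hd (hloc n) (by rw [hO]; exact h0) fun hp1 => ?_
      rw [hp] at hp1
      have e : ((r.stage d n).D (r.stage d n).cur) = R := by
        rw [hD, if_neg hp1]
        rw [hO]
        rfl
      have e2 : (r.stage d n).dg = r.dg := by rw [hO]; rfl
      rw [e, e2]
      exact hs
    · have hcur : (r.stage d n).cur = (r.stage d 0).cur := by rw [hO, hzero]; rfl
      have hDn : (r.stage d n).D = r.D ∨
          (r.stage d n).D = Function.update r.D r.cur (R.advance r.dg (r.reg .w)) := by
        rw [hD]
        split_ifs
        · exact .inr rfl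
        · exact .inl rfl
      refine enc_dip hcur (hX := fun y k ξ h h' => ?_) (hh := fun y => ?_) (hq := fun y => ?_)
        (hdg := fun m b h _ => by rw [hO]; exact h) (hreg := fun ρ => ?_)
        (hacc := fun m h _ => by rw [hO]; exact h) (hbad := fun m h _ => by rw [hO]; exact h)
        (h0 := fun _ _ => by rw [hO]; exact h0) (h1 := fun h _ => absurd h h1)
        (hma := fun n _ h => absurd (hi.ma.symm.trans h) (by simp))
        (hmb := fun n _ h => absurd (hi.mb.symm.trans h) (by simp))
        (hjr := fun n _ h => absurd (hi.jr.symm.trans h) (by simp))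
        (hout := fun m h _ => absurd h (hout m))
      · rcases hDn with e | e <;> rw [e]
        · exact h
        · exact h'
      · rcases hDn with e | e <;> rw [e]
        · exact .inl le_rfl
        · exact .inr le_rfl
      · rcases hDn with e | e <;> rw [e]
        · exact .inl le_rfl
        · exact .inr le_rfl
      · left
        have : (r.stage d 0).reg ρ = r.reg ρ := by rw [hzero, hi.goto_zero]
        rw [this]
        exact hregle n ρ
    · exact enc_dip rfl (hreg := fun ρ => .inl (hi.reg_le 0 ρ))
        (hma := fun n h _ => absurd (hi.ma.symm.trans h) (by simp))
        (hmb := fun n h _ => absurd (hi.mb.symm.trans h) (by simp))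
        (hjr := fun n h _ => absurd (hi.jr.symm.trans h) (by simp))
  · intro he n
    show (r.stage d (n + 1)).out n ↔ _
    rw [Rec.out_stage]
    obtain ⟨O, hO⟩ := Rec.stage_eq (r := r) (d := d) h1 n
    have : (r.stage d n).D = r.D := by
      rw [hO]
      simp [Row.tryAt, Row.tryStep, he]
    rw [this]

/-- The record at the beginning of the work on row `c`. -/
def Rec.begin (D : ℕ → Row.{u}) (c : ℕ) (dg : ℕ → Instr → Prop) : Rec.{u} :=
  { Rec.start D with cur := c, dg := dg }

theorem ready_begin_pred (D : ℕ → Row.{u}) (c : ℕ) (dg : ℕ → Instr → Prop) :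
    ((Rec.begin D c dg).pred d).Ready := by
  constructor
  · constructor <;> simp [Rec.begin, Rec.start, Rec.pred]
  all_goals simp [Rec.begin, Rec.start, Rec.pred]

theorem reach_begin_pred (hd : 0 < d) {D : ℕ → Row.{u}} {c : ℕ} {dg : ℕ → Instr → Prop}
    (hh : (D c).h ≤ d) (hlim : (D c).h = d → IsSuccPrelimit d) :
    Reach (Λ := layout) (Prog.root par) tail (enc d (Rec.begin D c dg))
      (enc d ((Rec.begin D c dg).pred d)) :=
  reach_pred hd (by simp [Rec.begin, Rec.start]) (by simp [Rec.begin, Rec.start]) rfl rfl hh hlim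

/-- A step of the simulated machine with the table `dg`, after the normalization of its head
position. -/
noncomputable def Row.cycle (d : Ordinal.{u}) (R : Row.{u}) (dg : ℕ → Instr → Prop) : Row.{u} :=
  (R.norm d).advance dg (leftOf (R.norm d).h)

theorem Row.norm_h_lt (hd : 0 < d) (R : Row.{u}) : (R.norm d).h < d := by
  unfold Row.norm
  simp only
  split_ifs with h
  · exact h
  · exact hd

/-- The work on a row after the test. -/
theorem reach_begin_next (hd : Ordinal.omega0 ≤ d) {D : ℕ → Row.{u}} {c : ℕ}
    {dg : ℕ → Instr → Prop}
    (hp : ∃ n : ℕ, (digitEquiv (dg n) : ℕ) + 1 < digitBase)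
    (ht : Reach (Λ := layout) (Prog.root par) tail (enc d ((Rec.begin D c dg).pred d))
      (enc d { (Rec.begin D c dg).pred d with p0 := True, p1 := False })) :
    Reach (Λ := layout) (Prog.root par) tail (enc d ((Rec.begin D c dg).pred d))
      (enc d (Rec.begin (Function.update D c ((D c).cycle d dg)) (c + 1) (succDigits dg))) := by
  have hd0 : 0 < d := Ordinal.omega0_pos.trans_le hd
  have hr := ready_begin_pred (d := d) D c dg
  set r := (Rec.begin D c dg).pred d with hrdef
  have hDc : r.D r.cur = (D c).norm d := by simp [r, Rec.begin, Rec.start, Rec.pred]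
  set r₁ : Rec.{u} := { r with p0 := True, p1 := False } with hr₁
  obtain ⟨P, O, h, -⟩ := reach_step_stage (par := par) (tail := tail)
    (r := r₁) hd0 trivial id
    ⟨hr.a, hr.b, hr.j, hr.ma, hr.mb, hr.jr⟩ (by simp [r₁, r, Rec.begin, Rec.start, Rec.pred])
    (.inl ⟨hd, by
      show (r.D r.cur).h < d
      rw [hDc]
      exact Row.norm_h_lt hd0 _⟩)
  have hnext : (r₁.stageEnd P O).next =
      Rec.begin (Function.update D c ((D c).cycle d dg)) (c + 1) (succDigits dg) := by
    simp only [Rec.next, Rec.stageEnd, r₁, r, Rec.begin, Rec.start, Rec.pred, Row.cycle,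
      Function.update_self, Function.update_idem]
  obtain ⟨n, hn⟩ := hp
  have hj : 0 < (r₁.stageEnd P O).reg .j := by
    simp [Rec.stageEnd]
  have h2 := reach_next (par := par) (tail := tail) (r := r₁.stageEnd P O) hd0 trivial hr.jr hj
    hr.ma hr.mb ⟨n, (Ordinal.natCast_lt_omega0 n).trans_le hd, hn⟩
  rw [hnext] at h2
  have hD1 : (r₁.stageEnd P O).D = Function.update D c ((D c).cycle d dg) :=
    congrArg Rec.D hnext
  refine ht.trans (h.trans h2 ?_) ?_
  · refine enc_dip rfl (hX := fun y k ξ _ h => ?_) (hh := fun y => .inr ?_) (hq := fun y => .inr ?_)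
      (hreg := fun ρ => .inl ?_) (h1 := fun h _ => h.elim) (hout := fun n h _ => ?_)
    · rw [hD1]; exact h
    · rw [hD1]; exact le_rfl
    · rw [hD1]; exact le_rfl
    · by_cases hρ : ρ = .j
      · subst hρ
        exact hr.j.trans_le zero_le
      · simp [Rec.stageEnd, hρ]
    · simp [r₁, r, Rec.begin, Rec.start, Rec.pred] at h
  · exact enc_dip rfl (h0 := fun _ _ => trivial)
      (h1 := fun _ h => absurd h (by simp [Rec.begin, Rec.start]))

end ITTM

namespace ITTM

open Track Base

variable {d : Ordinal.{u}} {par : Par} {tail : List Move}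

/-! ### The universal machine: rounds -/

/-- The simulated machine with the table `dg` at time `κ`, before the normalization of its head
position. -/
noncomputable def rowPre (d : Ordinal.{u}) (dg : ℕ → Instr → Prop) (κ : Ordinal.{u}) : Row.{u} :=
  Ordinal.limitRecOn κ ⟨fun _ _ => False, 0, 0⟩ (fun _ R => R.cycle d dg)
    (fun μ _ f =>
      { X := fun k ξ => ∃ t₀ < μ, ∀ t (ht : t < μ), t₀ ≤ t → (f t ht).X k ξ
        h := Filter.liminf (fun t : Set.Iio μ => ((f t.1 t.2).norm d).h) Filter.atTop
        q := Filter.liminf (fun t : Set.Iio μ => (f t.1 t.2).q) Filter.atTop })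

theorem rowPre_zero (d : Ordinal.{u}) (dg : ℕ → Instr → Prop) :
    rowPre d dg 0 = ⟨fun _ _ => False, 0, 0⟩ := Ordinal.limitRecOn_zero ..

theorem rowPre_add_one (d : Ordinal.{u}) (dg : ℕ → Instr → Prop) (κ : Ordinal.{u}) :
    rowPre d dg (κ + 1) = (rowPre d dg κ).cycle d dg := Ordinal.limitRecOn_add_one ..

theorem rowPre_limit (d : Ordinal.{u}) (dg : ℕ → Instr → Prop) {μ : Ordinal.{u}}
    (hμ : IsSuccLimit μ) : rowPre d dg μ =
      { X := fun k ξ => EvBelow μ fun t => (rowPre d dg t).X k ξ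
        h := Filter.liminf (fun t : Set.Iio μ => ((rowPre d dg t.1).norm d).h) Filter.atTop
        q := Filter.liminf (fun t : Set.Iio μ => (rowPre d dg t.1).q) Filter.atTop } := by
  unfold rowPre
  rw [Ordinal.limitRecOn_limit _ _ _ _ hμ]
  congr 1
  funext k ξ
  exact propext ⟨fun ⟨t₀, h0, h⟩ => ⟨t₀, h0, fun t h1 h2 => h t h2 h1⟩,
    fun ⟨t₀, h0, h⟩ => ⟨t₀, h0, fun t h1 h2 => h t h2 h1⟩⟩

theorem leftOf_le (ξ : Ordinal.{u}) : leftOf ξ ≤ ξ := by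
  unfold leftOf
  split_ifs
  · exact zero_le
  · exact Ordinal.pred_le_self _

/-- An attempted step changes nothing, or it leads to an effect of an instruction. -/
theorem Row.advance_eq (R : Row.{u}) (dg : ℕ → Instr → Prop) (left : Ordinal.{u}) :
    R.advance dg left = R ∨ ∃ w m, ∃ n : ℕ, R.advance dg left = R.exec w m n left := by
  classical
  unfold Row.advance
  split_ifs with h
  · have hn := Nat.find_spec h
    generalize Nat.find h = n at hn
    unfold Row.tryAt Row.tryStep at hn ⊢
    split_ifs at hn ⊢ with h1 h2
    · exact .inr ⟨_, _, _, rfl⟩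
    · exact absurd rfl hn
    · exact absurd rfl hn
  · exact .inl rfl

theorem Row.cycle_h_lt (hd : IsSuccLimit d) (R : Row.{u}) (dg : ℕ → Instr → Prop) :
    (R.cycle d dg).h < d := by
  have h := Row.norm_h_lt hd.bot_lt R
  unfold Row.cycle
  rcases Row.advance_eq (R.norm d) dg (leftOf (R.norm d).h) with e | ⟨w, m, n, e⟩ <;> rw [e]
  · exact h
  · simp only [Row.exec]
    split_ifs
    · exact (leftOf_le _).trans_lt h
    · exact hd.add_one_lt h
    · exact h

theorem rowPre_h_le (hd : IsSuccLimit d) (dg : ℕ → Instr → Prop) (κ : Ordinal.{u}) :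
    (rowPre d dg κ).h ≤ d := by
  induction κ using Ordinal.limitRecOn with
  | zero => rw [rowPre_zero]; exact zero_le
  | add_one κ _ => rw [rowPre_add_one]; exact (Row.cycle_h_lt hd _ _).le
  | limit μ hμ _ =>
    rw [rowPre_limit d dg hμ]
    refine le_of_forall_lt fun ξ hξ => ?_
    rw [lt_liminf_Iio_iff hμ.bot_lt (f := fun t => ((rowPre d dg t).norm d).h)
      fun t _ => (Row.norm_h_lt hd.bot_lt _).le] at hξ
    obtain ⟨t, ht, h⟩ := hξ
    exact (h t le_rfl ht).trans (Row.norm_h_lt hd.bot_lt _)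

theorem rowPre_q_le (d : Ordinal.{u}) (dg : ℕ → Instr → Prop) (κ : Ordinal.{u}) :
    (rowPre d dg κ).q ≤ Ordinal.omega0 := by
  induction κ using Ordinal.limitRecOn with
  | zero => rw [rowPre_zero]; exact zero_le
  | add_one κ ih =>
    rw [rowPre_add_one]
    unfold Row.cycle
    rcases Row.advance_eq ((rowPre d dg κ).norm d) dg (leftOf ((rowPre d dg κ).norm d).h) with
      e | ⟨w, m, n, e⟩ <;> rw [e]
    · exact ih
    · exact (Ordinal.natCast_lt_omega0 n).le
  | limit μ hμ ih =>
    rw [rowPre_limit d dg hμ]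
    refine le_of_forall_lt fun ξ hξ => ?_
    rw [lt_liminf_Iio_iff hμ.bot_lt (f := fun t => (rowPre d dg t).q) ih] at hξ
    obtain ⟨t, ht, h⟩ := hξ
    exact (h t le_rfl ht).trans_le (ih t ht)

/-- The rows at time `κ` of which the first `c` rows already have been changed. -/
noncomputable def rows (d : Ordinal.{u}) (tab : ℕ → ℕ → Instr → Prop) (κ : Ordinal.{u}) (c : ℕ) :
    ℕ → Row.{u} :=
  fun y => if y < c then rowPre d (tab y) (κ + 1) else rowPre d (tab y) κ

theorem rows_add_one (d : Ordinal.{u}) (tab : ℕ → ℕ → Instr → Prop) (κ : Ordinal.{u}) (c : ℕ) :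
    rows d tab κ (c + 1) =
      Function.update (rows d tab κ c) c ((rows d tab κ c c).cycle d (tab c)) := by
  funext y
  by_cases h : y = c
  · subst h
    simp [rows, rowPre_add_one]
  · rcases lt_or_gt_of_ne h with h' | h'
    · simp [rows, h, h', Nat.lt_succ_of_lt h']
    · have : ¬ y < c + 1 := by omega
      simp [rows, h, this, h'.not_gt]

/-- The record at the beginning of the work on row `c` in round `κ`. -/
noncomputable def beginRec (d : Ordinal.{u}) (tab : ℕ → ℕ → Instr → Prop) (κ : Ordinal.{u})
    (c : ℕ) : Rec.{u} := Rec.begin (rows d tab κ c) c (tab c)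

/-- The tapes in round `κ`: at the beginning, and before and after the test of each row. -/
noncomputable def roundTape (d : Ordinal.{u}) (tab : ℕ → ℕ → Instr → Prop) (κ : Ordinal.{u}) :
    ℕ → layout.Tape d
  | 0 => pre d (rows d tab κ 0) (κ ≠ 0)
  | n + 1 => if Even n then enc d ((beginRec d tab κ (n / 2)).pred d)
      else enc d (beginRec d tab κ (n / 2 + 1))

theorem roundTape_odd (d : Ordinal.{u}) (tab : ℕ → ℕ → Instr → Prop) (κ : Ordinal.{u}) (c : ℕ) :
    roundTape d tab κ (2 * c + 1) = enc d ((beginRec d tab κ c).pred d) := by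
  simp [roundTape]

theorem roundTape_even (d : Ordinal.{u}) (tab : ℕ → ℕ → Instr → Prop) (κ : Ordinal.{u}) (c : ℕ) :
    roundTape d tab κ (2 * c + 2) = enc d (beginRec d tab κ (c + 1)) := by
  have h : ¬ Even (2 * c + 1) := by simp
  simp only [roundTape, h, if_false]
  congr 2
  omega

theorem rows_h_le (hd : IsSuccLimit d) (tab : ℕ → ℕ → Instr → Prop) (κ : Ordinal.{u}) (c y : ℕ) :
    (rows d tab κ c y).h ≤ d := by
  unfold rows
  split_ifs <;> exact rowPre_h_le hd _ _

/-- Each tape of a round leads to the next one. -/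
theorem reach_roundTape (hd : IsSuccLimit d) {tab : ℕ → ℕ → Instr → Prop}
    (htab : tab 0 = fun _ _ => False) (κ : Ordinal.{u}) (n : ℕ)
    (hodd : ∀ c, n = 2 * c + 1 → Reach (Λ := layout) (Prog.root par) tail
      (enc d ((beginRec d tab κ c).pred d)) (enc d (beginRec d tab κ (c + 1)))) :
    Reach (Λ := layout) (Prog.root par) tail (roundTape d tab κ n) (roundTape d tab κ (n + 1)) := by
  have hd0 : 0 < d := hd.bot_lt
  have hbp : ∀ c, Reach (Λ := layout) (Prog.root par) tail (enc d (beginRec d tab κ c))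
      (enc d ((beginRec d tab κ c).pred d)) := fun c =>
    reach_begin_pred hd0 (rows_h_le hd _ _ _ _) fun _ => hd.isSuccPrelimit
  rcases n with _ | n
  · have e : Rec.start (rows d tab κ 0) = beginRec d tab κ 0 := by
      simp only [beginRec, Rec.begin, Rec.start, htab]
    have h1 := reach_init (par := par) (tail := tail) hd0 (rows d tab κ 0) (κ ≠ 0)
    rw [e] at h1
    have h2 := hbp 0
    rw [← roundTape_odd] at h2
    refine h1.trans h2 ?_
    intro x y t h h'
    have h'' : enc d ((beginRec d tab κ 0).pred d) x y t := by
      rw [← roundTape_odd]; exact h'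
    rcases t with o | _ | _
    · rcases o with k | _ | _ | _ | ρ | _ | _ | _ | _ | _ | _ | _ | _ | _
      case lim => exact h.2
      case even => exact h.2
      case X | H | Q => exact h
      all_goals exact h.elim
    · exact h.elim
    · exact h.elim
  · rcases Nat.even_or_odd' n with ⟨c, rfl | rfl⟩
    · rw [roundTape_odd, roundTape_even]
      exact hodd c rfl
    · rw [roundTape_even]
      have := roundTape_odd d tab κ (c + 1)
      rw [show 2 * (c + 1) + 1 = 2 * c + 1 + 1 + 1 by ring] at this
      rw [this]
      exact hbp (c + 1)

/-- The sequence of the tapes in all rounds. -/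
noncomputable def allTape (d : Ordinal.{u}) (tab : ℕ → ℕ → Instr → Prop) (j : Ordinal.{u}) :
    layout.Tape d :=
  roundTape d tab (j / Ordinal.omega0) (index (j % Ordinal.omega0))

theorem allTape_mul_add (d : Ordinal.{u}) (tab : ℕ → ℕ → Instr → Prop) (κ : Ordinal.{u}) (n : ℕ) :
    allTape d tab (Ordinal.omega0 * κ + n) = roundTape d tab κ n := by
  have h := Ordinal.natCast_lt_omega0 n
  unfold allTape
  rw [Ordinal.mul_add_div _ Ordinal.omega0_ne_zero, Ordinal.div_eq_zero_of_lt h, add_zero,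
    Ordinal.mul_add_mod_self, Ordinal.mod_eq_of_lt h, index_natCast]

theorem allTape_zero (d : Ordinal.{u}) (tab : ℕ → ℕ → Instr → Prop) :
    allTape d tab 0 = fun _ _ _ => False := by
  have h := allTape_mul_add d tab 0 0
  rw [mul_zero, Nat.cast_zero, add_zero] at h
  rw [h]
  funext x y t
  rcases t with o | _ | _ <;> try rfl
  rcases o with k | _ | _ | _ | ρ | _ | _ | _ | _ | _ | _ | _ | _ | _ <;> try rfl
  all_goals simp [roundTape, pre, rows, rowPre_zero]

/-- The contents of the tracks of the simulated machines. -/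
theorem roundTape_row (d : Ordinal.{u}) (tab : ℕ → ℕ → Instr → Prop) (κ : Ordinal.{u}) (n y : ℕ) :
    ∃ R : Row.{u}, (∀ x : Set.Iio d, (∀ k, roundTape d tab κ n x y (base (X k)) ↔ R.X k x) ∧
        (roundTape d tab κ n x y (base H) ↔ x.1 < R.h) ∧
        (roundTape d tab κ n x y (base Q) ↔ x.1 < R.q)) ∧
      (R = rowPre d (tab y) κ ∨ R = (rowPre d (tab y) κ).norm d ∨ R = rowPre d (tab y) (κ + 1)) ∧
      (n = 2 * y + 1 → R = (rowPre d (tab y) κ).norm d) ∧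
      (2 * y + 1 < n → R = rowPre d (tab y) (κ + 1)) := by
  rcases n with _ | n
  · refine ⟨rowPre d (tab y) κ, fun x => ?_, .inl rfl, by omega, by omega⟩
    simp [roundTape, pre, rows]
  · rcases Nat.even_or_odd' n with ⟨c, rfl | rfl⟩
    · rw [roundTape_odd]
      refine ⟨((beginRec d tab κ c).pred d).D y, fun x => by simp [enc], ?_⟩
      rcases lt_trichotomy y c with h | rfl | h
      · have : ((beginRec d tab κ c).pred d).D y = rowPre d (tab y) (κ + 1) := by
          simp [beginRec, Rec.pred, Rec.begin, Rec.start, rows, h, h.ne]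
        exact ⟨.inr (.inr this), by omega, fun _ => this⟩
      · have : ((beginRec d tab κ y).pred d).D y = (rowPre d (tab y) κ).norm d := by
          simp [beginRec, Rec.pred, Rec.begin, Rec.start, rows]
        exact ⟨.inr (.inl this), fun _ => this, by omega⟩
      · have : ((beginRec d tab κ c).pred d).D y = rowPre d (tab y) κ := by
          simp [beginRec, Rec.pred, Rec.begin, Rec.start, rows, h.ne', h.not_gt]
        exact ⟨.inl this, by omega, by omega⟩
    · rw [roundTape_even]
      refine ⟨(beginRec d tab κ (c + 1)).D y, fun x => by simp [enc], ?_⟩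
      rcases lt_or_ge y (c + 1) with h | h
      · have : (beginRec d tab κ (c + 1)).D y = rowPre d (tab y) (κ + 1) := by
          simp [beginRec, Rec.begin, Rec.start, rows, h]
        exact ⟨.inr (.inr this), by omega, fun _ => this⟩
      · have : (beginRec d tab κ (c + 1)).D y = rowPre d (tab y) κ := by
          simp [beginRec, Rec.begin, Rec.start, rows, h.not_gt]
        exact ⟨.inl this, by omega, by omega⟩

/-- The contents of the other tracks. -/
theorem roundTape_control (d : Ordinal.{u}) (tab : ℕ → ℕ → Instr → Prop) (κ : Ordinal.{u})
    {n y : ℕ} (x : Set.Iio d) (hn : 2 * y + 2 < n ∨ n = 0) (t : Track)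
    (hX : ∀ k, t ≠ base (X k)) (hH : t ≠ base H) (hQ : t ≠ base Q)
    (hl : t ≠ base lim) (he : t ≠ base even) : ¬ roundTape d tab κ n x y t := by
  rcases n with _ | n
  · rcases t with o | _ | _ <;> try exact id
    rcases o with k | _ | _ | _ | ρ | _ | _ | _ | _ | _ | _ | _ | _ | _ <;>
      first | exact id | simp_all
  · rcases Nat.even_or_odd' n with ⟨c, rfl | rfl⟩
    · rw [roundTape_odd]
      have : y ≠ c := by omega
      rcases t with o | _ | _
      · rcases o with k | _ | _ | _ | ρ | _ | _ | _ | _ | _ | _ | _ | _ | _ <;>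
          first
          | exact absurd rfl ‹_›
          | exact absurd rfl (hX _)
          | simp [enc, beginRec, Rec.pred, Rec.begin, Rec.start, this]
      · simp [enc, beginRec, Rec.pred, Rec.begin, Rec.start]
      · simp [enc, beginRec, Rec.pred, Rec.begin, Rec.start]
    · rw [roundTape_even]
      have : y ≠ c + 1 := by omega
      rcases t with o | _ | _
      · rcases o with k | _ | _ | _ | ρ | _ | _ | _ | _ | _ | _ | _ | _ | _ <;>
          first
          | exact absurd rfl ‹_›
          | exact absurd rfl (hX _)
          | simp [enc, beginRec, Rec.begin, Rec.start, this]
      · simp [enc, beginRec, Rec.begin, Rec.start]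
      · simp [enc, beginRec, Rec.begin, Rec.start]

end ITTM

namespace ITTM

open Track Base

variable {d : Ordinal.{u}} {par : Par} {tail : List Move}

/-- A bit of a row of the simulated machines at the end of a sequence of rounds. -/
theorem row_bit_limit {dg : ℕ → Instr → Prop} {κ : Ordinal.{u}} (hκ : κ ≠ 0) {y : ℕ}
    {f : Row.{u} → Prop} {b : Ordinal.{u} → Prop} (hf : ∀ R : Row.{u}, f (R.norm d) → f R)
    (hlim : IsSuccLimit κ →
      (f (rowPre d dg κ) ↔ EvBelow κ fun κ' => f ((rowPre d dg κ').norm d)))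
    (hb : ∀ κ' : Ordinal.{u}, ∀ n : ℕ, ∃ R : Row.{u}, (b (Ordinal.omega0 * κ' + n) ↔ f R) ∧
      (R = rowPre d dg κ' ∨ R = (rowPre d dg κ').norm d ∨ R = rowPre d dg (κ' + 1)) ∧
      (n = 2 * y + 1 → R = (rowPre d dg κ').norm d) ∧
      (2 * y + 1 < n → R = rowPre d dg (κ' + 1))) :
    f (rowPre d dg κ) ↔ EvBelow (Ordinal.omega0 * κ) b := by
  have hω : (Ordinal.omega0 : Ordinal.{u}) ≠ 0 := Ordinal.omega0_ne_zero
  rcases Ordinal.zero_or_succ_or_isSuccLimit κ with h | ⟨κ', h⟩ | h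
  · exact absurd h hκ
  · have h : κ = κ' + 1 := h.symm
    subst h
    have hv : ∀ j, Ordinal.omega0 * κ' + (2 * y + 2 : ℕ) ≤ j → j < Ordinal.omega0 * (κ' + 1) →
        (b j ↔ f (rowPre d dg (κ' + 1))) := by
      intro j h1 h2
      obtain ⟨ζ, rfl⟩ := exists_add_of_le (le_self_add.trans h1)
      rw [mul_add, mul_one] at h2
      obtain ⟨n, rfl⟩ := Ordinal.lt_omega0.1 (lt_of_add_lt_add_left h2)
      have hn : 2 * y + 2 ≤ n := by exact_mod_cast le_of_add_le_add_left h1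
      obtain ⟨R, hR, -, -, h3⟩ := hb κ' n
      rw [hR, h3 (by omega)]
    have hlt : Ordinal.omega0 * κ' + (2 * y + 2 : ℕ) < Ordinal.omega0 * (κ' + 1) := by
      rw [mul_add, mul_one]
      exact add_lt_add_right (Ordinal.natCast_lt_omega0 _) _
    constructor
    · exact fun h => ⟨_, hlt, fun j h1 h2 => (hv j h1 h2).2 h⟩
    · rintro ⟨t, ht, h⟩
      exact (hv _ (le_max_right t _) (max_lt ht hlt)).1 (h _ (le_max_left _ _) (max_lt ht hlt))
  · rw [hlim h]
    constructor
    · rintro ⟨κ₀, h0, hP⟩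
      refine ⟨Ordinal.omega0 * κ₀, (mul_lt_mul_iff_right₀ Ordinal.omega0_pos).2 h0,
          fun j h1 h2 => ?_⟩
      rw [eq_mul_add j] at h1 h2 ⊢
      set n := finPart j
      set κ' := j / Ordinal.omega0
      have hκ' : κ' < κ := by
        by_contra hle
        exact (h2.trans_le ((mul_le_mul_right (not_lt.1 hle) _).trans le_self_add)).false
      have hκ0 : κ₀ ≤ κ' := by
        by_contra hle
        refine (h1.trans_lt ((mul_add_lt_mul_add (x' := κ₀) (y' := 0)).2
            (.inl (not_le.1 hle)))).ne ?_
        simp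
      obtain ⟨R, hR, h3, -⟩ := hb κ' n
      refine hR.2 ?_
      rcases h3 with rfl | rfl | rfl
      · exact hf _ (hP _ hκ0 hκ')
      · exact hP _ hκ0 hκ'
      · exact hf _ (hP _ (hκ0.trans le_self_add) (h.add_one_lt hκ'))
    · rintro ⟨t, ht, hP⟩
      refine ⟨t / Ordinal.omega0 + 1, h.add_one_lt ((Ordinal.lt_mul_iff_div_lt hω).1 ht),
        fun κ' h1 h2 => ?_⟩
      obtain ⟨R, hR, -, h3, -⟩ := hb κ' (2 * y + 1)
      rw [← h3 rfl, ← hR]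
      refine hP _ ?_ (mul_add_lt_mul h2 _)
      conv_lhs => rw [eq_mul_add t]
      exact (mul_add_lt_mul_add.2 (.inl (Order.add_one_le_iff.1 h1))).le

/-- The tapes of the rounds behave continuously. The tracks of the control vanish in the limit,
since the current row moves on; for the other tracks, the limit of the rounds is the limit of the
simulated machines. -/
theorem allTape_limit (hd : IsSuccLimit d) (tab : ℕ → ℕ → Instr → Prop) {μ : Ordinal.{u}}
    (hμ : IsSuccLimit μ) (x : Set.Iio d) (y : ℕ) (t : Track) :
    allTape d tab μ x y t ↔ EvBelow μ fun j => allTape d tab j x y t := by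
  obtain ⟨κ, rfl⟩ := Ordinal.isSuccPrelimit_iff_omega0_dvd.1 hμ.isSuccPrelimit
  have hκ : κ ≠ 0 := by
    rintro rfl
    simp at hμ
  have hμ0 := hμ.bot_lt
  have hκ0 : allTape d tab (Ordinal.omega0 * κ) = roundTape d tab κ 0 := by
    simpa using allTape_mul_add d tab κ 0
  rw [hκ0]
  -- The tracks which belong to the current row: they are empty in row `y` late in each round.
  have hcontrol : (∀ k, t ≠ base (X k)) → t ≠ base H → t ≠ base Q → t ≠ base lim →
      t ≠ base even → (roundTape d tab κ 0 x y t ↔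
        EvBelow (Ordinal.omega0 * κ) fun j => allTape d tab j x y t) := by
    intro h1 h2 h3 h4 h5
    refine iff_of_false (roundTape_control d tab κ x (.inr rfl) t h1 h2 h3 h4 h5) ?_
    rintro ⟨j, hj, h⟩
    have hlt : j + (2 * y + 3 : ℕ) < Ordinal.omega0 * κ := by
      rw [eq_mul_add j, add_assoc, ← Nat.cast_add]
      exact mul_add_lt_mul ((Ordinal.lt_mul_iff_div_lt Ordinal.omega0_ne_zero).1 hj) _
    have := h _ le_self_add hlt
    rw [eq_mul_add j, add_assoc, ← Nat.cast_add, allTape_mul_add] at this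
    exact roundTape_control d tab _ x (.inl (by omega)) t h1 h2 h3 h4 h5 this
  -- The marks which are constant after the very first cycle.
  have hmark : ∀ P : Prop, (roundTape d tab κ 0 x y t ↔ P) →
      (∀ κ' n, κ' ≠ 0 ∨ n ≠ 0 → (roundTape d tab κ' n x y t ↔ P)) →
      (roundTape d tab κ 0 x y t ↔ EvBelow (Ordinal.omega0 * κ)
          fun j => allTape d tab j x y t) := by
    intro P h0 h
    have hv : ∀ j, 0 < j → (allTape d tab j x y t ↔ P) := by
      intro j hj
      rw [eq_mul_add j, allTape_mul_add]
      refine h _ _ ?_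
      by_contra hne
      push Not at hne
      rw [eq_mul_add j, hne.1, hne.2] at hj
      simp at hj
    rw [h0]
    have h1 : (1 : Ordinal.{u}) < Ordinal.omega0 * κ := by
      simpa using hμ.add_one_lt hμ0
    constructor
    · exact fun hP => ⟨1, h1, fun j h1 _ => (hv j (one_pos.trans_le h1)).2 hP⟩
    · rintro ⟨j, hj, h⟩
      exact (hv _ (one_pos.trans_le (le_max_right j 1))).1 (h _ (le_max_left _ _) (max_lt hj h1))
  -- The tracks which describe the simulated machine of row `y`.
  have hrow : ∀ f : Row.{u} → Prop, (roundTape d tab κ 0 x y t ↔ f (rowPre d (tab y) κ)) →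
      (∀ R : Row.{u}, f (R.norm d) → f R) →
      (IsSuccLimit κ →
        (f (rowPre d (tab y) κ) ↔ EvBelow κ fun κ' => f ((rowPre d (tab y) κ').norm d))) →
      (∀ κ' n R, (∀ x : Set.Iio d, (∀ k, roundTape d tab κ' n x y (base (X k)) ↔ R.X k x) ∧
        (roundTape d tab κ' n x y (base H) ↔ x.1 < R.h) ∧
        (roundTape d tab κ' n x y (base Q) ↔ x.1 < R.q)) → (roundTape d tab κ' n x y t ↔ f R)) →
      (roundTape d tab κ 0 x y t ↔
        EvBelow (Ordinal.omega0 * κ) fun j => allTape d tab j x y t) := by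
    intro f h0 h1 h2 h3
    rw [h0]
    refine row_bit_limit (y := y) hκ h1 h2 fun κ' n => ?_
    obtain ⟨R, hR, h4⟩ := roundTape_row d tab κ' n y
    refine ⟨R, ?_, h4⟩
    rw [allTape_mul_add]
    exact h3 κ' n R hR
  have hr0 : rows d tab κ 0 y = rowPre d (tab y) κ := by simp [rows]
  rcases t with o | i | i
  · rcases o with k | _ | _ | b | ρ | _ | _ | _ | _ | _ | _ | _ | _ | _
    case X =>
      refine hrow (fun R => R.X k x) ?_ (fun R h => h) (fun h => ?_) (fun κ' n R h => (h x).1 k)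
      · simp [roundTape, pre, hr0]
      · rw [rowPre_limit d _ h]
        exact Iff.rfl
    case H =>
      refine hrow (fun R => x.1 < R.h) ?_ (fun R h => ?_) (fun h => ?_) (fun κ' n R h => (h x).2.1)
      · simp [roundTape, pre, hr0]
      · refine h.trans_le ?_
        unfold Row.norm
        simp only
        split_ifs
        · exact le_rfl
        · exact zero_le
      · rw [rowPre_limit d _ h]
        exact lt_liminf_Iio_iff h.bot_lt (f := fun t => ((rowPre d (tab y) t).norm d).h)
          (fun t _ => (Row.norm_h_lt hd.bot_lt _).le) _
    case Q =>
      refine hrow (fun R => x.1 < R.q) ?_ (fun R h => h) (fun h => ?_) (fun κ' n R h => (h x).2.2)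
      · simp [roundTape, pre, hr0]
      · rw [rowPre_limit d _ h]
        exact lt_liminf_Iio_iff h.bot_lt (f := fun t => (rowPre d (tab y) t).q)
          (fun t _ => rowPre_q_le d _ _) _
    case lim =>
      refine hmark (y = 0) (by simp [roundTape, pre, hκ]) fun κ' n h => ?_
      rcases n with _ | n
      · simp [roundTape, pre, h.resolve_right (by simp)]
      · rcases Nat.even_or_odd' n with ⟨c, rfl | rfl⟩
        · rw [roundTape_odd]; rfl
        · rw [roundTape_even]; rfl
    case even =>
      refine hmark (Even y) (by simp [roundTape, pre, hκ]) fun κ' n h => ?_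
      rcases n with _ | n
      · simp [roundTape, pre, h.resolve_right (by simp)]
      · rcases Nat.even_or_odd' n with ⟨c, rfl | rfl⟩
        · rw [roundTape_odd]; rfl
        · rw [roundTape_even]; rfl
    all_goals exact hcontrol (by simp) (by simp) (by simp) (by simp) (by simp)
  · exact hcontrol (by simp) (by simp) (by simp) (by simp) (by simp)
  · exact hcontrol (by simp) (by simp) (by simp) (by simp) (by simp)

/-- The universal machine runs through all rounds, as long as no test makes it halt. -/
theorem reach_allTape (hd : IsSuccLimit d) {tab : ℕ → ℕ → Instr → Prop}
    (htab : tab 0 = fun _ _ => False) {J : Ordinal.{u}} (hJ : 0 < J)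
    (hodd : ∀ κ c, Ordinal.omega0 * κ + (2 * c + 1 : ℕ) < J →
      Reach (Λ := layout) (Prog.root par) tail
        (enc d ((beginRec d tab κ c).pred d)) (enc d (beginRec d tab κ (c + 1)))) :
    Reach (Λ := layout) (Prog.root par) tail (fun _ _ _ => False) (allTape d tab J) := by
  rw [← allTape_zero d tab]
  refine Reach.chain hJ (fun j hj => ?_) (fun μ _ hμ x y t => allTape_limit hd tab hμ x y t) ?_
  · have e : j + 1 = Ordinal.omega0 * (j / Ordinal.omega0) + (finPart j + 1 : ℕ) := by
      conv_lhs => rw [eq_mul_add j]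
      rw [add_assoc, Nat.cast_succ]
    rw [e, allTape_mul_add]
    rw [eq_mul_add j] at hj
    conv =>
      arg 3
      rw [eq_mul_add j, allTape_mul_add]
    refine reach_roundTape hd htab _ _ fun c hc => hodd _ c ?_
    rwa [hc] at hj
  · rw [allTape_zero]
    exact fun _ _ _ _ _ h => h.elim

end ITTM

namespace ITTM

/-! ### The enumeration of all tables -/

theorem one_lt_digitBase : 1 < digitBase := by
  unfold digitBase
  rw [Finite.one_lt_card_iff_nontrivial]
  infer_instance

/-- The table with number `y`: its digits are those of `y` with respect to `digitBase`. -/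
noncomputable def table (y n : ℕ) : Instr → Prop := digit (y / digitBase ^ n)

theorem digit_mod (n : ℕ) : digit (n % digitBase) = digit n := by
  unfold digit
  simp

theorem digitEquiv_table (y n : ℕ) :
    (digitEquiv (table y n) : ℕ) = y / digitBase ^ n % digitBase := by
  unfold table
  rw [← digit_mod, digitEquiv_digit (Nat.mod_lt _ digitBase_pos)]

theorem table_zero : table 0 = fun _ _ => False := by
  funext n
  simp [table, digit_zero]

theorem exists_table_lt (y : ℕ) : ∃ n, (digitEquiv (table y n) : ℕ) + 1 < digitBase := by
  refine ⟨y, ?_⟩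
  rw [digitEquiv_table, Nat.div_eq_of_lt (Nat.lt_pow_self one_lt_digitBase), Nat.zero_mod]
  exact one_lt_digitBase

/-- The table of the next number arises by the usual addition of one with carry. -/
theorem succDigits_table (y : ℕ) : succDigits (table y) = table (y + 1) := by
  set B := digitBase with hB
  have hB1 : 1 < B := one_lt_digitBase
  have hB0 : 0 < B := digitBase_pos
  set p := firstDigit (table y) with hp
  have hp1 : y / B ^ p % B + 1 < B := by
    have := Nat.sInf_mem (s := {n | (digitEquiv (table y n) : ℕ) + 1 < digitBase})
        (exists_table_lt y)
    change (digitEquiv (table y p) : ℕ) + 1 < digitBase at this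
    rwa [digitEquiv_table] at this
  have hlow : ∀ m < p, y / B ^ m % B + 1 = B := by
    intro m hm
    have := Nat.notMem_of_lt_sInf (s := {n | (digitEquiv (table y n) : ℕ) + 1 < digitBase}) hm
    change ¬ (digitEquiv (table y m) : ℕ) + 1 < digitBase at this
    rw [digitEquiv_table, ← hB] at this
    have := Nat.mod_lt (y / B ^ m) hB0
    omega
  have key : ∀ m ≤ p, y + 1 = B ^ m * (y / B ^ m + 1) := by
    intro m hm
    induction m with
    | zero => simp
    | succ m ih =>
      rw [ih (by omega)]
      have h1 := hlow m (by omega)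
      have h2 := Nat.div_add_mod (y / B ^ m) B
      rw [Nat.div_div_eq_div_mul, ← pow_succ] at h2
      have h3 : y / B ^ m + 1 = B * (y / B ^ (m + 1) + 1) := by
        rw [mul_add, mul_one]; omega
      rw [h3]
      ring
  have hy := key p le_rfl
  have hBp : ∀ m, 0 < B ^ m := fun m => pow_pos hB0 m
  funext n
  unfold succDigits
  rw [← hp]
  split_ifs with h1 h2
  · obtain ⟨k, hk⟩ := Nat.exists_eq_add_of_lt h1
    have : (y + 1) / B ^ n = B * (B ^ k * (y / B ^ p + 1)) := by
      rw [hy, hk, show B ^ (n + k + 1) * (y / B ^ (n + k + 1) + 1) =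
        B ^ n * (B * (B ^ k * (y / B ^ (n + k + 1) + 1))) by ring]
      exact Nat.mul_div_cancel_left _ (hBp n)
    rw [table, ← hB, this, ← digit_mod, ← hB, Nat.mul_mod_right, digit_zero]
  · rw [h2, digitEquiv_table, table, ← hB]
    have : (y + 1) / B ^ p = y / B ^ p + 1 := by
      conv_lhs => rw [hy]
      exact Nat.mul_div_cancel_left _ (hBp p)
    rw [this, ← digit_mod (y / B ^ p + 1), ← hB, Nat.add_mod, Nat.mod_eq_of_lt hB1,
      Nat.mod_eq_of_lt hp1]
  · obtain ⟨k, rfl⟩ := Nat.exists_eq_add_of_lt (lt_of_le_of_ne (not_lt.1 h1) (Ne.symm h2))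
    rw [table, table, ← hB]
    congr 1
    rw [show B ^ (p + k + 1) = B ^ p * (B * B ^ k) by ring, ← Nat.div_div_eq_div_mul,
      ← Nat.div_div_eq_div_mul, ← Nat.div_div_eq_div_mul, ← Nat.div_div_eq_div_mul]
    have : (y + 1) / B ^ p = y / B ^ p + 1 := by
      conv_lhs => rw [hy]
      exact Nat.mul_div_cancel_left _ (hBp p)
    rw [this]
    congr 1
    rw [Nat.succ_div_of_not_dvd]
    intro hdvd
    have := Nat.mod_eq_zero_of_dvd hdvd
    rw [Nat.add_mod, Nat.mod_eq_of_lt hB1, Nat.mod_eq_of_lt hp1] at this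
    omega

theorem exists_table {dg : ℕ → Instr → Prop} {N : ℕ} (h : ∀ n ≥ N, dg n = fun _ => False) :
    ∃ y, table y = dg := by
  induction N generalizing dg with
  | zero => exact ⟨0, by rw [table_zero]; funext n; exact (h n (Nat.zero_le _)).symm⟩
  | succ N ih =>
    obtain ⟨y, hy⟩ := ih (dg := fun n => dg (n + 1)) fun n hn => h _ (by omega)
    have hc := (digitEquiv (dg 0)).2
    refine ⟨digitBase * y + digitEquiv (dg 0), ?_⟩
    funext n
    rcases n with _ | n
    · rw [table, pow_zero, Nat.div_one, ← digit_mod, Nat.mul_add_mod, digit_mod, digit_digitEquiv]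
    · have : table y n = dg (n + 1) := congrFun hy n
      rw [← this, table, table, pow_succ', ← Nat.div_div_eq_div_mul, Nat.mul_add_div digitBase_pos,
        Nat.div_eq_of_lt hc, add_zero]

end ITTM

/-! ### Primitive recursively closed ordinals -/

/-- The recursion scheme defines a function. -/
theorem exists_setRecursion {n : ℕ} (G : (Fin (n + 2) → ZFSet.{u}) → ZFSet.{u}) :
    ∃ F : (Fin (n + 1) → ZFSet.{u}) → ZFSet.{u}, ∀ (z : ZFSet.{u}) (x : Fin n → ZFSet.{u}),
      F (Fin.cons z x) = G (Fin.cons (ZFSet.iUnion (fun w : {w // w ∈ z} => F (Fin.cons w.1 x)))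
        (Fin.cons z x)) := by
  let f : (Fin n → ZFSet.{u}) → ZFSet.{u} → ZFSet.{u} := fun x =>
    ZFSet.mem_wf.fix fun z ih =>
      G (Fin.cons (ZFSet.iUnion (fun w : {w // w ∈ z} => ih w.1 w.2)) (Fin.cons z x))
  refine ⟨fun y => f (Fin.tail y) (y 0), fun z x => ?_⟩
  simp only [Fin.tail_cons, Fin.cons_zero]
  exact ZFSet.mem_wf.fix_eq _ z

theorem iUnion_toZFSet (z : Ordinal.{u}) (F : ZFSet.{u} → ZFSet.{u})
    (f : Ordinal.{u} → Ordinal.{u}) (h : ∀ w < z, F w.toZFSet = (f w).toZFSet) :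
    ZFSet.iUnion (fun w : {w // w ∈ z.toZFSet} => F w.1) =
      (⨆ w : Set.Iio z, f w.1).toZFSet := by
  ext y
  rw [ZFSet.mem_iUnion, Ordinal.mem_toZFSet_iff]
  constructor
  · rintro ⟨⟨w, hw⟩, hy⟩
    obtain ⟨a, ha, rfl⟩ := Ordinal.mem_toZFSet_iff.1 hw
    simp only [h a ha] at hy
    obtain ⟨b, hb, rfl⟩ := Ordinal.mem_toZFSet_iff.1 hy
    exact ⟨b, hb.trans_le (Ordinal.le_iSup (fun w : Set.Iio z => f w.1) ⟨a, ha⟩), rfl⟩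
  · rintro ⟨b, hb, rfl⟩
    obtain ⟨⟨a, ha⟩, hb⟩ := (Ordinal.lt_iSup_iff).1 hb
    refine ⟨⟨a.toZFSet, Ordinal.toZFSet_mem_toZFSet_iff.2 ha⟩, ?_⟩
    simp only [h a ha]
    exact Ordinal.toZFSet_mem_toZFSet_iff.2 hb

namespace PrimRecSetFun

theorem comp₂ {n : ℕ} {G : (Fin 2 → ZFSet.{u}) → ZFSet.{u}}
    {H₀ H₁ : (Fin n → ZFSet.{u}) → ZFSet.{u}}
    (hG : PrimRecSetFun G) (h₀ : PrimRecSetFun H₀) (h₁ : PrimRecSetFun H₁) :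
    PrimRecSetFun fun x => G ![H₀ x, H₁ x] := by
  have := comp (H := ![H₀, H₁]) hG (fun i => by fin_cases i <;> assumption)
  convert this using 3 with x
  funext i
  fin_cases i <;> rfl

theorem comp₄ {n : ℕ} {G : (Fin 4 → ZFSet.{u}) → ZFSet.{u}}
    {H₀ H₁ H₂ H₃ : (Fin n → ZFSet.{u}) → ZFSet.{u}}
    (hG : PrimRecSetFun G) (h₀ : PrimRecSetFun H₀) (h₁ : PrimRecSetFun H₁)
    (h₂ : PrimRecSetFun H₂) (h₃ : PrimRecSetFun H₃) :
    PrimRecSetFun fun x => G ![H₀ x, H₁ x, H₂ x, H₃ x] := by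
  have := comp (H := ![H₀, H₁, H₂, H₃]) hG (fun i => by fin_cases i <;> assumption)
  convert this using 3 with x
  funext i
  fin_cases i <;> rfl

/-- The successor of a set. -/
theorem succ {n : ℕ} {H : (Fin n → ZFSet.{u}) → ZFSet.{u}} (h : PrimRecSetFun H) :
    PrimRecSetFun fun x => H x ∪ {H x} := comp₂ adjoin h h

theorem union_singleton_toZFSet (a : Ordinal.{u}) :
    a.toZFSet ∪ {a.toZFSet} = (a + 1).toZFSet := by
  rw [Ordinal.toZFSet_add_one]
  ext y
  simp [or_comm]

/-- There is a primitive recursive set function which extends `(z, x) ↦ x + z + 1`. -/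
theorem exists_add : ∃ A : (Fin 2 → ZFSet.{u}) → ZFSet.{u}, PrimRecSetFun A ∧
    ∀ z x : Ordinal.{u}, A ![z.toZFSet, x.toZFSet] = (x + z + 1).toZFSet := by
  classical
  -- At `z = 0` the union of the previous values is empty, and `x` has to be used instead.
  let T : (Fin 3 → ZFSet.{u}) → ZFSet.{u} := fun y => if (∅ : ZFSet.{u}) ∈ y 1 then y 0 else y 2
  have hT : PrimRecSetFun T := by
    convert comp₄ (n := 3) cond (proj 0) (proj 2) empty (proj 1) using 2
    exact if_congr Iff.rfl rfl rfl
  obtain ⟨A, hA⟩ := exists_setRecursion (n := 1) fun y => T y ∪ {T y}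
  refine ⟨A, recursion hT.succ hA, fun z x => ?_⟩
  have hc : ∀ z : ZFSet.{u}, ![z, x.toZFSet] = Fin.cons z ![x.toZFSet] := fun _ => rfl
  induction z using WellFoundedLT.induction with
  | _ z ih =>
    rw [hc, hA, iUnion_toZFSet z (fun w => A (Fin.cons w ![x.toZFSet])) (fun w => x + w + 1)
      (fun w hw => ih w hw)]
    have h : T (Fin.cons (⨆ w : Set.Iio z, (x + w.1 + 1)).toZFSet
        (Fin.cons z.toZFSet ![x.toZFSet])) = (x + z).toZFSet := by
      show (if (∅ : ZFSet.{u}) ∈ z.toZFSet then (⨆ w : Set.Iio z, (x + w.1 + 1)).toZFSet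
        else x.toZFSet) = _
      rw [← Ordinal.toZFSet_zero, Ordinal.toZFSet_mem_toZFSet_iff]
      split_ifs with h
      · congr 1
        refine eq_of_forall_lt_iff fun ξ => ?_
        rw [Ordinal.lt_iSup_iff]
        constructor
        · rintro ⟨w, hw⟩
          refine hw.trans_le ?_
          rw [add_assoc]
          exact add_le_add_right (Order.add_one_le_iff.2 w.2) _
        · intro hξ
          rcases lt_or_ge ξ x with h' | h'
          · exact ⟨⟨0, h⟩, by simpa using h'.trans (Order.lt_add_one_iff.2 le_rfl)⟩
          · obtain ⟨w, rfl⟩ := exists_add_of_le h'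
            exact ⟨⟨w, lt_of_add_lt_add_left hξ⟩, Order.lt_add_one_iff.2 le_rfl⟩
      · have : z = 0 := by simpa using h
        rw [this, add_zero]
    rw [h, union_singleton_toZFSet]

/-- There is a primitive recursive set function whose values at ordinals are ordinals, and bound
the product of ordinals. -/
theorem exists_mul : ∃ M : (Fin 2 → ZFSet.{u}) → ZFSet.{u}, PrimRecSetFun M ∧
    ∀ z x : Ordinal.{u}, ∃ m, M ![z.toZFSet, x.toZFSet] = m.toZFSet ∧ x * (z + 1) ≤ m := by
  obtain ⟨A, hA, hA'⟩ := exists_add.{u}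
  obtain ⟨M, hM⟩ := exists_setRecursion (n := 1) fun y => A ![y 2, y 0]
  refine ⟨M, recursion (comp₂ (n := 3) hA (proj 2) (proj 0)) hM, fun z x => ?_⟩
  have hc : ∀ z : ZFSet.{u}, ![z, x.toZFSet] = Fin.cons z ![x.toZFSet] := fun _ => rfl
  induction z using WellFoundedLT.induction with
  | _ z ih =>
    choose! f hf1 hf2 using ih
    refine ⟨(⨆ w : Set.Iio z, f w.1) + x + 1, ?_, ?_⟩
    · rw [hc, hM, iUnion_toZFSet z (fun w => M (Fin.cons w ![x.toZFSet])) f hf1]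
      exact hA' _ _
    · rw [mul_add, mul_one]
      refine (add_le_add_left (le_of_forall_lt fun ξ hξ => ?_) x).trans le_self_add
      rcases eq_or_ne x 0 with rfl | hx
      · simp at hξ
      · have hw := (Ordinal.lt_mul_iff_div_lt hx).1 hξ
        refine lt_of_lt_of_le ?_ ((hf2 _ hw).trans
          (Ordinal.le_iSup (fun w : Set.Iio z => f w.1) ⟨_, hw⟩))
        rw [Ordinal.lt_mul_iff_div_lt hx]
        exact Order.lt_add_one_iff.2 le_rfl

end PrimRecSetFun

namespace PrimRecClosed

variable {δ : Ordinal.{u}}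

theorem isSuccLimit (h : PrimRecClosed δ) : IsSuccLimit δ := by
  rw [Ordinal.isSuccLimit_iff, Order.isSuccPrelimit_iff_succ_lt]
  refine ⟨?_, fun a ha => ?_⟩
  · exact (h 0 _ PrimRecSetFun.empty Fin.elim0 0 (fun i => i.elim0) Ordinal.toZFSet_zero.symm).ne'
  · exact h 1 _ (PrimRecSetFun.succ (PrimRecSetFun.proj 0)) (fun _ => a) _ (fun _ => ha)
      (PrimRecSetFun.union_singleton_toZFSet a)

theorem omega0_mul_lt (h : PrimRecClosed δ) (hω : Ordinal.omega0 < δ) {ξ : Ordinal.{u}}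
    (hξ : ξ < δ) : Ordinal.omega0 * ξ < δ := by
  obtain ⟨M, hM, hM'⟩ := PrimRecSetFun.exists_mul.{u}
  obtain ⟨m, hm, hle⟩ := hM' ξ Ordinal.omega0
  have : m < δ := by
    refine h 2 M hM ![ξ, Ordinal.omega0] m (fun i => ?_) ?_
    · fin_cases i
      · exact hξ
      · exact hω
    · rw [← hm]
      congr 1
      funext i
      fin_cases i <;> rfl
  refine lt_of_le_of_lt ?_ (hle.trans_lt this)
  exact mul_le_mul_right (Order.lt_add_one_iff.2 le_rfl).le _

theorem omega0_mul_eq (h : PrimRecClosed δ) (hω : Ordinal.omega0 < δ) :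
    Ordinal.omega0 * δ = δ := by
  refine le_antisymm (le_of_forall_lt fun ξ hξ => ?_)
    (Ordinal.le_mul_right _ Ordinal.omega0_pos)
  obtain ⟨ζ, hζ, hξ⟩ := ((Ordinal.isNormal_mul_right Ordinal.omega0_pos).lt_iff_exists_lt
    h.isSuccLimit).1 hξ
  exact hξ.trans (h.omega0_mul_lt hω hζ)

end PrimRecClosed

namespace ITTM

/-! ### Programs as tables -/

/-- The code of a move in an instruction. -/
def Move.code : Move → Fin 3
  | .left => 0
  | .stay => 1
  | .right => 2

/-- The table of a program: the instructions for the pair of states `(q, q')` are the transitions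
from `q` to `q'`. -/
def Program.digits (p : Program) (n : ℕ) : Instr → Prop := fun b =>
  ∃ (q q' : Fin (p.last + 1)) (m : Move), n = Nat.pair q q' ∧
    p.next q b.1 = some (q', b.2.1, m) ∧ m.code = b.2.2

theorem Program.exists_table (p : Program) : ∃ y, table y = p.digits := by
  refine ITTM.exists_table (N := (p.last + 1) ^ 2) fun n hn => ?_
  funext b
  refine propext ⟨?_, False.elim⟩
  rintro ⟨q, q', m, rfl, -, -⟩
  have h := Nat.pair_lt_max_add_one_sq (q : ℕ) q'
  have h' : max (q : ℕ) q' + 1 ≤ p.last + 1 := by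
    have := q.2
    have := q'.2
    omega
  have := Nat.pow_le_pow_left h' 2
  omega

/-- The row `R` describes the configuration `c`. -/
structure Row.Describes {p : Program} (R : Row.{u}) (c : Config.{u} p) : Prop where
  X : ∀ k ξ, R.X k ξ ↔ c.tape k ξ = true
  h : R.h = c.head
  q : R.q = ((c.state : ℕ) : Ordinal.{u})

section

variable {p : Program} {R R' : Row.{u}} {c : Config.{u} p} {d : Ordinal.{u}}

theorem Row.Describes.symbols (h : R.Describes c) : R.symbols = c.read := by
  funext k
  simp only [Row.symbols, Config.read, h.X, h.h, Bool.decide_eq_true]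

theorem Row.tryAt_digits {left : Ordinal.{u}} {n : ℕ} (h : R.tryAt p.digits left n = some R') :
    ∃ (q q' : Fin (p.last + 1)) (w : Fin 3 → Bool) (m : Move), R.q = ((q : ℕ) : Ordinal.{u}) ∧
      p.next q R.symbols = some (q', w, m) ∧
      R' = R.exec w m.code ((q' : ℕ) : Ordinal.{u}) left := by
  unfold Row.tryAt Row.tryStep at h
  split_ifs at h with h1 h2
  · obtain ⟨q, q', m, rfl, hn, hm⟩ := h2.choose_spec
    rw [Nat.unpair_pair] at h h1
    refine ⟨q, q', _, m, h1, hn, ?_⟩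
    rw [hm]
    exact (Option.some_injective _ h).symm

theorem Row.tryAt_digits_ne_none {left : Ordinal.{u}} {q q' : Fin (p.last + 1)}
    {w : Fin 3 → Bool} {m : Move} (hq : R.q = ((q : ℕ) : Ordinal.{u}))
    (hn : p.next q R.symbols = some (q', w, m)) :
    R.tryAt p.digits left (Nat.pair q q') ≠ none := by
  unfold Row.tryAt Row.tryStep
  rw [Nat.unpair_pair, if_pos hq,
    dif_pos (show ∃ i, p.digits (Nat.pair q q') (R.symbols, i) from
      ⟨(w, m.code), q, q', m, rfl, hn, rfl⟩)]
  simp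

theorem Move.apply_eq {m : Move} {ξ : Ordinal.{u}} (hd : IsSuccLimit d) (hξ : ξ < d) :
    m.apply d ξ = if m.code = 0 then leftOf ξ else if m.code = 2 then ξ + 1 else ξ := by
  cases m
  · simp [Move.apply, Move.code, leftOf]
  · simp [Move.apply, Move.code]
  · simp [Move.apply, Move.code, hd.add_one_lt hξ]

/-- A step of the simulation is a step of the simulated program. -/
theorem Row.Describes.advance (hd : IsSuccLimit d) (h : R.Describes c) (hh : R.h < d) :
    (R.advance p.digits (leftOf R.h)).Describes (c.step d) := by
  classical
  unfold Row.advance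
  cases hn : p.next c.state c.read with
  | none =>
    have hs : c.step d = c := by unfold Config.step; rw [hn]
    rw [dif_neg, hs]
    · exact h
    · rintro ⟨n, hne⟩
      obtain ⟨R', hR'⟩ := Option.ne_none_iff_exists'.1 hne
      obtain ⟨q, q', w, m, hq, hn', -⟩ := Row.tryAt_digits hR'
      rw [h.q, Nat.cast_inj, Fin.val_inj] at hq
      rw [h.symbols, ← hq, hn] at hn'
      cases hn'
  | some x =>
    obtain ⟨q', w, m⟩ := x
    have hex : ∃ n, R.tryAt p.digits (leftOf R.h) n ≠ none :=
      ⟨_, Row.tryAt_digits_ne_none h.q (by rw [h.symbols]; exact hn)⟩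
    rw [dif_pos hex]
    obtain ⟨R', hR'⟩ := Option.ne_none_iff_exists'.1 (Nat.find_spec hex)
    rw [hR', Option.getD_some]
    obtain ⟨q, q₁, w₁, m₁, hq, hn', rfl⟩ := Row.tryAt_digits hR'
    rw [h.q, Nat.cast_inj, Fin.val_inj] at hq
    rw [h.symbols, ← hq, hn] at hn'
    cases hn'
    have hs : c.step d = ⟨q', m.apply d c.head,
        fun k ξ => if ξ = c.head then w k else c.tape k ξ⟩ := by
      unfold Config.step; rw [hn]
    rw [hs]
    refine ⟨fun k ξ => ?_, ?_, rfl⟩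
    · by_cases hξ : ξ = c.head <;> simp [Row.exec, h.h, hξ, h.X]
    · simp only [Row.exec, Move.apply_eq hd (h.h ▸ hh), h.h]

theorem bool_liminf_eq_true_iff {μ : Ordinal.{u}} (hμ : 0 < μ) (f : Ordinal.{u} → Bool) :
    Filter.liminf (fun n : Set.Iio μ => f n.1) Filter.atTop = true ↔
      EvBelow μ fun t => f t = true := by
  by_cases h : EvBelow μ fun t => f t = true
  · exact iff_of_true (liminf_Iio_eq_of_isGreatest hμ (h.mono fun t _ h => h.ge)
      (h.mono fun t _ h => h.le).cof) h
  · refine iff_of_false ?_ h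
    rw [not_evBelow] at h
    rw [liminf_Iio_eq_of_isGreatest (v := false) hμ (evBelow_of_forall hμ fun t _ => bot_le)
      (h.mono fun t _ h => (Bool.eq_false_of_not_eq_true h).le)]
    simp

theorem fin_liminf_cast {μ : Ordinal.{u}} (hμ : 0 < μ) {n : ℕ} (f : Ordinal.{u} → Fin (n + 1)) :
    Filter.liminf (fun t : Set.Iio μ => (((f t.1 : Fin (n + 1)) : ℕ) : Ordinal.{u})) Filter.atTop =
      (((Filter.liminf (fun t : Set.Iio μ => f t.1) Filter.atTop : Fin (n + 1)) : ℕ) :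
        Ordinal.{u}) := by
  obtain ⟨v, hv, hmax⟩ := Set.Finite.exists_maximal
    (Set.toFinite {a : Fin (n + 1) | EvBelow μ fun t => a ≤ f t})
    ⟨0, evBelow_of_forall hμ fun t _ => Fin.zero_le _⟩
  have hcof : CofBelow μ fun t => f t ≤ v := by
    by_contra hc
    have hev : EvBelow μ fun t => v < f t := by
      by_contra he
      exact hc ((not_evBelow.1 he).mono fun t _ h => not_lt.1 h)
    obtain ⟨t, ht, h⟩ := id hev
    have hlt : (v : ℕ) < f t := h t le_rfl ht
    have h2 := (f t).2
    have : (⟨v + 1, by omega⟩ : Fin (n + 1)) ≤ v :=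
      hmax (hev.mono fun t _ h => Fin.le_def.2 (Nat.succ_le_of_lt h))
        (Fin.le_def.2 (Nat.le_succ _))
    have := Fin.le_def.1 this
    simp at this
  rw [liminf_Iio_eq_of_isGreatest hμ hv hcof]
  exact liminf_Iio_eq_of_isGreatest hμ
    (f := fun t => (((f t : Fin (n + 1)) : ℕ) : Ordinal.{u}))
    (EvBelow.mono hv fun t _ h => Nat.cast_le.2 (Fin.le_def.1 h))
    (hcof.mono fun t _ h => Nat.cast_le.2 (Fin.le_def.1 h))

theorem Row.norm_of_lt (h : R.h < d) : R.norm d = R := by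
  unfold Row.norm
  rw [if_pos h]

/-- The simulation of a program is faithful. -/
theorem describes_run (hd : IsSuccLimit d) (p : Program) (κ : Ordinal.{u}) :
    ((rowPre d p.digits κ).norm d).Describes (run d p κ) := by
  induction κ using Ordinal.limitRecOn with
  | zero =>
    rw [rowPre_zero, run_eq_runFrom, runFrom_zero, Row.norm_of_lt hd.bot_lt]
    exact ⟨by simp [Config.init], rfl, by simp [Config.init]⟩
  | add_one κ ih =>
    rw [rowPre_add_one, run_eq_runFrom, runFrom_add_one, ← run_eq_runFrom,
      Row.norm_of_lt (Row.cycle_h_lt hd _ _)]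
    exact ih.advance hd (Row.norm_h_lt hd.bot_lt _)
  | limit μ hμ ih =>
    have hμ0 : 0 < μ := hμ.bot_lt
    rw [rowPre_limit d p.digits hμ, run_eq_runFrom, runFrom_limit _ _ hμ]
    refine ⟨fun k ξ => ?_, ?_, ?_⟩
    · refine Iff.trans ?_ (bool_liminf_eq_true_iff hμ0 fun t => (run d p t).tape k ξ).symm
      exact ⟨fun h => h.mono fun t ht h => ((ih t ht).X k ξ).1 h,
        fun h => h.mono fun t ht h => ((ih t ht).X k ξ).2 h⟩
    · have : (fun t : Set.Iio μ => ((rowPre d p.digits t.1).norm d).h) =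
          fun t : Set.Iio μ => (run d p t.1).head := funext fun t => (ih t.1 t.2).h
      unfold Row.norm at this
      simp only at this
      unfold Row.norm Config.limit
      simp only [this]
      rfl
    · have : (fun t : Set.Iio μ => (rowPre d p.digits t.1).q) =
          fun t : Set.Iio μ => (((run d p t.1).state : ℕ) : Ordinal.{u}) :=
        funext fun t => (ih t.1 t.2).q
      simp only [Row.norm, Config.limit]
      rw [this]
      exact fin_liminf_cast hμ0 fun t => (run d p t).state

end

end ITTM

namespace ITTM

/-! ### Coded wellorders -/

section

variable {r : ℕ → ℕ → Prop} [IsWellOrder ℕ r]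

variable (r) in
/-- The rank of a number in a wellorder of the natural numbers. -/
noncomputable def rankIn (n : ℕ) : Ordinal.{u} := Ordinal.lift.{u} (Ordinal.typein r n)

theorem rankIn_lt_rankIn {m n : ℕ} : rankIn.{u} r m < rankIn r n ↔ r m n := by
  unfold rankIn
  rw [Ordinal.lift_lt, Ordinal.typein_lt_typein]

theorem rankIn_lt (n : ℕ) : rankIn.{u} r n < Ordinal.lift.{u} (Ordinal.type r) := by
  unfold rankIn
  rw [Ordinal.lift_lt]
  exact Ordinal.typein_lt_type r n

theorem exists_rankIn_eq {ξ : Ordinal.{u}} (h : ξ < Ordinal.lift.{u} (Ordinal.type r)) :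
    ∃ n, rankIn r n = ξ := by
  obtain ⟨ζ, rfl⟩ := Ordinal.mem_range_lift_of_le h.le
  rw [Ordinal.lift_lt] at h
  obtain ⟨n, rfl⟩ := Ordinal.typein_surj r h
  exact ⟨n, rfl⟩

theorem exists_rankIn_eq_of_lt {ξ : Ordinal.{u}} {n : ℕ} (h : ξ < rankIn r n) :
    ∃ m, rankIn r m = ξ ∧ r m n := by
  obtain ⟨m, rfl⟩ := exists_rankIn_eq (h.trans (rankIn_lt n))
  exact ⟨m, rfl, rankIn_lt_rankIn.1 h⟩

/-- In a wellorder, the rank is the order type of the initial segment. -/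
theorem rankLT_iff_rankIn_lt {β : Ordinal.{u}} {n : ℕ} : rankLT r β n ↔ rankIn r n < β := by
  induction β using WellFoundedLT.induction generalizing n with
  | _ β ih =>
    rw [rankLT_iff]
    constructor
    · rintro ⟨γ, hγ, h⟩
      refine lt_of_le_of_lt (le_of_forall_lt fun ξ hξ => ?_) hγ
      obtain ⟨m, rfl, hm⟩ := exists_rankIn_eq_of_lt hξ
      exact (ih γ hγ).1 (h m hm)
    · exact fun h => ⟨_, h, fun m hm => (ih _ h).2 (rankIn_lt_rankIn.2 hm)⟩

end

/-- A relation which compares the values of an injective function to `δ` codes `δ`, if `δ` embeds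
into its range. -/
theorem codesWellOrder_of_place {t : Ordinal.{u} → Bool} {δ : Ordinal.{u}} {f : ℕ → Ordinal.{u}}
    (ht : ∀ m n, codedRel t m n ↔ f m < f n) (hf : Function.Injective f) (hδ : ∀ n, f n < δ)
    (g : Ordinal.{u} → ℕ) (hg : ∀ ξ ξ', ξ < ξ' → ξ' < δ → f (g ξ) < f (g ξ')) :
    CodesWellOrder t δ := by
  have hwo : IsWellOrder ℕ (codedRel t) :=
    RelEmbedding.isWellOrder (s := (· < · : Ordinal.{u} → Ordinal.{u} → Prop))
      ⟨⟨f, hf⟩, fun {m n} => (ht m n).symm⟩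
  refine ⟨hwo, le_antisymm (le_of_forall_lt fun ξ hξ => ?_) (le_of_forall_lt fun ξ hξ => ?_)⟩
  · obtain ⟨n, rfl⟩ := exists_rankIn_eq hξ
    -- `f` is an order embedding, hence it dominates the rank.
    suffices h : ∀ n, rankIn (codedRel t) n ≤ f n from (h n).trans_lt (hδ n)
    intro n
    induction h : f n using WellFoundedLT.induction generalizing n with
    | _ a ih =>
      subst h
      refine le_of_forall_lt fun ξ hξ => ?_
      obtain ⟨m, rfl, hm⟩ := exists_rankIn_eq_of_lt hξ
      have := (ht m n).1 hm
      exact (ih _ this m rfl).trans_lt this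
  · suffices h : ∀ ξ < δ, ξ ≤ rankIn (codedRel t) (g ξ) from (h ξ hξ).trans_lt (rankIn_lt _)
    intro ξ
    induction ξ using WellFoundedLT.induction with
    | _ ξ ih =>
      refine fun hξ => le_of_forall_lt fun ζ hζ => ?_
      exact (ih ζ hζ (hζ.trans hξ)).trans_lt
        (rankIn_lt_rankIn.2 ((ht _ _).2 (hg ζ ξ hζ hξ)))

/-- At the exact rank, the bound has no effect. -/
theorem rankMin_eq {E : ℕ → ℕ → Prop} {n : ℕ} {u d : Ordinal.{u}} (hu : u < d)
    (h1 : rankLT E (u + 1) n) (h2 : ¬ rankLT E u n) : rankMin E n d = u := by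
  refine eq_of_forall_lt_iff fun ξ => ?_
  rw [lt_rankMin_iff]
  refine ⟨fun h => h.2 u h1, fun h => ⟨h.trans hu, fun γ hγ => h.trans_le ?_⟩⟩
  by_contra hlt
  exact h2 (rankLT_mono (Order.add_one_le_of_lt (not_le.1 hlt)) hγ)

/-! ### Runs of the universal machine on the empty tape -/

theorem Config.step_of_halted {p : Program} {c : Config.{u} p} (h : c.Halted) (δ : Ordinal.{u}) :
    c.step δ = c := by
  unfold Config.step
  rw [show p.next c.state c.read = none from h]

theorem runFrom_of_halted {p : Program} {δ : Ordinal.{u}} {c : Config.{u} p} (h : c.Halted)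
    (hh : c.head < δ) (t : Ordinal.{u}) : runFrom δ c t = c := by
  induction t using Ordinal.limitRecOn with
  | zero => simp
  | add_one t ih => rw [runFrom_add_one, ih, c.step_of_halted h]
  | limit μ hμ ih =>
    have h0 := hμ.bot_lt
    have e := funext fun β : Set.Iio μ => ih β.1 β.2
    have hne : Nonempty (Set.Iio μ) := ⟨⟨0, h0⟩⟩
    rw [runFrom_limit _ _ hμ, e]
    refine Config.ext' ?_ ?_ ?_
    · exact Filter.liminf_const _
    · simp only [Config.limit, Filter.liminf_const, hh, if_true]
    · funext k ξ
      exact Filter.liminf_const _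

/-- After halting, the final snapshot is kept also through limit times. -/
theorem run_of_halted {p : Program} {δ τ τ' : Ordinal.{u}} (h : (run δ p τ).Halted)
    (hh : (run δ p τ).head < δ) (hτ : τ ≤ τ') : run δ p τ' = run δ p τ := by
  obtain ⟨s, rfl⟩ := exists_add_of_le hτ
  rw [run_eq_runFrom, runFrom_add, ← run_eq_runFrom, runFrom_of_halted h hh]

section

variable {d : Ordinal.{u}} {Λ : Layout} {root : Cmd Λ.Tr} {tail : List Move}

theorem bootConf_empty : bootConf root tail (fun _ _ _ => False : Λ.Tape d) =
    (Λ.machine root tail).conf (Ordinal.omega0 * d) none fun _ _ => false := by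
  unfold bootConf
  congr 1
  funext ξ t
  simp [lin]

theorem reaches_of_bootConf (hd : 0 < d) {β t : Ordinal.{u}}
    (h1 : (runFrom (Ordinal.omega0 * d)
      (bootConf root tail (fun _ _ _ => False : Λ.Tape d)) t).Halted)
    (h2 : (runFrom (Ordinal.omega0 * d)
      (bootConf root tail (fun _ _ _ => False : Λ.Tape d)) t).head = β) :
    Reaches (Ordinal.omega0 * d) (Λ.machine root tail).program β := by
  refine ⟨t + 1, ?_⟩
  rw [PassMachine.run_eq (closed hd) (pos_iff_ne_zero.2 (by simp)), ← bootConf_empty,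
    runFrom_add_one, Config.step_of_halted h1]
  exact ⟨h1, h2⟩

end

theorem natCast_blockLen_mul (x : Ordinal.{u}) (y : ℕ) :
    (blockLen : Ordinal.{u}) * (Ordinal.omega0 * x + y) =
      Ordinal.omega0 * x + (blockLen * y : ℕ) := by
  rw [mul_add, ← mul_assoc, Ordinal.natCast_mul_omega0 (n := blockLen) (Nat.succ_pos _),
    Ordinal.natCast_mul]

/-- The track `out` becomes the beginning of the third tape. -/
theorem exists_tape_of_reach {d : Ordinal.{u}} (hd : 0 < d) {root : Cmd Track} {tail : List Move}
    {V : layout.Tape d} (h : Reach (Λ := layout) root tail (fun _ _ _ => False) V) :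
    ∃ τ, ∀ n : ℕ, (run (Ordinal.omega0 * d) (layout.machine root tail).program τ).tape 2
      (n : Ordinal.{u}) = true ↔
        V ⟨0, hd⟩ (n / blockLen) (.out ⟨n % blockLen, Nat.mod_lt _ (Nat.succ_pos _)⟩) := by
  obtain ⟨l, hl, e, -⟩ := h
  refine ⟨l, fun n => ?_⟩
  rw [PassMachine.run_eq (closed hd) hl, ← bootConf_empty, e]
  have hn : (n : Ordinal.{u}) = (blockLen : Ordinal.{u}) * (n / blockLen : ℕ) +
      (n % blockLen : ℕ) := by
    rw [← Ordinal.natCast_mul, ← Nat.cast_add, Nat.div_add_mod]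
  have hlt : (n : Ordinal.{u}) < Ordinal.omega0 * d := by
    simpa using mul_add_lt_mul hd n
  have h1 := PassMachine.flat_pos (M := layout.machine root tail) (δ := Ordinal.omega0 * d)
    (W := lin root tail V) (ξ := (n / blockLen : ℕ))
    (.out ⟨n % blockLen, Nat.mod_lt _ (Nat.succ_pos _)⟩) (by
      refine lt_of_eq_of_lt ?_ hlt
      exact hn.symm)
  have h2 := lin_apply (root := root) (tail := tail) V ⟨0, hd⟩ (n / blockLen)
  simp only [mul_zero, zero_add] at h2
  rw [h2] at h1
  rw [hn]
  show (layout.machine root tail).flat (Ordinal.omega0 * d) (lin root tail V) 2 _ = true ↔ _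
  refine (Bool.eq_iff_iff.1 h1).trans ?_
  simp

/-- If the work on the first row is begun with the data `D`, the order of the places appears. -/
theorem exists_codedRel_place {d : Ordinal.{u}} (hd : 0 < d) {tail : List Move} {D : ℕ → Row.{u}}
    (h : Reach (Λ := layout) (Prog.root none) tail (fun _ _ _ => False)
      (enc d ((Rec.begin D 0 fun _ _ => False).pred d))) :
    ∃ τ, ∀ m n, codedRel ((run (Ordinal.omega0 * d)
      (layout.machine (Prog.root none) tail).program τ).tape 2) m n ↔
        place d D m < place d D n := by
  set r := (Rec.begin D 0 fun _ _ => False).pred d with hr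
  have hR : r.Ready := ready_begin_pred D 0 _
  obtain ⟨P, O, h1, h2⟩ := reach_step_stage (par := none) (tail := tail) (d := d)
    (r := { r with p0 := True, p1 := False }) hd trivial id
    ⟨hR.a, hR.b, hR.j, hR.ma, hR.mb, hR.jr⟩ (by simp [r, Rec.begin, Rec.start, Rec.pred])
    (.inr fun _ _ h => h)
  have h3 := (h.trans (reach_skip_test hd hR.p1 hR.p0 hR.jr hR.j rfl) fun _ _ _ h _ =>
    h.elim).trans h1 fun _ _ _ h _ => h.elim
  obtain ⟨τ, hτ⟩ := exists_tape_of_reach hd h3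
  refine ⟨τ, fun m n => (hτ (Nat.pair m n)).trans ?_⟩
  have hplace : ∀ z, place d r.D z = place d D z := by
    intro z
    unfold place
    by_cases hz : z = 0
    · subst hz
      have : (r.D 0) = (D 0).norm d := by simp [r, Rec.begin, Rec.start, Rec.pred]
      rw [this, if_pos (Row.norm_h_lt hd _)]
      rfl
    · have : r.D z = D z := by simp [r, Rec.begin, Rec.start, Rec.pred, hz]
      rw [this]
  have := h2 (fun _ _ h => h) (Nat.pair m n)
  rw [Nat.unpair_pair] at this
  simp only [hplace] at this
  rw [← this]
  simp [enc, Rec.stageEnd, Nat.div_add_mod]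

theorem place_injective (d : Ordinal.{u}) (D : ℕ → Row.{u}) : Function.Injective (place d D) := by
  intro m n h
  unfold place at h
  have h1 := h.not_lt
  have h2 := h.not_gt
  rw [mul_add_lt_mul_add] at h1 h2
  push Not at h1 h2
  have e := le_antisymm h2.1 h1.1
  exact le_antisymm (h2.2 e.symm) (h1.2 e)

theorem place_lt {d : Ordinal.{u}} (hd : 0 < d) (D : ℕ → Row.{u}) (z : ℕ) :
    place d D z < Ordinal.omega0 * d :=
  mul_add_lt_mul (Row.norm_h_lt hd (D z)) z

end ITTM

namespace ITTM

open Track Base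

variable {δ : Ordinal.{u}}

/-! ### The equivalence -/

theorem beginRec_next (d κ : Ordinal.{u}) (c : ℕ) : beginRec d table κ (c + 1) =
    Rec.begin (Function.update (rows d table κ c) c ((rows d table κ c c).cycle d (table c)))
      (c + 1) (succDigits (table c)) := by
  rw [beginRec, rows_add_one, succDigits_table]

/-- The work on a row of the universal machine, when the machine goes on after the test. -/
theorem reach_beginRec_next {par : Par} {tail : List Move} (hω : Ordinal.omega0 ≤ δ)
    {κ : Ordinal.{u}} {c : ℕ}
    (ht : Reach (Λ := layout) (Prog.root par) tail (enc δ ((beginRec δ table κ c).pred δ))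
      (enc δ { (beginRec δ table κ c).pred δ with p0 := True, p1 := False })) :
    Reach (Λ := layout) (Prog.root par) tail (enc δ ((beginRec δ table κ c).pred δ))
      (enc δ (beginRec δ table κ (c + 1))) := by
  rw [beginRec_next]
  exact reach_begin_next hω (exists_table_lt c) ht

theorem describes_run_table (hδ : IsSuccLimit δ) (p : Program) : ∃ y, ∀ κ : Ordinal.{u},
    ((rowPre δ (table y) κ).norm δ).Describes (run δ p κ) := by
  obtain ⟨y, hy⟩ := p.exists_table
  exact ⟨y, fun κ => by rw [hy]; exact describes_run hδ p κ⟩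

/-- If all cells are reached, the final positions of all programs give a code for `δ`. -/
theorem exists_code_of_reaches (hδ : IsSuccLimit δ) (hω : Ordinal.omega0 ≤ δ)
    (hmul : Ordinal.omega0 * δ = δ) (h : ∀ α < δ, ∃ p : Program, Reaches δ p α) :
    ∃ (p : Program) (τ : Ordinal.{u}) (k : Fin 3), CodesWellOrder ((run δ p τ).tape k) δ := by
  have hd0 : 0 < δ := hδ.bot_lt
  choose p τ hp hα using fun α : Set.Iio δ => h α.1 α.2
  choose y hy using fun α : Set.Iio δ => describes_run_table hδ (p α)
  -- At this time all the programs `p α` have halted.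
  set κ : Ordinal.{u} := ⨆ α, τ α with hκ
  -- Row `y α` shows the final head position of `p α`.
  have hrow : ∀ α : Set.Iio δ, ((rows δ table κ 0 (y α)).norm δ).h = α.1 := by
    intro α
    have e : run δ (p α) κ = run δ (p α) (τ α) :=
      run_of_halted (hp α) ((hα α).trans_lt α.2) (Ordinal.le_iSup τ α)
    rw [← hα α, ← e]
    exact (hy α κ).h
  have hreach : Reach (Λ := layout) (Prog.root none) [] (fun _ _ _ => False)
      (enc δ ((Rec.begin (rows δ table κ 0) 0 fun _ _ => False).pred δ)) := by
    have h1 := reach_allTape (par := none) (tail := []) hδ table_zero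
      (J := Ordinal.omega0 * κ + (2 * 0 + 1 : ℕ)) (by simp) fun κ' c _ =>
        have hr := ready_begin_pred (d := δ) (rows δ table κ' c) c (table c)
        reach_beginRec_next hω (reach_skip_test hd0 hr.p1 hr.p0 hr.jr hr.j rfl)
    rw [allTape_mul_add, roundTape_odd, beginRec, table_zero] at h1
    exact h1
  obtain ⟨t, ht⟩ := exists_codedRel_place hd0 hreach
  rw [hmul] at ht
  classical
  refine ⟨_, t, 2, codesWellOrder_of_place ht (place_injective _ _)
    (fun n => (place_lt hd0 _ n).trans_eq hmul)
    (fun ξ => if hξ : ξ < δ then y ⟨ξ, hξ⟩ else 0) fun ξ ξ' hlt hξ' => ?_⟩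
  simp only [hlt.trans hξ', hξ', dite_true]
  refine mul_add_lt_mul_add.2 (.inl ?_)
  refine lt_of_eq_of_lt (hrow ⟨ξ, hlt.trans hξ'⟩) (hlt.trans_eq (hrow ⟨ξ', hξ'⟩).symm)

/-- On tapes of length `ω` the order of the places of the cells in the first row of blocks is the
order of the natural numbers. -/
theorem exists_code_omega0 : ∃ (p : Program) (τ : Ordinal.{u}) (k : Fin 3),
    CodesWellOrder ((run Ordinal.omega0 p τ).tape k) Ordinal.omega0 := by
  let D : ℕ → Row.{u} := fun _ => ⟨fun _ _ => False, 0, 0⟩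
  have h1 := reach_init (par := none) (tail := []) (one_pos (α := Ordinal.{u})) D False
  have e : pre (1 : Ordinal.{u}) D False = fun _ _ _ => False := by
    funext x y t
    rcases t with o | _ | _ <;> try rfl
    cases o <;> simp [pre, D]
  rw [e] at h1
  have h2 := reach_begin_pred (par := none) (tail := []) (one_pos (α := Ordinal.{u})) (D := D)
    (c := 0) (dg := fun _ _ => False) zero_le (fun h => absurd h zero_ne_one)
  obtain ⟨τ, hτ⟩ := exists_codedRel_place one_pos (h1.trans h2 fun _ _ _ h _ => h.elim)
  have hplace : ∀ n, place 1 D n = n := fun n => by simp [place, D]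
  simp only [hplace, mul_one] at hτ
  exact ⟨_, τ, 2, codesWellOrder_of_place hτ Nat.cast_injective Ordinal.natCast_lt_omega0 index
    fun ξ ξ' h h' => by
      obtain ⟨n, rfl⟩ := Ordinal.lt_omega0.1 h'
      obtain ⟨m, rfl⟩ := Ordinal.lt_omega0.1 (h.trans h')
      simpa using h⟩

theorem foldl_replicate_right (hδ : IsSuccLimit δ) (v : ℕ) {ξ : Ordinal.{u}} (hξ : ξ < δ) :
    (List.replicate v Move.right).foldl (fun h m => m.apply δ h) ξ = ξ + v := by
  induction v generalizing ξ with
  | zero => simp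
  | succ v ih =>
    have h := hδ.add_one_lt hξ
    rw [List.replicate_succ, List.foldl_cons,
      show Move.right.apply δ ξ = ξ + 1 by simp [Move.apply, h], ih h, add_assoc,
      ← Nat.cast_one, ← Nat.cast_add, add_comm 1 v]

theorem foldl_replicate_left (v : ℕ) (ξ : Ordinal.{u}) :
    (List.replicate v Move.left).foldl (fun h m => m.apply δ h) (ξ + v) = ξ := by
  induction v with
  | zero => simp
  | succ v ih =>
    have h : Move.left.apply δ (ξ + (v + 1 : ℕ)) = ξ + v := by
      rw [Nat.cast_succ, ← add_assoc]
      simp [Move.apply]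
    rw [List.replicate_succ, List.foldl_cons, h, ih]

theorem exists_reaches_omega0 (n : ℕ) :
    ∃ p : Program, Reaches (Ordinal.omega0 : Ordinal.{u}) p n := by
  have h := exists_halted_of_halts (Λ := layout) (d := (1 : Ordinal.{u}))
    (root := .halt fun _ => True) (by simp) one_pos (V := fun _ _ _ => False)
    (Halts.halt (tail := List.replicate n .right) one_pos (x₀ := ⟨0, Set.mem_Iio.2 one_pos⟩)
        (y₀ := 0) trivial
      (by
        rintro x y (h | ⟨-, h⟩)
        · exact absurd (Subtype.mk_lt_mk.1 h) not_lt_zero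
        · exact absurd h (Nat.not_lt_zero _)))
  obtain ⟨t, h1, h2⟩ := h
  have := reaches_of_bootConf one_pos h1 h2
  simp only [mul_one, mul_zero, Nat.cast_zero, add_zero] at this
  rw [foldl_replicate_right Ordinal.isSuccLimit_omega0 n Ordinal.omega0_pos, zero_add] at this
  exact ⟨_, this⟩

/-- If a code for `δ` appears, the universal machine with the test on the tape `kk` finds a relation
with ranks of all values below `δ`, and each such value can be used to find a cell. -/
theorem exists_reaches_of_code (hδ : IsSuccLimit δ) (hω : Ordinal.omega0 ≤ δ)
    (hmul : Ordinal.omega0 * δ = δ) {p : Program} {τ : Ordinal.{u}} {kk : Fin 3}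
    (h : CodesWellOrder ((run δ p τ).tape kk) δ) {α : Ordinal.{u}} (hα : α < δ) :
    ∃ p : Program, Reaches δ p α := by
  have hd0 : 0 < δ := hδ.bot_lt
  let good (κ : Ordinal.{u}) (c : ℕ) : Prop := ∀ β < δ, ∃ n,
    rankLT (((beginRec δ table κ c).pred δ).rel kk) (β + 1) n ∧
      ¬ rankLT (((beginRec δ table κ c).pred δ).rel kk) β n
  have hgood : ∃ κ c, good κ c := by
    obtain ⟨y, hy⟩ := describes_run_table hδ p
    obtain ⟨hwo, htype⟩ := h
    refine ⟨τ, y, ?_⟩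
    have hrel : ((beginRec δ table τ y).pred δ).rel kk = codedRel ((run δ p τ).tape kk) := by
      funext m n
      refine propext (Iff.trans ?_ ((hy τ).X kk (Nat.pair m n : ℕ)))
      simp [Rec.rel, Rec.pred, beginRec, Rec.begin, Rec.start, rows]
    intro β hβ
    rw [hrel]
    rw [← htype] at hβ
    obtain ⟨n, rfl⟩ := exists_rankIn_eq hβ
    exact ⟨n, rankLT_iff_rankIn_lt.2 (Order.lt_add_one_iff.2 le_rfl),
      fun h => lt_irrefl _ (rankLT_iff_rankIn_lt.1 h)⟩
  -- The first test which succeeds. It does not depend on the distinguished number, which therefore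
  -- can be chosen afterwards, with rank `α / ω`.
  let S : Set Ordinal.{u} := {j | ∃ κ c, j = Ordinal.omega0 * κ + (2 * c + 1 : ℕ) ∧ good κ c}
  obtain ⟨κ, c, hJ, hκ⟩ : sInf S ∈ S := csInf_mem (by
    obtain ⟨κ, c, h⟩ := hgood
    exact ⟨_, κ, c, rfl, h⟩)
  have hfirst : ∀ κ' c', Ordinal.omega0 * κ' + (2 * c' + 1 : ℕ) < sInf S → ¬ good κ' c' :=
    fun κ' c' hlt hg => notMem_of_lt_csInf' hlt ⟨κ', c', rfl, hg⟩
  have hu : α / Ordinal.omega0 < δ := by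
    rw [← Ordinal.lt_mul_iff_div_lt Ordinal.omega0_ne_zero, hmul]
    exact hα
  obtain ⟨n, hn1, hn2⟩ := hκ _ hu
  -- The run halts at cell `ω * (α / ω) + blockLen * c`; the tail leads from there to `α`.
  set tail : List Move := List.replicate (blockLen * c) .left ++
    List.replicate (finPart α) .right with htail
  have hreach : Reach (Λ := layout) (Prog.root (some (n, kk))) tail (fun _ _ _ => False)
      (enc δ ((beginRec δ table κ c).pred δ)) := by
    have h1 := reach_allTape (par := some (n, kk)) (tail := tail) hδ table_zero (J := sInf S)
      (by
        rw [hJ]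
        exact (pos_iff_ne_zero.2 (Nat.cast_ne_zero.2 (Nat.succ_ne_zero _))).trans_le
          (le_add_of_nonneg_left zero_le))
      fun κ' c' hlt => reach_beginRec_next hω
        (reach_test_fail hω (ready_begin_pred _ _ _) (hfirst κ' c' hlt))
    rwa [hJ, allTape_mul_add, roundTape_odd] at h1
  have hr : rankMin (((beginRec δ table κ c).pred δ).rel kk) n δ = α / Ordinal.omega0 :=
    rankMin_eq hu hn1 hn2
  obtain ⟨t, h1, h2⟩ := Stops.of_reach hreach
    (stops_of_ranks hω (ready_begin_pred _ _ _) hκ (hr.trans_lt hu))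
  have := reaches_of_bootConf hd0 h1 h2
  rw [hr, hmul, natCast_blockLen_mul, htail, List.foldl_append] at this
  have e : ((beginRec δ table κ c).pred δ).cur = c := rfl
  have hlt : Ordinal.omega0 * (α / Ordinal.omega0) < δ := (Ordinal.mul_div_le _ _).trans_lt hα
  rw [e, foldl_replicate_left, foldl_replicate_right hδ _ hlt, ← eq_mul_add] at this
  exact ⟨_, this⟩

end ITTM

theorem theorem3p1 (δ : Ordinal.{u}) (hδ : PrimRecClosed δ) :
    (∀ α < δ, ∃ p : ITTM.Program, ITTM.Reaches δ p α) ↔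
      ∃ (p : ITTM.Program) (τ : Ordinal.{u}) (k : Fin 3),
        ITTM.CodesWellOrder ((ITTM.run δ p τ).tape k) δ := by
  have hlim := hδ.isSuccLimit
  have hω : Ordinal.omega0 ≤ δ := Ordinal.omega0_le_of_isSuccLimit hlim
  rcases hω.eq_or_lt with rfl | hlt
  · refine iff_of_true (fun α hα => ?_) ITTM.exists_code_omega0
    obtain ⟨n, rfl⟩ := Ordinal.lt_omega0.1 hα
    exact ITTM.exists_reaches_omega0 n
  · have hmul := hδ.omega0_mul_eq hlt
    exact ⟨ITTM.exists_code_of_reaches hlim hω hmul, fun ⟨p, τ, k, h⟩ α hα =>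
      ITTM.exists_reaches_of_code hlim hω hmul h hα⟩
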